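/- **Setting.** Closed planar curves are maps $\gamma:\mathbb R/\mathbb Z\to\mathbb R^2$. A *generic immersion* is a $C^1$-immersion all of whose self-intersections are transverse double points. Let $S(\gamma)=\{(u,v): 0\le u<v<1,\ \gamma(u)=\gamma(v)\}$, let $T(\gamma)$ be the finite set of all parameters occurring in $S(\gamma)$, let $d_\gamma$ be the intrinsic distance along $\gamma$, and let $\Lambda(\gamma)=\min\{d_\gamma(a,b): a,b\in T(\gamma),\,a\neq b\}$ (with $\min\emptyset=\infty$). $W(\gamma)$ denotes the winding number (degree of $\gamma'/|\gamma'|$), and $J^+,J^-,\mathrm{St}$ denote Arnold's invariants of generic immersions. They are normalized on a representative curve of each winding number $\omega$ (a figure eight for $\omega=0$, a circle with $|\omega|-1$ small interior kinks and suitable orientation for $\omega\ne0$) by $(J^+,J^-,\mathrm{St})=(0,-1,0)$ for $\omega=0$ and $(-2(|\omega|-1),-3(|\omega|-1),|\omega|-1)$ for $\omega\neq0$. Along a generic regular homotopy, $J^+$ changes by $+2$ at a positive crossing of a direct self-tangency, $J^-$ by $-2$ at a positive crossing of an inverse self-tangency, $\mathrm{St}$ by $+1$ at a positive crossing of a transverse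 triple point, with the opposite changes at negative crossings, and each invariant is otherwise unchanged. A self-tangency crossing is positive if the number of double points increases; the sign of a triple point crossing is that of the newborn triangle, namely $(-1)^k$, where $k$ is the number of its sides on which the orientation of the curve agrees with the orientation of the triangle given by the cyclic order in which the curve visits the sides. For integers $j_+,j_-,s,\omega$, a *$(j_\pm,s,\omega)$-compartment* is a path component, with respect to regular ($C^1$-continuous) homotopy, of the set of generic immersions with $J^+=j_+$, $J^-=j_-$, $\mathrm{St}=s$, $W=\omega$. For $\eta\in(0,1)$ let $\mathcal F(\eta,j_\pm,s,\omega)$ be the set of all generic immersions $\gamma$ parametrized by arclength with these invariants, with $\Lambda(\gamma)\ge 2\eta$, and such that $\gamma$ is affine linear on $(u-\eta,u+\eta)$ for every $u\in T(\gamma)$. For $\delta>0$ let $Y_\delta(\gamma)$ be the set of $(x,y)\in(\mathbb R/\mathbb Z)^2$ such that, for some $(u,v)\in S(\gamma)$, either $d_\gamma(x,u)<\delta$ and $d_\gamma(y,v)<\delta$, or $d_\gamma(x,v)<\delta$ and $d_\gamma(y,u)<\delta$. For $q>2$ put $$\mathrm{TP}_{q,\delta}(\gamma)=\iint_{(\mathbb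 R/\mathbb Z)^2\setminus Y_\delta(\gamma)}\left(\frac{2\,\mathrm{dist}\big(\gamma(t)+\mathbb R\gamma'(t),\gamma(s)\big)}{|\gamma(t)-\gamma(s)|^2}\right)^q|\gamma'(s)||\gamma'(t)|\,ds\,dt\in[0,\infty].$$ **Theorem 1.5** (Limit immersion is almost-minimizer). Let $\mathcal C=\mathcal C(j_\pm,s,\omega)$ be a non-empty compartment. There exists $\eta_1\in(0,1)$ such that $(\ast)$ for every $\eta\in(0,\eta_1]$ the set $\mathcal F(\eta,j_\pm,s,\omega)\cap\mathcal C$ contains a curve of class $C^{1,1}$ all of whose self-intersection angles equal $\frac\pi2$. Let $\eta_1=\eta_1(\mathcal C)\in(0,1)$ be any number with property $(\ast)$, and let $q>2$ and $\eta\in(0,\eta_1]$. Let $\delta_k\in(0,\frac\eta2]$ with $\delta_k\to0$, and for each $k$ let $\gamma_k$ be a minimizer of $\mathrm{TP}_{q,\delta_k}$ in $\mathcal F(\eta,j_\pm,s,\omega)\cap\mathcal C$. Then, after suitable translations of the $\gamma_k$ in the plane, a subsequence of $(\gamma_k)$ converges in $C^1$ to a curve $$\Gamma^\eta\in\mathcal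 F(\eta,j_\pm,s,\omega)\cap\mathcal C\cap W^{2-\frac1q,q}(\mathbb R/\mathbb Z,\mathbb R^2)$$ such that all intersection angles of $\Gamma^\eta$ equal $\frac\pi2$, and such that for every $\epsilon>0$ there is $\hat\delta>0$ with $$\inf_{\mathcal F(\eta,j_\pm,s,\omega)\cap\mathcal C}\mathrm{TP}_{q,\delta}\ \le\ \mathrm{TP}_{q,\delta}(\Gamma^\eta)\ <\ \inf_{\mathcal F(\eta,j_\pm,s,\omega)\cap\mathcal C}\mathrm{TP}_{q,\delta}+\epsilon\qquad\text{for all }\delta\in(0,\hat\delta).$$ -/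

import Mathlib

open Set Filter Topology MeasureTheory
open scoped ENNReal

/-! Closed planar curves are `1`-periodic functions `γ : ℝ → ℂ`; the circle `ℝ/ℤ` is represented by
the fundamental domain `[0,1)` and the Euclidean plane by `ℂ`. -/

namespace ArnoldLoop

noncomputable section

/-! ### Immersed loops, self-intersections, generic immersions -/

/-- A closed immersed planar curve of class `C¹`. -/
structure IsImmersedLoop (γ : ℝ → ℂ) : Prop where
  periodic : Function.Periodic γ 1
  contDiff : ContDiff ℝ 1 γ
  deriv_ne_zero : ∀ x, deriv γ x ≠ 0

/-- The set `S(γ)` of parameter pairs `u < v` in `[0,1)` with `γ(u) = γ(v)`. -/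
def selfInt (γ : ℝ → ℂ) : Set (ℝ × ℝ) :=
  {p | p.1 ∈ Ico (0 : ℝ) 1 ∧ p.2 ∈ Ico (0 : ℝ) 1 ∧ p.1 < p.2 ∧ γ p.1 = γ p.2}

/-- The set `T(γ)` of all parameters in `[0,1)` of self-intersection points. -/
def selfIntParams (γ : ℝ → ℂ) : Set ℝ :=
  {u | ∃ p ∈ selfInt γ, u = p.1 ∨ u = p.2}

/-- The tangent vectors at the parameters `u` and `v` span the plane. -/
def TransverseAt (γ : ℝ → ℂ) (u v : ℝ) : Prop :=
  LinearIndependent ℝ ![deriv γ u, deriv γ v]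

/-- The three parameters `u < v < w` in `[0,1)` have the same image point. -/
def IsTriple (γ : ℝ → ℂ) (u v w : ℝ) : Prop :=
  (u, v) ∈ selfInt γ ∧ (v, w) ∈ selfInt γ

/-- Generic immersions: all self-intersections are transverse double points. -/
structure IsGeneric (γ : ℝ → ℂ) : Prop where
  immersed : IsImmersedLoop γ
  transverse : ∀ p ∈ selfInt γ, TransverseAt γ p.1 p.2
  double : ∀ u v w, ¬ IsTriple γ u v w

/-- The winding number of `γ` is `ω`: a continuous angle function of the tangent vector increases
by `2πω` along one period. -/
def HasWindingNumber (γ : ℝ → ℂ) (ω : ℤ) : Prop :=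
  ∃ θ : ℝ → ℝ, Continuous θ ∧
    (∀ x, deriv γ x = (‖deriv γ x‖ : ℂ) * Complex.exp ((θ x : ℂ) * Complex.I)) ∧
    ∀ x, θ (x + 1) = θ x + 2 * Real.pi * ω

/-- A regular homotopy `(H t)`, `t ∈ [0,1]`: a path of immersed loops, continuous in the
`C¹`-topology. -/
structure IsRegularHomotopy (H : ℝ → ℝ → ℂ) : Prop where
  immersed : ∀ t ∈ Icc (0 : ℝ) 1, IsImmersedLoop (H t)
  cont : ContinuousOn (fun p : ℝ × ℝ => H p.1 p.2) (Icc (0 : ℝ) 1 ×ˢ univ)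
  cont_deriv : ContinuousOn (fun p : ℝ × ℝ => deriv (H p.1) p.2) (Icc (0 : ℝ) 1 ×ˢ univ)

/-! ### The good part of the discriminant and its signed crossings -/

/-- Immersions that are generic apart from exactly one self-tangency of multiplicity two, at the
parameters `a < b`, where `γ'(b) = c γ'(a)`. It is direct if `c > 0`, inverse if `c < 0`. -/
structure IsTangencyWith (γ : ℝ → ℂ) (a b c : ℝ) : Prop where
  immersed : IsImmersedLoop γ
  mem : (a, b) ∈ selfInt γ
  tangent : deriv γ b = c • deriv γ a
  transverse : ∀ p ∈ selfInt γ, p ≠ (a, b) → TransverseAt γ p.1 p.2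
  double : ∀ u v w, ¬ IsTriple γ u v w

/-- The stratum of exactly one direct self-tangency. -/
def directStratum : Set (ℝ → ℂ) := {γ | ∃ a b c : ℝ, 0 < c ∧ IsTangencyWith γ a b c}

/-- The stratum of exactly one inverse self-tangency. -/
def inverseStratum : Set (ℝ → ℂ) := {γ | ∃ a b c : ℝ, c < 0 ∧ IsTangencyWith γ a b c}

/-- Immersions that are generic apart from exactly one transverse triple point, at the parameters
`a < b < c` (uniqueness of the triple also excludes quadruple points). -/
structure IsTripleAt (γ : ℝ → ℂ) (a b c : ℝ) : Prop where
  immersed : IsImmersedLoop γ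
  triple : IsTriple γ a b c
  transverse : ∀ p ∈ selfInt γ, TransverseAt γ p.1 p.2
  unique : ∀ u v w, IsTriple γ u v w → u = a ∧ v = b ∧ w = c

/-- The path `H` crosses a self-tangency at time `t` with sign `ε`: the number of double points
changes by `2ε`. -/
def TangencySign (H : ℝ → ℝ → ℂ) (t : ℝ) (ε : ℤ) : Prop :=
  (ε = 1 ∨ ε = -1) ∧
    ∀ᶠ t₁ in 𝓝[<] t, ∀ᶠ t₂ in 𝓝[>] t,
      ((selfInt (H t₂)).ncard : ℤ) - ((selfInt (H t₁)).ncard : ℤ) = 2 * ε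

/-- `γ` has, within parameter distance `r` of `a`, `b`, `c`, a small triangle formed by the three
strands through `γ(a)`, `γ(b)`, `γ(c)`, and its sign is `ε`.
The strand near `a` meets the strand near `b` at the parameter `ab` and the strand near `c` at the
parameter `ac`, and similarly for the others. The cyclic order `a → b → c → a` in which the loop
visits the sides orients the triangle: the side on the strand near `a` goes from the vertex common
with `c` to the vertex common with `b`, and so on. If `k` is the number of sides on which this
orientation agrees with the one of the loop, then the sign of the triangle is `(-1)^k`. -/
def HasTriangleSign (γ : ℝ → ℂ) (a b c r : ℝ) (ε : ℤ) : Prop :=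
  ∃ ab ac ba bc ca cb : ℝ,
    |ab - a| < r ∧ |ac - a| < r ∧ |ba - b| < r ∧ |bc - b| < r ∧ |ca - c| < r ∧ |cb - c| < r ∧
    γ ab = γ ba ∧ γ bc = γ cb ∧ γ ca = γ ac ∧
    ab ≠ ac ∧ ba ≠ bc ∧ ca ≠ cb ∧
    ε = (if ac < ab then -1 else 1) * (if ba < bc then -1 else 1) * (if cb < ca then -1 else 1)

/-- The path `H` crosses, at time `t`, the stratum of exactly one transverse triple point, and the
sign of the newborn triangle is `ε`, the one of the dying triangle `-ε`. -/
def TripleCrossing (H : ℝ → ℝ → ℂ) (t : ℝ) (ε : ℤ) : Prop :=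
  (ε = 1 ∨ ε = -1) ∧ ∃ a b c : ℝ, IsTripleAt (H t) a b c ∧
    ∀ r > 0, (∀ᶠ t₁ in 𝓝[<] t, HasTriangleSign (H t₁) a b c r (-ε)) ∧
      ∀ᶠ t₂ in 𝓝[>] t, HasTriangleSign (H t₂) a b c r ε

/-- A generic path: a regular homotopy that leaves the generic immersions only at finitely many
times, namely at signed crossings of the direct self-tangency stratum (times in `D`), of the
inverse self-tangency stratum (times in `I`) and of the triple point stratum (times in `T`). The
crossing at time `t` has the sign `ε t`. -/
structure IsGenericPath (H : ℝ → ℝ → ℂ) (D I T : Finset ℝ) (ε : ℝ → ℤ) : Prop where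
  homotopy : IsRegularHomotopy H
  direct : ∀ t ∈ D, t ∈ Ioo (0 : ℝ) 1 ∧ H t ∈ directStratum ∧ TangencySign H t (ε t)
  inverse : ∀ t ∈ I, t ∈ Ioo (0 : ℝ) 1 ∧ H t ∈ inverseStratum ∧ TangencySign H t (ε t)
  triple : ∀ t ∈ T, t ∈ Ioo (0 : ℝ) 1 ∧ TripleCrossing H t (ε t)
  generic : ∀ t ∈ Icc (0 : ℝ) 1, t ∉ D → t ∉ I → t ∉ T → IsGeneric (H t)

/-! ### Arnold's representative curves and invariants -/

/-- The representative curve with winding number `ω`: a figure eight for `ω = 0`, and otherwise a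
circle with `|ω| - 1` small interior kinks (an epitrochoid), with the orientation given by the sign
of `ω`. -/
def arnoldRep (ω : ℤ) (x : ℝ) : ℂ :=
  if ω = 0 then
    (Real.sin (2 * Real.pi * x) : ℂ) + (Real.sin (4 * Real.pi * x) : ℂ) * Complex.I
  else
    Complex.exp (((2 * Real.pi * (ω.sign : ℝ) * x : ℝ) : ℂ) * Complex.I)
      + ((3 / (2 * |(ω : ℝ)|) : ℝ) : ℂ) *
        Complex.exp (((2 * Real.pi * (ω : ℝ) * x : ℝ) : ℂ) * Complex.I)

/-- Prescribed value of `J⁺` on the representative curve. -/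
def repJplus (ω : ℤ) : ℤ := if ω = 0 then 0 else -2 * (|ω| - 1)

/-- Prescribed value of `J⁻` on the representative curve. -/
def repJminus (ω : ℤ) : ℤ := if ω = 0 then -1 else -3 * (|ω| - 1)

/-- Prescribed value of `St` on the representative curve. -/
def repSt (ω : ℤ) : ℤ := if ω = 0 then 0 else |ω| - 1

/-- The generic immersion `γ` with winding number `ω` has the Arnold invariants `J⁺ = jp`,
`J⁻ = jm`, `St = s`: these values are obtained along a generic path from the representative curve
to `γ`, where `J⁺` increases by `2` at positive crossings of direct self-tangencies, `J⁻` by `-2` at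
positive crossings of inverse self-tangencies, and `St` by `1` at positive crossings of triple
points. By Arnold's theorem the values do not depend on the path. -/
def HasArnoldInvariants (γ : ℝ → ℂ) (jp jm s ω : ℤ) : Prop :=
  ∃ (H : ℝ → ℝ → ℂ) (D I T : Finset ℝ) (ε : ℝ → ℤ),
    IsGenericPath H D I T ε ∧ H 0 = arnoldRep ω ∧ H 1 = γ ∧
    jp = repJplus ω + 2 * ∑ t ∈ D, ε t ∧
    jm = repJminus ω - 2 * ∑ t ∈ I, ε t ∧
    s = repSt ω + ∑ t ∈ T, ε t

/-- All generic immersions with `J⁺ = jp`, `J⁻ = jm`, `St = s` and winding number `ω`. -/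
def genericClass (jp jm s ω : ℤ) : Set (ℝ → ℂ) :=
  {γ | IsGeneric γ ∧ HasWindingNumber γ ω ∧ HasArnoldInvariants γ jp jm s ω}

/-- `C` is a (non-empty) `(j±,s,ω)`-compartment: a path component, with respect to regular homotopy,
of the set of all generic immersions with the prescribed invariants. -/
def IsCompartment (jp jm s ω : ℤ) (C : Set (ℝ → ℂ)) : Prop :=
  ∃ γ₀ ∈ genericClass jp jm s ω,
    C = {γ | ∃ H : ℝ → ℝ → ℂ, IsRegularHomotopy H ∧ H 0 = γ₀ ∧ H 1 = γ ∧
      ∀ t ∈ Icc (0 : ℝ) 1, H t ∈ genericClass jp jm s ω}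

/-! ### The truncated tangent-point energy -/

/-- Intrinsic distance along the closed curve between the parameters `x` and `y` (mod `1`). -/
def intrinsicDist (γ : ℝ → ℂ) (x y : ℝ) : ℝ :=
  ⨅ k : ℤ, |∫ t in x..(y + k), ‖deriv γ t‖|

/-- `Λ(γ)`: the shortest intrinsic distance between two different parameters in `T(γ)`
(it is `∞` for embedded curves). -/
def minGap (γ : ℝ → ℂ) : ℝ≥0∞ :=
  ⨅ a ∈ selfIntParams γ, ⨅ b ∈ selfIntParams γ, ⨅ _ : a ≠ b, ENNReal.ofReal (intrinsicDist γ a b)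

/-- The region `Y_δ(γ)` that is cut out of the domain of integration. -/
def cutout (δ : ℝ) (γ : ℝ → ℂ) : Set (ℝ × ℝ) :=
  {z | ∃ p ∈ selfInt γ,
    (intrinsicDist γ z.1 p.1 < δ ∧ intrinsicDist γ z.2 p.2 < δ) ∨
    (intrinsicDist γ z.1 p.2 < δ ∧ intrinsicDist γ z.2 p.1 < δ)}

/-- The affine tangent line of `γ` at the parameter `t`. -/
def tangentLine (γ : ℝ → ℂ) (t : ℝ) : Set ℂ := range fun r : ℝ => γ t + r • deriv γ t

/-- The truncated tangent-point energy `TP_{q,δ}(γ) ∈ [0,∞]`. -/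
def truncatedTP (q δ : ℝ) (γ : ℝ → ℂ) : ℝ≥0∞ :=
  ∫⁻ z in (Ico (0 : ℝ) 1 ×ˢ Ico (0 : ℝ) 1) \ cutout δ γ,
    ENNReal.ofReal
      ((2 * Metric.infDist (γ z.1) (tangentLine γ z.2) / ‖γ z.2 - γ z.1‖ ^ 2) ^ q
        * ‖deriv γ z.1‖ * ‖deriv γ z.2‖)

/-! ### Admissible curves -/

/-- The class `F(η, j±, s, ω)` of admissible curves: generic immersions parametrized by arclength,
with the prescribed invariants and `Λ(γ) ≥ 2η`, that are affine linear within arclength `η` of every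
self-intersection parameter. -/
def admissible (η : ℝ) (jp jm s ω : ℤ) : Set (ℝ → ℂ) :=
  {γ | γ ∈ genericClass jp jm s ω ∧ (∀ x, ‖deriv γ x‖ = 1) ∧
    ENNReal.ofReal (2 * η) ≤ minGap γ ∧
    ∀ u ∈ selfIntParams γ, ∃ p v : ℂ, ∀ x ∈ Ioo (u - η) (u + η), γ x = p + x • v}

/-- The angle in `[0, π/2]` between the tangent lines of `γ` at the parameters `u` and `v`. -/
def intersectionAngle (γ : ℝ → ℂ) (u v : ℝ) : ℝ :=
  min (InnerProductGeometry.angle (deriv γ u) (deriv γ v))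
    (Real.pi - InnerProductGeometry.angle (deriv γ u) (deriv γ v))

/-- All intersection angles of `γ` equal `π/2`. -/
def RightAngled (γ : ℝ → ℂ) : Prop :=
  ∀ p ∈ selfInt γ, intersectionAngle γ p.1 p.2 = Real.pi / 2

/-- `η₁ ∈ (0,1)` is a threshold for `C`: for every `η ∈ (0,η₁]` some admissible curve in `C` of class
`C^{1,1}` intersects itself only at right angles. -/
def IsRightAngleThreshold (jp jm s ω : ℤ) (C : Set (ℝ → ℂ)) (η₁ : ℝ) : Prop :=
  η₁ ∈ Ioo (0 : ℝ) 1 ∧ ∀ η ∈ Ioc (0 : ℝ) η₁, ∃ γ ∈ admissible η jp jm s ω ∩ C,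
    (∃ K, LipschitzWith K (deriv γ)) ∧ RightAngled γ

/-- `γ` minimizes `TP_{q,δ}` in the class `A`. -/
def IsTPMinimizer (q δ : ℝ) (A : Set (ℝ → ℂ)) (γ : ℝ → ℂ) : Prop :=
  γ ∈ A ∧ ∀ ξ ∈ A, truncatedTP q δ γ ≤ truncatedTP q δ ξ

/-! ### Fractional Sobolev spaces and `C¹`-convergence -/

/-- The periodic fractional Sobolev space `W^{σ,p}(ℝ/ℤ, ℂ)`, `0 < σ < 1`: functions in `L^p` with
finite Gagliardo seminorm. -/
def MemFracSobolev (σ p : ℝ) (g : ℝ → ℂ) : Prop :=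
  Function.Periodic g 1 ∧
  MemLp g (ENNReal.ofReal p) (volume.restrict (Ico (0 : ℝ) 1)) ∧
  ∫⁻ x in Ico (0 : ℝ) 1, ∫⁻ w in Icc (-(1 / 2) : ℝ) (1 / 2),
    ENNReal.ofReal (‖g (x + w) - g x‖ ^ p / |w| ^ (1 + σ * p)) < ∞

/-- The periodic fractional Sobolev space `W^{1+σ,p}(ℝ/ℤ, ℂ)`, `0 < σ < 1`: absolutely continuous
functions whose (weak) derivative `g` belongs to `W^{σ,p}`. -/
def MemSobolevOneAdd (σ p : ℝ) (γ : ℝ → ℂ) : Prop :=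
  Function.Periodic γ 1 ∧ ∃ g : ℝ → ℂ, MemFracSobolev σ p g ∧ ∀ x, γ x = γ 0 + ∫ t in (0 : ℝ)..x, g t

/-- Convergence in `C¹`: uniform convergence of the curves and of their derivatives. -/
def TendstoC1 (f : ℕ → ℝ → ℂ) (Γ : ℝ → ℂ) : Prop :=
  TendstoUniformly f Γ atTop ∧ TendstoUniformly (fun k => deriv (f k)) (deriv Γ) atTop

end

end ArnoldLoop

open ArnoldLoop

namespace ArnoldLoop

/-! ### Lifted self-intersections -/

/-! Near its self-intersections an admissible curve consists of straight strands. For δ ≤ η the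
truncated energy therefore splits exactly (`truncatedTP_split`): TP_δ(γ) = TP_η(γ) + Σ
crossEnergy(δ, η, c), summed over the ordered pairs of crossing parameters, with c the inner product
of the two unit tangents. The first term does not depend on δ. The second sees only the angles.

The crossing energy can be minimized by hand. In slope coordinates it is the product of a radial
integral, at least a multiple of δ^(2-q) once δ ≤ η/2, and an angular integral. An affine
substitution and a symmetrization show that the angular integral exceeds its value at c = 0 by at
least (√(1-c²))^(1-q) - 1 (`crossEnergy_eq_slope`, `lintegral_slopeDensity_ge`). The number of
crossings is constant on a compartment. So if ζ is right-angled and TP_δ(γ) + E ≤ TP_δ(ζ), the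
finite energies of right-angled crossings cancel, which leaves TP_η(γ) + E ≤ TP_η(ζ) and a bound by
TP_η(ζ) on the excess of each crossing of γ (`IsStraightGeneric.compare`). As δ → 0 the radial
factor blows up, so the angles are forced to π/2 (`exists_angle_bound`).

Compactness rests on the bound for TP_η. The kernel sees tangent lines and not oriented tangents, so
near the diagonal it controls the difference quotients of the squared tangent. A Morrey inequality
makes the squares, and then by continuity the tangents, equicontinuous (`exists_modulus`), and
Arzelà–Ascoli gives C¹ limits. The danger is that the limit touches itself where the approximating
curves do not cross. A near-contact at distance e without a crossing nearby costs energy of order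
e^(2-q), so this is impossible (`IsControlled.exists_cross_near`). Hence every crossing of the limit
is a limit of crossings; it is orthogonal, and a triple point would require three mutually
orthogonal directions in the plane. Gap and straightness pass to the limit, and stability of generic
immersions under C¹-small changes keeps it in the compartment. Fatou's lemma gives lower
semicontinuity of TP_η.

It follows that Γ minimizes TP_η among the right-angled curves of the class. If it were not almost
minimizing, there would be curves beating it by a fixed amount ε/2 for some δ_j → 0. They converge
to a right-angled curve whose TP_η is smaller by ε/2, a contradiction.

A threshold η₁ exists because any curve of the compartment can be deformed inside it: crossings are
made orthogonal by plane diffeomorphisms supported near them, the curve is smoothed and straightened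
at the crossings, and finally scaled and reparametrized by arclength
(`IsCompartment.exists_arclength`). -/

theorem periodic_add_int {E : Type*} {γ : ℝ → E} (h : Function.Periodic γ 1) (x : ℝ) (k : ℤ) :
    γ (x + k) = γ x := by
  simpa using h.int_mul k x

theorem periodic_fract {E : Type*} {γ : ℝ → E} (h : Function.Periodic γ 1) (x : ℝ) :
    γ (Int.fract x) = γ x := by
  have := periodic_add_int h (Int.fract x) ⌊x⌋
  rw [← this, Int.fract_add_floor]

theorem periodic_deriv {γ : ℝ → ℂ} (h : Function.Periodic γ 1) :
    Function.Periodic (deriv γ) 1 := by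
  intro x
  have : (fun y => γ (y + 1)) = γ := funext h
  conv_rhs => rw [← this]
  rw [deriv_comp_add_const]

/-- Parameters that are distinct on the circle and have the same image point. -/
def Cross (γ : ℝ → ℂ) (x y : ℝ) : Prop := (∀ k : ℤ, x ≠ y + k) ∧ γ x = γ y

/-- Ordered pairs of distinct parameters in `[0,1)` with the same image point. -/
def crossPairs (γ : ℝ → ℂ) : Set (ℝ × ℝ) :=
  {p | p.1 ∈ Ico (0 : ℝ) 1 ∧ p.2 ∈ Ico (0 : ℝ) 1 ∧ p.1 ≠ p.2 ∧ γ p.1 = γ p.2}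

theorem Cross.symm {γ : ℝ → ℂ} {x y : ℝ} (h : Cross γ x y) : Cross γ y x :=
  ⟨fun k hk => h.1 (-k) (by rw [hk]; push_cast; ring), h.2.symm⟩

theorem Cross.add_int {γ : ℝ → ℂ} (hp : Function.Periodic γ 1) {x y : ℝ} (h : Cross γ x y)
    (k l : ℤ) : Cross γ (x + k) (y + l) :=
  ⟨fun m hm => h.1 (l + m - k) (by push_cast; linarith), by
    rw [periodic_add_int hp, periodic_add_int hp, h.2]⟩

theorem Cross.fract {γ : ℝ → ℂ} (hp : Function.Periodic γ 1) {x y : ℝ} (h : Cross γ x y) :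
    Cross γ (Int.fract x) (Int.fract y) := by
  have := h.add_int hp (-⌊x⌋) (-⌊y⌋)
  simpa [Int.fract, sub_eq_add_neg] using this

theorem eq_of_Ico_of_eq_add_int {x y : ℝ} (hx : x ∈ Ico (0 : ℝ) 1) (hy : y ∈ Ico (0 : ℝ) 1)
    {k : ℤ} (h : x = y + k) : x = y := by
  have h1 : (k : ℝ) < 1 := by linarith [hx.2, hy.1]
  have h2 : (-1 : ℝ) < k := by linarith [hx.1, hy.2]
  have h3 : k < 1 := by exact_mod_cast h1
  have h4 : -1 < k := by exact_mod_cast h2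
  have : k = 0 := by omega
  simpa [this] using h

theorem cross_of_mem_crossPairs {γ : ℝ → ℂ} {p : ℝ × ℝ} (h : p ∈ crossPairs γ) :
    Cross γ p.1 p.2 :=
  ⟨fun _ hk => h.2.2.1 (eq_of_Ico_of_eq_add_int h.1 h.2.1 hk), h.2.2.2⟩

theorem fract_mem_Ico (x : ℝ) : Int.fract x ∈ Ico (0 : ℝ) 1 :=
  ⟨Int.fract_nonneg x, Int.fract_lt_one x⟩

theorem Cross.fract_mem {γ : ℝ → ℂ} (hp : Function.Periodic γ 1) {x y : ℝ} (h : Cross γ x y) :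
    (Int.fract x, Int.fract y) ∈ crossPairs γ := by
  have h' := h.fract hp
  exact ⟨fract_mem_Ico x, fract_mem_Ico y, fun e => h'.1 0 (by simpa using e), h'.2⟩

theorem Cross.of_mem_selfInt {γ : ℝ → ℂ} {p : ℝ × ℝ} (h : p ∈ selfInt γ) : Cross γ p.1 p.2 :=
  ⟨fun _ hk => h.2.2.1.ne (eq_of_Ico_of_eq_add_int h.1 h.2.1 hk), h.2.2.2⟩

theorem mem_selfInt_or {γ : ℝ → ℂ} {x y : ℝ} (h : (x, y) ∈ crossPairs γ) :
    (x, y) ∈ selfInt γ ∨ (y, x) ∈ selfInt γ := by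
  obtain ⟨h1, h2, h3, h4⟩ := h
  rcases lt_or_gt_of_ne h3 with h | h
  · exact Or.inl ⟨h1, h2, h, h4⟩
  · exact Or.inr ⟨h2, h1, h, h4.symm⟩

theorem mem_selfIntParams_iff {γ : ℝ → ℂ} {u : ℝ} :
    u ∈ selfIntParams γ ↔ ∃ v, (u, v) ∈ crossPairs γ := by
  constructor
  · rintro ⟨p, hp, rfl | rfl⟩
    · exact ⟨p.2, hp.1, hp.2.1, hp.2.2.1.ne, hp.2.2.2⟩
    · exact ⟨p.1, hp.2.1, hp.1, hp.2.2.1.ne', hp.2.2.2.symm⟩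
  · rintro ⟨v, hv⟩
    rcases mem_selfInt_or hv with h | h
    · exact ⟨_, h, Or.inl rfl⟩
    · exact ⟨_, h, Or.inr rfl⟩

theorem Cross.fract_mem_selfIntParams {γ : ℝ → ℂ} (hp : Function.Periodic γ 1) {x y : ℝ}
    (h : Cross γ x y) : Int.fract x ∈ selfIntParams γ :=
  mem_selfIntParams_iff.2 ⟨_, h.fract_mem hp⟩

/-! ### The determinant of two plane vectors -/

/-- The determinant of two vectors of the plane. -/
def det (a b : ℂ) : ℝ := a.re * b.im - a.im * b.re

theorem det_swap (a b : ℂ) : det b a = -det a b := by unfold det; ring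

theorem det_sub_right (a b c : ℂ) : det a (b - c) = det a b - det a c := by
  simp [det]; ring

theorem det_sub_left (a b c : ℂ) : det (a - b) c = det a c - det b c := by
  simp [det]; ring

theorem det_smul_right (r : ℝ) (a b : ℂ) : det a (r • b) = r * det a b := by
  simp [det]; ring

theorem det_smul_left (r : ℝ) (a b : ℂ) : det (r • a) b = r * det a b := by
  simp [det]; ring

theorem det_self (a : ℂ) : det a a = 0 := by unfold det; ring

theorem det_eq_im (a b : ℂ) : det a b = ((starRingEnd ℂ) a * b).im := by
  simp [det]; ring

theorem abs_det_le (a b : ℂ) : |det a b| ≤ ‖a‖ * ‖b‖ := by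
  rw [det_eq_im]
  refine (Complex.abs_im_le_norm _).trans ?_
  simp

theorem continuous_det : Continuous fun p : ℂ × ℂ => det p.1 p.2 := by
  unfold det; fun_prop

theorem inner_sq_add_det_sq (a b : ℂ) : inner ℝ a b ^ 2 + det a b ^ 2 = ‖a‖ ^ 2 * ‖b‖ ^ 2 := by
  rw [Complex.sq_norm, Complex.sq_norm, Complex.normSq_apply, Complex.normSq_apply,
    Complex.inner]
  simp [det]; ring

theorem linearIndependent_pair_iff_det (a b : ℂ) :
    LinearIndependent ℝ ![a, b] ↔ det a b ≠ 0 := by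
  rw [LinearIndependent.pair_iff]
  constructor
  · intro h h0
    -- `det b I` is the real part of `b` and `det b 1` is minus its imaginary part. Both
    -- combinations vanish with the determinant, so independence forces both coordinates of `a` to
    -- vanish.
    have h1 := h (-det b Complex.I) (det a Complex.I) (by
      apply Complex.ext <;> simp [det] at h0 ⊢
      · ring
      · linarith)
    have h2 := h (det b 1) (-det a 1) (by
      apply Complex.ext <;> simp [det] at h0 ⊢
      · linarith
      · ring)
    have : a = 0 := by
      apply Complex.ext <;> simp [det] at h1 h2 ⊢ <;> linarith
    have hh := h 1 0 (by simp [this])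
    simp at hh
  · intro h s t hst
    have h1 : s * det a b = 0 := by
      have : det (s • a + t • b) b = 0 := by rw [hst]; simp [det]
      simp [det] at this
      unfold det; linear_combination this
    have h2 : t * det a b = 0 := by
      have : det a (s • a + t • b) = 0 := by rw [hst]; simp [det]
      simp [det] at this
      unfold det; linear_combination this
    exact ⟨by simpa [h] using h1, by simpa [h] using h2⟩

theorem transverseAt_iff {γ : ℝ → ℂ} {u v : ℝ} :
    TransverseAt γ u v ↔ det (deriv γ u) (deriv γ v) ≠ 0 :=
  linearIndependent_pair_iff_det _ _

theorem TransverseAt.symm {γ : ℝ → ℂ} {u v : ℝ} (h : TransverseAt γ u v) :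
    TransverseAt γ v u := by
  rw [transverseAt_iff] at *
  rw [det_swap]; simpa using h

/-! ### Generic immersions in terms of lifted self-intersections -/

theorem IsGeneric.transverse_of_cross {γ : ℝ → ℂ} (h : IsGeneric γ) {x y : ℝ}
    (hxy : Cross γ x y) : TransverseAt γ x y := by
  have hp := h.immersed.periodic
  have hd := periodic_deriv hp
  have key : det (deriv γ (Int.fract x)) (deriv γ (Int.fract y)) ≠ 0 := by
    rcases mem_selfInt_or (hxy.fract_mem hp) with h1 | h1
    · exact transverseAt_iff.1 (h.transverse (_, _) h1)
    · exact transverseAt_iff.1 (TransverseAt.symm (h.transverse (_, _) h1))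
  rw [periodic_fract hd, periodic_fract hd] at key
  exact transverseAt_iff.2 key

theorem IsGeneric.not_triple {γ : ℝ → ℂ} (h : IsGeneric γ) {x y z : ℝ}
    (h1 : Cross γ x y) (h2 : Cross γ y z) (h3 : Cross γ x z) : False := by
  have hp := h.immersed.periodic
  have key : ∀ a b c : ℝ, (a, b) ∈ crossPairs γ → (b, c) ∈ crossPairs γ → a < b → b < c → False :=
    fun a b c hab hbc h1 h2 =>
      h.double a b c ⟨⟨hab.1, hab.2.1, h1, hab.2.2.2⟩, ⟨hbc.1, hbc.2.1, h2, hbc.2.2.2⟩⟩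
  have a1 := h1.fract_mem hp
  have a2 := h2.fract_mem hp
  have a3 := h3.fract_mem hp
  have b1 := h1.symm.fract_mem hp
  have b2 := h2.symm.fract_mem hp
  have b3 := h3.symm.fract_mem hp
  -- Genericity forbids only increasing triples in [0,1), so the three representatives are sorted.
  -- Two of the eight sign patterns are cyclic and contradictory.
  rcases lt_or_gt_of_ne a1.2.2.1 with c1 | c1 <;> rcases lt_or_gt_of_ne a2.2.2.1 with c2 | c2 <;>
    rcases lt_or_gt_of_ne a3.2.2.1 with c3 | c3 <;> simp only at c1 c2 c3
  · exact key _ _ _ a1 a2 c1 c2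
  · linarith
  · exact key _ _ _ a3 b2 c3 c2
  · exact key _ _ _ b3 a1 c3 c1
  · exact key _ _ _ b1 a3 c1 c3
  · exact key _ _ _ a2 b3 c2 c3
  · linarith
  · exact key _ _ _ b2 b1 c2 c1

theorem IsGeneric.of_cross {γ : ℝ → ℂ} (h : IsImmersedLoop γ)
    (ht : ∀ x y, Cross γ x y → TransverseAt γ x y)
    (h3 : ∀ x y z, Cross γ x y → Cross γ y z → Cross γ x z → False) : IsGeneric γ := by
  refine ⟨h, fun p hp => ht _ _ (Cross.of_mem_selfInt hp), ?_⟩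
  rintro u v w ⟨h1, h2⟩
  refine h3 u v w (Cross.of_mem_selfInt h1) (Cross.of_mem_selfInt h2)
    (Cross.of_mem_selfInt (p := (u, w)) ⟨h1.1, h2.2.1, ?_, h1.2.2.2.trans h2.2.2.2⟩)
  exact lt_trans h1.2.2.1 h2.2.2.1

/-! ### Immersed loops -/

theorem IsImmersedLoop.continuous {γ : ℝ → ℂ} (h : IsImmersedLoop γ) : Continuous γ :=
  h.contDiff.continuous

theorem IsImmersedLoop.continuous_deriv {γ : ℝ → ℂ} (h : IsImmersedLoop γ) :
    Continuous (deriv γ) :=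
  h.contDiff.continuous_deriv le_rfl

theorem IsImmersedLoop.hasDerivAt {γ : ℝ → ℂ} (h : IsImmersedLoop γ) (x : ℝ) :
    HasDerivAt γ (deriv γ x) x :=
  (h.contDiff.differentiable one_ne_zero x).hasDerivAt

theorem exists_bound_of_periodic {E : Type*} [SeminormedAddCommGroup E] {f : ℝ → E}
    (hc : Continuous f) (hp : Function.Periodic f 1) : ∃ B, 0 < B ∧ ∀ x, ‖f x‖ ≤ B := by
  obtain ⟨B, hB⟩ := isCompact_Icc.exists_bound_of_continuousOn (hc.continuousOn (s := Icc (0:ℝ) 1))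
  refine ⟨|B| + 1, by positivity, fun x => ?_⟩
  rw [← periodic_fract hp]
  have := hB (Int.fract x) ⟨(fract_mem_Ico x).1, (fract_mem_Ico x).2.le⟩
  exact this.trans ((le_abs_self B).trans (by linarith))

theorem exists_uniform_of_periodic {E : Type*} [SeminormedAddCommGroup E] {f : ℝ → E}
    (hc : Continuous f) (hp : Function.Periodic f 1) {ε : ℝ} (hε : 0 < ε) :
    ∃ r, 0 < r ∧ ∀ x y, |x - y| ≤ r → ‖f x - f y‖ ≤ ε := by
  -- The window [-1,2] has room for every point at distance at most 1 from the fundamental domain.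
  have hu := (isCompact_Icc (a := (-1:ℝ)) (b := 2)).uniformContinuousOn_of_continuous
    hc.continuousOn
  obtain ⟨r, hr, H⟩ := Metric.uniformContinuousOn_iff.1 hu ε hε
  refine ⟨min (r / 2) 1, by positivity, fun x y hxy => ?_⟩
  have h1 : |x - y| ≤ r / 2 := hxy.trans (min_le_left _ _)
  have h2 : |x - y| ≤ 1 := hxy.trans (min_le_right _ _)
  rw [abs_le] at h2
  have hf := fract_mem_Ico x
  have e1 : f x = f (Int.fract x) := (periodic_fract hp x).symm
  have e2 : f y = f (y - ⌊x⌋) := by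
    have := periodic_add_int hp y (-⌊x⌋)
    rw [← this]; simp [sub_eq_add_neg]
  rw [e1, e2, ← dist_eq_norm]
  have hfx : Int.fract x = x - ⌊x⌋ := rfl
  refine (H _ ⟨by linarith [hf.1], by linarith [hf.2]⟩ _ ⟨?_, ?_⟩ ?_).le
  · linarith [hf.1]
  · linarith [hf.2]
  · rw [Real.dist_eq, hfx]
    have : x - (⌊x⌋:ℝ) - (y - ⌊x⌋) = x - y := by ring
    rw [this]; linarith

theorem exists_lower_bound_of_periodic {f : ℝ → ℂ}
    (hc : Continuous f) (hp : Function.Periodic f 1) (h0 : ∀ x, f x ≠ 0) :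
    ∃ m, 0 < m ∧ ∀ x, m ≤ ‖f x‖ := by
  obtain ⟨z, hz, hm⟩ := (isCompact_Icc (a := (0:ℝ)) (b := 1)).exists_isMinOn
    ⟨0, by simp⟩ hc.norm.continuousOn
  refine ⟨‖f z‖, norm_pos_iff.2 (h0 z), fun x => ?_⟩
  rw [← periodic_fract hp x]
  exact hm ⟨(fract_mem_Ico x).1, (fract_mem_Ico x).2.le⟩

/-- First order Taylor estimate for a function whose derivative varies little. -/
theorem norm_sub_sub_le {γ : ℝ → ℂ} (hd : Differentiable ℝ γ) {x y : ℝ} {v : ℂ} {c : ℝ}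
    (h : ∀ t ∈ uIcc x y, ‖deriv γ t - v‖ ≤ c) : ‖γ y - γ x - (y - x) • v‖ ≤ c * |y - x| := by
  have := (convex_uIcc x y).norm_image_sub_le_of_norm_hasDerivWithin_le
    (f := fun t => γ t - t • v) (f' := fun t => deriv γ t - v) (C := c) (x := x) (y := y)
    (fun t _ => by
      have := ((hd t).hasDerivAt.sub ((hasDerivAt_id t).smul_const v)).hasDerivWithinAt
        (s := uIcc x y)
      rw [one_smul] at this
      exact this) h left_mem_uIcc right_mem_uIcc
  rw [Real.norm_eq_abs] at this
  have e : γ y - γ x - (y - x) • v = γ y - y • v - (γ x - x • v) := by rw [sub_smul]; abel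
  rwa [e]


/-! ### Stability of generic immersions under `C¹`-small perturbations -/

/-- A closed planar curve of class `C¹`. -/
structure IsC1Loop (γ : ℝ → ℂ) : Prop where
  periodic : Function.Periodic γ 1
  contDiff : ContDiff ℝ 1 γ

/-- The curves `γ` and `ξ` have `C¹`-distance at most `ε`. -/
def C1Close (ε : ℝ) (γ ξ : ℝ → ℂ) : Prop :=
  ∀ x, ‖ξ x - γ x‖ ≤ ε ∧ ‖deriv ξ x - deriv γ x‖ ≤ ε

theorem IsImmersedLoop.isC1Loop {γ : ℝ → ℂ} (h : IsImmersedLoop γ) : IsC1Loop γ :=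
  ⟨h.periodic, h.contDiff⟩

theorem IsC1Loop.differentiable {γ : ℝ → ℂ} (h : IsC1Loop γ) : Differentiable ℝ γ :=
  h.contDiff.differentiable one_ne_zero

theorem C1Close.mono {ε ε' : ℝ} (h : ε ≤ ε') {γ ξ : ℝ → ℂ} (hc : C1Close ε γ ξ) :
    C1Close ε' γ ξ := fun x => ⟨(hc x).1.trans h, (hc x).2.trans h⟩

theorem C1Close.refl {ε : ℝ} (h : 0 ≤ ε) (γ : ℝ → ℂ) : C1Close ε γ γ :=
  fun x => by simp [h]

/-- Curves `C¹`-close to an immersed loop are immersed, and injective on short arcs of uniform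
length. -/
theorem exists_immersed_of_close {γ : ℝ → ℂ} (h : IsImmersedLoop γ) :
    ∃ r > 0, ∃ ε > 0, ∀ ξ, IsC1Loop ξ → C1Close ε γ ξ →
      (∀ x, deriv ξ x ≠ 0) ∧ ∀ x y, |x - y| ≤ r → x ≠ y → ξ x ≠ ξ y := by
  obtain ⟨m, hm, hm'⟩ := exists_lower_bound_of_periodic h.continuous_deriv
    (periodic_deriv h.periodic) h.deriv_ne_zero
  obtain ⟨r, hr, hr'⟩ := exists_uniform_of_periodic h.continuous_deriv
    (periodic_deriv h.periodic) (ε := m / 4) (by positivity)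
  refine ⟨r, hr, m / 4, by positivity, fun ξ hξ hc => ⟨fun x h0 => ?_, fun x y hxy hne he => ?_⟩⟩
  · have := (hc x).2
    rw [h0, zero_sub, norm_neg] at this
    linarith [hm' x]
  · have key := norm_sub_sub_le hξ.differentiable (x := x) (y := y) (v := deriv γ x)
      (c := m / 2) (fun t ht => by
        have h1 := hr' t x (by
          rw [abs_sub_comm]
          rw [abs_sub_comm] at hxy
          have := abs_sub_right_of_mem_uIcc ht
          have h2 := abs_sub_left_of_mem_uIcc ht
          rw [abs_sub_comm]
          linarith)
        have h2 := (hc t).2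
        calc ‖deriv ξ t - deriv γ x‖ = ‖(deriv ξ t - deriv γ t) + (deriv γ t - deriv γ x)‖ := by
              congr 1; ring
          _ ≤ m / 4 + m / 4 := (norm_add_le _ _).trans (add_le_add h2 h1)
          _ = m / 2 := by ring)
    rw [he, sub_self, zero_sub, norm_neg, norm_smul, Real.norm_eq_abs] at key
    have h1 : 0 < |y - x| := abs_pos.2 (sub_ne_zero.2 hne.symm)
    have h2 := hm' x
    nlinarith

/-- At the self-intersections of a generic immersion the tangent vectors are uniformly
transverse. -/
theorem IsGeneric.exists_det_ge {γ : ℝ → ℂ} (h : IsGeneric γ) :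
    ∃ c > 0, ∀ x y, Cross γ x y → c ≤ |det (deriv γ x) (deriv γ y)| := by
  obtain ⟨r, hr, ε, hε, hr'⟩ := exists_immersed_of_close h.immersed
  have hinj := (hr' γ h.immersed.isC1Loop (C1Close.refl hε.le γ)).2
  have hp := h.immersed.periodic
  have hd := periodic_deriv hp
  -- Injectivity on short arcs keeps crossings at circle distance at least `r` from the diagonal, so
  -- they lie in a compact set on which the determinant has no zero.
  set K : Set (ℝ × ℝ) := (Icc 0 1 ×ˢ Icc 0 1) ∩
    ({p | γ p.1 = γ p.2} ∩ ⋂ k : ℤ, {p | r ≤ |p.1 - (p.2 + k)|}) with hK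
  have hcont := h.immersed.continuous
  have hcont' := h.immersed.continuous_deriv
  have hKc : IsCompact K := by
    refine (isCompact_Icc.prod isCompact_Icc).inter_right (IsClosed.inter ?_ ?_)
    · exact isClosed_eq (by fun_prop) (by fun_prop)
    · exact isClosed_iInter fun k => isClosed_le continuous_const (by fun_prop)
  have hmem : ∀ x y, Cross γ x y → (Int.fract x, Int.fract y) ∈ K := by
    intro x y hxy
    have hf := hxy.fract hp
    refine ⟨⟨⟨(fract_mem_Ico x).1, (fract_mem_Ico x).2.le⟩,
      ⟨(fract_mem_Ico y).1, (fract_mem_Ico y).2.le⟩⟩, hf.2, mem_iInter.2 fun k => ?_⟩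
    by_contra hlt
    simp only [mem_ofPred_eq, not_le] at hlt
    refine hinj _ _ hlt.le (hf.1 k) ?_
    rw [periodic_add_int hp]; exact hf.2
  have hcd : Continuous fun p : ℝ × ℝ => |det (deriv γ p.1) (deriv γ p.2)| := by
    have := continuous_det.comp (f := fun p : ℝ × ℝ => (deriv γ p.1, deriv γ p.2)) (by fun_prop)
    exact this.abs
  rcases K.eq_empty_or_nonempty with he | hne
  · refine ⟨1, one_pos, fun x y hxy => ?_⟩
    have := hmem x y hxy
    rw [he] at this
    exact this.elim
  · obtain ⟨z, hz, hmin⟩ := hKc.exists_isMinOn hne hcd.continuousOn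
    refine ⟨_, abs_pos.2 (transverseAt_iff.1 (h.transverse_of_cross (x := z.1) (y := z.2)
      ⟨fun k hk => ?_, hz.2.1⟩)), fun x y hxy => ?_⟩
    · have := mem_iInter.1 hz.2.2 k
      simp only [mem_ofPred_eq, hk, sub_self, abs_zero] at this
      linarith
    · have := hmin (hmem x y hxy)
      simp only [mem_ofPred_eq, periodic_fract hd] at this
      exact this

/-- The linear map `(a, b) ↦ a v - b w`. -/
noncomputable def pairMap (v w : ℂ) : ℝ × ℝ →L[ℝ] ℂ :=
  (ContinuousLinearMap.fst ℝ ℝ ℝ).smulRight v - (ContinuousLinearMap.snd ℝ ℝ ℝ).smulRight w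

theorem pairMap_apply (v w : ℂ) (z : ℝ × ℝ) : pairMap v w z = z.1 • v - z.2 • w := by
  simp [pairMap]

/-- Taking the determinant of `z.1 • v - z.2 • w` with `w`, respectively `v`, kills one coordinate
and isolates the other. -/
theorem norm_pairMap_ge {v w : ℂ} {c B : ℝ} (hd : c ≤ |det v w|) (hv : ‖v‖ ≤ B)
    (hw : ‖w‖ ≤ B) (z : ℝ × ℝ) : c * ‖z‖ ≤ B * ‖pairMap v w z‖ := by
  have h1 : |z.1| * |det v w| ≤ ‖pairMap v w z‖ * ‖w‖ := by
    rw [← abs_mul, ← det_smul_left]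
    refine le_trans (le_of_eq ?_) (abs_det_le _ _)
    rw [pairMap_apply, det_sub_left, det_smul_left z.2, det_self, mul_zero, sub_zero]
  have h2 : |z.2| * |det v w| ≤ ‖pairMap v w z‖ * ‖v‖ := by
    have := abs_det_le v (pairMap v w z)
    rw [pairMap_apply, det_sub_right, det_smul_right, det_smul_right, det_self, mul_zero,
      zero_sub, abs_neg, abs_mul] at this
    rw [pairMap_apply]
    linarith
  have h3 : ‖pairMap v w z‖ * ‖w‖ ≤ B * ‖pairMap v w z‖ := by
    rw [mul_comm]; exact mul_le_mul_of_nonneg_right hw (norm_nonneg _)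
  have h4 : ‖pairMap v w z‖ * ‖v‖ ≤ B * ‖pairMap v w z‖ := by
    rw [mul_comm]; exact mul_le_mul_of_nonneg_right hv (norm_nonneg _)
  have h5 : c * ‖z‖ ≤ |det v w| * ‖z‖ := mul_le_mul_of_nonneg_right hd (norm_nonneg _)
  refine h5.trans ?_
  rcases le_total ‖z.1‖ ‖z.2‖ with h | h
  · rw [Prod.norm_def, max_eq_right h, Real.norm_eq_abs]; linarith
  · rw [Prod.norm_def, max_eq_left h, Real.norm_eq_abs]; linarith

theorem pairMap_surj {v w : ℂ} (hd : det v w ≠ 0) (y : ℂ) : ∃ z, pairMap v w z = y := by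
  refine ⟨(det y w / det v w, det y v / det v w), ?_⟩
  rw [pairMap_apply]
  apply Complex.ext
  · simp only [Complex.sub_re, Complex.smul_re, smul_eq_mul]
    field_simp
    unfold det; ring
  · simp only [Complex.sub_im, Complex.smul_im, smul_eq_mul]
    field_simp
    unfold det; ring

theorem finite_of_pairwise_dist {X : Type*} [PseudoMetricSpace X] {K S : Set X} (hK : IsCompact K)
    (hS : S ⊆ K) {r : ℝ} (hr : 0 < r) (h : ∀ x ∈ S, ∀ y ∈ S, dist x y < r → x = y) :
    S.Finite := by
  obtain ⟨t, ht, hcov⟩ := Metric.totallyBounded_iff.1 hK.totallyBounded (r / 2) (by positivity)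
  refine (ht.biUnion (t := fun y => S ∩ Metric.ball y (r / 2)) fun y _ => ?_).subset ?_
  · refine Set.Subsingleton.finite fun a ha b hb => h a ha.1 b hb.1 ?_
    have h1 : dist a y < r / 2 := ha.2
    have h2 : dist b y < r / 2 := hb.2
    linarith [dist_triangle_right a b y]
  · intro x hx
    obtain ⟨y, hy, hxy⟩ := mem_iUnion₂.1 (hcov (hS hx))
    exact mem_iUnion₂.2 ⟨y, hy, hx, hxy⟩

/-- Near a self-intersection of a generic immersion `γ`, a `C¹`-close curve has exactly one
self-intersection, and it is transverse. -/
theorem IsGeneric.exists_local {γ : ℝ → ℂ} (h : IsGeneric γ) :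
    ∃ r₀ > 0, ∀ r, 0 < r → r ≤ r₀ → ∃ ε > 0, ∀ ξ, IsC1Loop ξ → C1Close ε γ ξ →
      ∀ p : ℝ × ℝ, Cross γ p.1 p.2 →
      (∀ z ∈ Metric.closedBall p r₀, ∀ z' ∈ Metric.closedBall p r₀,
        ξ z.1 = ξ z.2 → ξ z'.1 = ξ z'.2 → z = z') ∧
      (∀ z ∈ Metric.closedBall p r₀, det (deriv ξ z.1) (deriv ξ z.2) ≠ 0) ∧
      ∃ z ∈ Metric.closedBall p r, ξ z.1 = ξ z.2 := by
  obtain ⟨c₀, hc₀, hdet⟩ := h.exists_det_ge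
  have hp := h.immersed.periodic
  have hd := periodic_deriv hp
  obtain ⟨B, hB, hB'⟩ := exists_bound_of_periodic h.immersed.continuous_deriv hd
  set c := c₀ / B with hc
  have hcp : 0 < c := by positivity
  -- The first bound keeps `ξ z.1 - ξ z.2` within `c / 2` of the linear map in the Lipschitz sense,
  -- the second keeps the determinant away from zero, and the third gives `‖deriv ξ‖ ≤ 2 * B`.
  set κ := min (c / 8) (min (c₀ / (8 * B)) (B / 2)) with hκ
  have hκp : 0 < κ := by positivity
  have hκ1 : κ ≤ c / 8 := min_le_left _ _
  have hκ2 : κ ≤ c₀ / (8 * B) := (min_le_right _ _).trans (min_le_left _ _)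
  have hκ3 : κ ≤ B / 2 := (min_le_right _ _).trans (min_le_right _ _)
  obtain ⟨r₀, hr₀, hosc⟩ := exists_uniform_of_periodic h.immersed.continuous_deriv hd hκp
  refine ⟨r₀, hr₀, fun r hr hrr => ⟨min κ (c * r / 8), by positivity, ?_⟩⟩
  intro ξ hξ hclose p hcr
  have hε1 : C1Close κ γ ξ := hclose.mono (min_le_left _ _)
  have hε2 : C1Close (c * r / 8) γ ξ := hclose.mono (min_le_right _ _)
  have hosc' : ∀ s x, |s - x| ≤ r₀ → ‖deriv ξ s - deriv γ x‖ ≤ 2 * κ := fun s x hsx => by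
    calc ‖deriv ξ s - deriv γ x‖ = ‖(deriv ξ s - deriv γ s) + (deriv γ s - deriv γ x)‖ := by
          congr 1; ring
      _ ≤ κ + κ := (norm_add_le _ _).trans (add_le_add (hε1 s).2 (hosc s x hsx))
      _ = 2 * κ := by ring
  have hball : ∀ z ∈ Metric.closedBall p r₀, |z.1 - p.1| ≤ r₀ ∧ |z.2 - p.2| ≤ r₀ := by
    intro z hz
    rw [Metric.mem_closedBall, Prod.dist_eq, max_le_iff, Real.dist_eq, Real.dist_eq] at hz
    exact hz
  have happ1 : ∀ x s s' : ℝ, |s - x| ≤ r₀ → |s' - x| ≤ r₀ →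
      ‖ξ s' - ξ s - (s' - s) • deriv γ x‖ ≤ c / 4 * |s' - s| := by
    intro x s s' hs hs'
    refine norm_sub_sub_le hξ.differentiable fun t ht => (hosc' t x ?_).trans (by linarith)
    have : t ∈ Icc (x - r₀) (x + r₀) := by
      have h1 : uIcc s s' ⊆ Icc (x - r₀) (x + r₀) := by
        apply uIcc_subset_Icc
        · rw [abs_le] at hs; constructor <;> linarith
        · rw [abs_le] at hs'; constructor <;> linarith
      exact h1 ht
    rw [abs_le]; constructor <;> linarith [this.1, this.2]
  set v := deriv γ p.1
  set w := deriv γ p.2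
  have happ : ∀ z ∈ Metric.closedBall p r₀, ∀ z' ∈ Metric.closedBall p r₀,
      ‖(ξ z.1 - ξ z.2) - (ξ z'.1 - ξ z'.2) - pairMap v w (z - z')‖ ≤ c / 2 * ‖z - z'‖ := by
    intro z hz z' hz'
    have h1 := happ1 p.1 z'.1 z.1 (hball z' hz').1 (hball z hz).1
    have h2 := happ1 p.2 z'.2 z.2 (hball z' hz').2 (hball z hz).2
    have h3 : |z.1 - z'.1| ≤ ‖z - z'‖ := norm_fst_le (z - z')
    have h4 : |z.2 - z'.2| ≤ ‖z - z'‖ := norm_snd_le (z - z')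
    calc _ = ‖(ξ z.1 - ξ z'.1 - (z.1 - z'.1) • v) - (ξ z.2 - ξ z'.2 - (z.2 - z'.2) • w)‖ := by
          rw [pairMap_apply]; congr 1; simp only [Prod.fst_sub, Prod.snd_sub]; ring
      _ ≤ c / 4 * |z.1 - z'.1| + c / 4 * |z.2 - z'.2| := (norm_sub_le _ _).trans (add_le_add h1 h2)
      _ ≤ c / 4 * ‖z - z'‖ + c / 4 * ‖z - z'‖ := by gcongr
      _ = _ := by ring
  have hlow : ∀ z, c * ‖z‖ ≤ ‖pairMap v w z‖ := by
    intro z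
    have := norm_pairMap_ge (hdet _ _ hcr) (hB' p.1) (hB' p.2) z
    rw [hc, div_mul_eq_mul_div, div_le_iff₀ hB]
    linarith
  refine ⟨?_, ?_, ?_⟩
  · intro z hz z' hz' e e'
    have h1 := happ z hz z' hz'
    rw [e, e', sub_self, sub_self, sub_self, zero_sub, norm_neg] at h1
    have h2 := hlow (z - z')
    have h3 : ‖z - z'‖ = 0 := le_antisymm (by nlinarith) (norm_nonneg _)
    exact sub_eq_zero.1 (norm_eq_zero.1 h3)
  · intro z hz h0
    have h1 := hosc' z.1 p.1 (hball z hz).1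
    have h2 := hosc' z.2 p.2 (hball z hz).2
    have h3 : det v w = det (v - deriv ξ z.1) w + det (deriv ξ z.1) (w - deriv ξ z.2) := by
      rw [det_sub_left, det_sub_right, h0]; ring
    have h4 := abs_det_le (v - deriv ξ z.1) w
    have h5 := abs_det_le (deriv ξ z.1) (w - deriv ξ z.2)
    rw [norm_sub_rev] at h4 h5
    have hξn : ‖deriv ξ z.1‖ ≤ 2 * B := by
      calc ‖deriv ξ z.1‖ = ‖(deriv ξ z.1 - v) + v‖ := by congr 1; ring
        _ ≤ 2 * κ + B := (norm_add_le _ _).trans (add_le_add h1 (hB' _))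
        _ ≤ 2 * B := by linarith
    have h6 : ‖deriv ξ z.1 - v‖ * ‖w‖ ≤ 2 * κ * B :=
      mul_le_mul h1 (hB' _) (norm_nonneg _) (by positivity)
    have h7 : ‖deriv ξ z.1‖ * ‖deriv ξ z.2 - w‖ ≤ 2 * B * (2 * κ) :=
      mul_le_mul hξn h2 (norm_nonneg _) (by positivity)
    have h8 : c₀ ≤ 6 * κ * B := by
      have := hdet _ _ hcr
      rw [show det (deriv γ p.1) (deriv γ p.2) = det v w from rfl, h3] at this
      have h9 := this.trans (abs_add_le _ _)
      linarith
    have h10 : κ * (8 * B) ≤ c₀ := by rwa [le_div_iff₀ (by positivity)] at hκ2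
    nlinarith [mul_pos hκp hB]
  · have hdet0 : det v w ≠ 0 := fun h0 => by
      have := hdet _ _ hcr
      rw [show det (deriv γ p.1) (deriv γ p.2) = det v w from rfl, h0, abs_zero] at this
      linarith
    have hsurj := pairMap_surj hdet0
    choose g hg using hsurj
    -- Quantitative inverse function theorem: the linear map has an inverse of norm at most `c⁻¹`
    -- and the error has Lipschitz constant `c / 2`. The image of the `r`-ball therefore contains a
    -- ball of radius `c * r / 2` about `ξ p.1 - ξ p.2`, which includes 0.
    let R : (pairMap v w).NonlinearRightInverse :=
      { toFun := g
        nnnorm := ⟨c⁻¹, by positivity⟩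
        bound' := fun y => by
          have := hlow (g y)
          rw [hg y] at this
          change ‖g y‖ ≤ c⁻¹ * ‖y‖
          rw [inv_mul_eq_div, le_div_iff₀ hcp]
          linarith
        right_inv' := hg }
    have hA : ApproximatesLinearOn (fun z : ℝ × ℝ => ξ z.1 - ξ z.2) (pairMap v w)
        (Metric.closedBall p r₀) ⟨c / 2, by positivity⟩ := happ
    have hs := hA.surjOn_closedBall_of_nonlinearRightInverse R (ε := r) (b := p) hr.le
      (Metric.closedBall_subset_closedBall hrr)
    have h0 : (0 : ℂ) ∈ Metric.closedBall (ξ p.1 - ξ p.2)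
        (((R.nnnorm : ℝ)⁻¹ - (⟨c / 2, by positivity⟩ : NNReal)) * r) := by
      rw [Metric.mem_closedBall, dist_eq_norm, zero_sub, norm_neg]
      change _ ≤ ((c⁻¹)⁻¹ - c / 2) * r
      rw [inv_inv]
      have h1 := (hε2 p.1).1
      have h2 := (hε2 p.2).1
      calc ‖ξ p.1 - ξ p.2‖ = ‖(ξ p.1 - γ p.1) - (ξ p.2 - γ p.2)‖ := by
            rw [hcr.2]; congr 1; ring
        _ ≤ c * r / 8 + c * r / 8 := (norm_sub_le _ _).trans (add_le_add h1 h2)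
        _ ≤ (c - c / 2) * r := by nlinarith [mul_pos hcp hr]
    obtain ⟨z, hz, hz0⟩ := hs h0
    exact ⟨z, hz, sub_eq_zero.1 hz0⟩

theorem IsGeneric.finite_crossPairs {γ : ℝ → ℂ} (h : IsGeneric γ) : (crossPairs γ).Finite := by
  obtain ⟨r₀, hr₀, H⟩ := h.exists_local
  obtain ⟨ε, hε, H⟩ := H r₀ hr₀ le_rfl
  have H := H γ h.immersed.isC1Loop (C1Close.refl hε.le γ)
  refine finite_of_pairwise_dist (K := Icc 0 1 ×ˢ Icc 0 1) (isCompact_Icc.prod isCompact_Icc)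
    (fun p hp => ⟨⟨hp.1.1, hp.1.2.le⟩, ⟨hp.2.1.1, hp.2.1.2.le⟩⟩) hr₀ ?_
  intro x hx y hy hxy
  exact (H x (cross_of_mem_crossPairs hx)).1 x (Metric.mem_closedBall_self hr₀.le) y
    (by rw [Metric.mem_closedBall, dist_comm]; exact hxy.le) hx.2.2.2 hy.2.2.2

theorem IsGeneric.finite_selfIntParams {γ : ℝ → ℂ} (h : IsGeneric γ) :
    (selfIntParams γ).Finite := by
  refine (h.finite_crossPairs.image Prod.fst).subset fun u hu => ?_
  obtain ⟨v, hv⟩ := mem_selfIntParams_iff.1 hu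
  exact ⟨_, hv, rfl⟩

theorem exists_pos_le_of_finite {S : Set ℝ} (hS : S.Finite) (h : ∀ s ∈ S, 0 < s) :
    ∃ g > 0, ∀ s ∈ S, g ≤ s := by
  rcases S.eq_empty_or_nonempty with rfl | hne
  · exact ⟨1, one_pos, by simp⟩
  · obtain ⟨a, ha, hmin⟩ := S.exists_min_image id hS hne
    exact ⟨a, h a ha, hmin⟩

/-- Finitely many points of the circle have a positive mutual distance. -/
theorem exists_gap {T : Set ℝ} (hT : T.Finite) (h01 : T ⊆ Ico 0 1) :
    ∃ g > 0, ∀ a ∈ T, ∀ b ∈ T, ∀ k : ℤ, a ≠ b + k → g ≤ |a - (b + k)| := by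
  -- For |k| ≥ 3 a point of [0,1) is farther than 1 from the translate by `k` of another, so only
  -- finitely many translations matter.
  set S : Set ℝ := ((fun q : ℝ × ℝ × ℤ => |q.1 - (q.2.1 + q.2.2)|) ''
    (T ×ˢ T ×ˢ (Icc (-2 : ℤ) 2))) ∩ Ioi 0 with hS
  have hSf : S.Finite := by
    refine Finite.inter_of_left (Finite.image _ (hT.prod (hT.prod (finite_Icc _ _)))) _
  obtain ⟨g, hg, hmin⟩ := exists_pos_le_of_finite hSf fun s hs => hs.2
  refine ⟨min g 1, by positivity, fun a ha b hb k hk => ?_⟩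
  by_cases hk2 : k ∈ Icc (-2 : ℤ) 2
  · exact (min_le_left _ _).trans (hmin _ ⟨⟨(a, b, k), ⟨ha, hb, hk2⟩, rfl⟩,
      abs_pos.2 (sub_ne_zero.2 hk)⟩)
  · refine (min_le_right _ _).trans ?_
    have h1 := h01 ha
    have h2 := h01 hb
    rw [mem_Icc, not_and_or, not_le, not_le] at hk2
    rcases hk2 with h3 | h3
    · have : (k : ℝ) ≤ -3 := by exact_mod_cast (by omega : k ≤ -3)
      rw [le_abs]; left; linarith [h1.1, h2.2]
    · have : (3 : ℝ) ≤ k := by exact_mod_cast (by omega : 3 ≤ k)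
      rw [le_abs]; right; linarith [h1.2, h2.1]

theorem selfIntParams_subset_Ico {γ : ℝ → ℂ} : selfIntParams γ ⊆ Ico 0 1 := by
  intro u hu
  obtain ⟨v, hv⟩ := mem_selfIntParams_iff.1 hu
  exact hv.1

/-- The lifted crossing parameters are the integer translates of a finite set, hence uniformly
discrete. This is what identifies nearby crossings with each other. -/
theorem IsGeneric.exists_gap_cross {γ : ℝ → ℂ} (h : IsGeneric γ) :
    ∃ g > 0, ∀ a a' b b', Cross γ a a' → Cross γ b b' → |a - b| < g → a = b := by
  obtain ⟨g, hg, H⟩ := exists_gap h.finite_selfIntParams selfIntParams_subset_Ico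
  have hp := h.immersed.periodic
  refine ⟨g, hg, fun a a' b b' ha hb hab => ?_⟩
  by_contra hne
  have h1 := ha.fract_mem_selfIntParams hp
  have h2 := hb.fract_mem_selfIntParams hp
  have e : Int.fract a - (Int.fract b + ((⌊b⌋ - ⌊a⌋ : ℤ) : ℝ)) = a - b := by
    unfold Int.fract; push_cast; ring
  have := H _ h1 _ h2 (⌊b⌋ - ⌊a⌋) (by rw [← sub_ne_zero, e, sub_ne_zero]; exact hne)
  rw [e] at this
  linarith

/-- Self-intersections of a curve that is `C¹`-close to `γ` are close to those of `γ`. -/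
theorem IsImmersedLoop.exists_cross_near {γ : ℝ → ℂ} (h : IsImmersedLoop γ) {ρ : ℝ} (hρ : 0 < ρ) :
    ∃ ε > 0, ∀ ξ, IsC1Loop ξ → C1Close ε γ ξ → ∀ p : ℝ × ℝ, Cross ξ p.1 p.2 →
      ∃ p' : ℝ × ℝ, Cross γ p'.1 p'.2 ∧ dist p p' ≤ ρ := by
  obtain ⟨r, hr, ε₁, hε₁, hr'⟩ := exists_immersed_of_close h
  have hp := h.periodic
  have hcont := h.continuous
  set U : Set (ℝ × ℝ) := ⋃ p' ∈ {p' : ℝ × ℝ | Cross γ p'.1 p'.2}, Metric.ball p' ρ with hU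
  have hUo : IsOpen U := isOpen_biUnion fun _ _ => Metric.isOpen_ball
  -- On pairs far from the diagonal and from all crossings of `γ`, `‖γ x - γ y‖` has a positive
  -- minimum, which survives a small perturbation.
  set K : Set (ℝ × ℝ) := (Icc 0 1 ×ˢ Icc 0 1) ∩
    (Uᶜ ∩ ⋂ k : ℤ, {p | r ≤ |p.1 - (p.2 + k)|}) with hK
  have hKc : IsCompact K := by
    refine (isCompact_Icc.prod isCompact_Icc).inter_right (IsClosed.inter hUo.isClosed_compl ?_)
    exact isClosed_iInter fun k => isClosed_le continuous_const (by fun_prop)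
  have hpos : ∀ p ∈ K, γ p.1 ≠ γ p.2 := by
    intro p hpK he
    refine hpK.2.1 (mem_iUnion₂.2 ⟨p, ⟨fun k hk => ?_, he⟩, Metric.mem_ball_self hρ⟩)
    have := mem_iInter.1 hpK.2.2 k
    simp only [mem_ofPred_eq, hk, sub_self, abs_zero] at this
    linarith
  have hm : ∃ m > 0, ∀ p ∈ K, m ≤ ‖γ p.1 - γ p.2‖ := by
    rcases K.eq_empty_or_nonempty with he | hne
    · exact ⟨1, one_pos, by simp [he]⟩
    · obtain ⟨z, hz, hmin⟩ := hKc.exists_isMinOn hne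
        (f := fun p : ℝ × ℝ => ‖γ p.1 - γ p.2‖) (by fun_prop)
      exact ⟨_, norm_pos_iff.2 (sub_ne_zero.2 (hpos z hz)), fun p hpK => hmin hpK⟩
  obtain ⟨m, hm, hmK⟩ := hm
  refine ⟨min ε₁ (m / 4), by positivity, fun ξ hξ hclose p hcr => ?_⟩
  have hinj := (hr' ξ hξ (hclose.mono (min_le_left _ _))).2
  have hcl := hclose.mono (min_le_right _ _)
  have hf := hcr.fract hξ.periodic
  by_cases hin : (Int.fract p.1, Int.fract p.2) ∈ U
  · obtain ⟨q, hq, hqd⟩ := mem_iUnion₂.1 hin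
    refine ⟨(q.1 + ⌊p.1⌋, q.2 + ⌊p.2⌋), Cross.add_int hp hq _ _, ?_⟩
    rw [Metric.mem_ball, Prod.dist_eq, max_lt_iff, Real.dist_eq, Real.dist_eq] at hqd
    rw [Prod.dist_eq, Real.dist_eq, Real.dist_eq]
    refine max_le ?_ ?_
    · refine le_trans (le_of_eq ?_) hqd.1.le
      simp only [Int.fract]; congr 1; ring
    · refine le_trans (le_of_eq ?_) hqd.2.le
      simp only [Int.fract]; congr 1; ring
  · exfalso
    have hmemK : (Int.fract p.1, Int.fract p.2) ∈ K := by
      refine ⟨⟨⟨(fract_mem_Ico _).1, (fract_mem_Ico _).2.le⟩,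
        ⟨(fract_mem_Ico _).1, (fract_mem_Ico _).2.le⟩⟩, hin, mem_iInter.2 fun k => ?_⟩
      by_contra hlt
      simp only [mem_ofPred_eq, not_le] at hlt
      refine hinj _ _ hlt.le (hf.1 k) ?_
      rw [periodic_add_int hξ.periodic]; exact hf.2
    have h1 := hmK _ hmemK
    have h2 := (hcl (Int.fract p.1)).1
    have h3 := (hcl (Int.fract p.2)).1
    have h4 : ‖γ (Int.fract p.1) - γ (Int.fract p.2)‖ ≤ m / 4 + m / 4 := by
      calc _ = ‖(ξ (Int.fract p.2) - γ (Int.fract p.2)) -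
            (ξ (Int.fract p.1) - γ (Int.fract p.1))‖ := by rw [hf.2]; congr 1; ring
        _ ≤ _ := (norm_sub_le _ _).trans (add_le_add h3 h2)
    simp only at h1
    linarith

/-- Loops that are `C¹`-close to a generic immersion are generic, with equally many double
points. -/
theorem IsGeneric.exists_stable {γ : ℝ → ℂ} (h : IsGeneric γ) :
    ∃ ε > 0, ∀ ξ, IsC1Loop ξ → C1Close ε γ ξ →
      IsGeneric ξ ∧ (crossPairs ξ).ncard = (crossPairs γ).ncard := by
  have hp := h.immersed.periodic
  obtain ⟨r₁, hr₁, ε₁, hε₁, H₁⟩ := exists_immersed_of_close h.immersed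
  obtain ⟨r₀, hr₀, H₂⟩ := h.exists_local
  obtain ⟨g, hg, Hg⟩ := h.exists_gap_cross
  -- `r₀` gives local uniqueness of the perturbed crossing, `r₁ / 4` keeps it off the diagonal, and
  -- `g / 4` makes parameters of `γ` that are close to a common point coincide.
  set r := min r₀ (min (r₁ / 4) (g / 4)) with hrdef
  have hr : 0 < r := by positivity
  have hrr₀ : r ≤ r₀ := min_le_left _ _
  have hrr₁ : r ≤ r₁ / 4 := (min_le_right _ _).trans (min_le_left _ _)
  have hrg : r ≤ g / 4 := (min_le_right _ _).trans (min_le_right _ _)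
  obtain ⟨ε₂, hε₂, H₂⟩ := H₂ r hr hrr₀
  obtain ⟨ε₃, hε₃, H₃⟩ := h.immersed.exists_cross_near hr
  refine ⟨min ε₁ (min ε₂ ε₃), by positivity, fun ξ hξ hc => ?_⟩
  have H₁' := H₁ ξ hξ (hc.mono (min_le_left _ _))
  have H₂ := H₂ ξ hξ (hc.mono ((min_le_right _ _).trans (min_le_left _ _)))
  have H₃ := H₃ ξ hξ (hc.mono ((min_le_right _ _).trans (min_le_right _ _)))
  have hpξ := hξ.periodic
  have Hγ := (H₁ γ h.immersed.isC1Loop (C1Close.refl hε₁.le γ)).2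
  have hd1 : ∀ p q : ℝ × ℝ, dist p q ≤ r → |p.1 - q.1| ≤ r ∧ |p.2 - q.2| ≤ r := by
    intro p q hpq
    rwa [Prod.dist_eq, max_le_iff, Real.dist_eq, Real.dist_eq] at hpq
  have htri : ∀ a b c : ℝ, |a - b| ≤ r → |a - c| ≤ r → |b - c| < g := by
    intro a b c h1 h2
    rw [abs_le] at h1 h2
    rw [abs_lt]; constructor <;> linarith
  refine ⟨IsGeneric.of_cross ⟨hξ.periodic, hξ.contDiff, H₁'.1⟩ ?_ ?_, ?_⟩
  · intro x y hxy
    obtain ⟨p', hp', hd⟩ := H₃ (x, y) hxy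
    exact transverseAt_iff.2 ((H₂ p' hp').2.1 (x, y) (Metric.mem_closedBall.2 (hd.trans hrr₀)))
  · intro x y z hxy hyz hxz
    obtain ⟨p, hp1, hd1'⟩ := H₃ (x, y) hxy
    obtain ⟨q, hq1, hd2'⟩ := H₃ (y, z) hyz
    obtain ⟨s, hs1, hd3'⟩ := H₃ (x, z) hxz
    have d1 := hd1 _ _ hd1'
    have d2 := hd1 _ _ hd2'
    have d3 := hd1 _ _ hd3'
    -- Each of the three crossings of `ξ` shadows one of `γ`; the gap makes their parameters match
    -- up to a triple point of `γ`.
    have e1 : p.1 = s.1 := Hg _ _ _ _ hp1 hs1 (htri _ _ _ d1.1 d3.1)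
    have e2 : p.2 = q.1 := Hg _ _ _ _ hp1.symm hq1 (htri _ _ _ d1.2 d2.1)
    have e3 : q.2 = s.2 := Hg _ _ _ _ hq1.symm hs1.symm (htri _ _ _ d2.2 d3.2)
    rw [e1, e2] at hp1
    rw [e3] at hq1
    exact h.not_triple hp1 hq1 hs1
  · have hex : ∀ p ∈ crossPairs γ, ∃ z : ℝ × ℝ, dist z p ≤ r ∧ Cross ξ z.1 z.2 := by
      intro p hpc
      have hcr := cross_of_mem_crossPairs hpc
      obtain ⟨z, hz, hz0⟩ := (H₂ p hcr).2.2
      refine ⟨z, hz, fun k hk => ?_, hz0⟩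
      have hdz := hd1 _ _ (Metric.mem_closedBall.1 hz)
      refine Hγ p.1 (p.2 + k) ?_ (hcr.1 k) (by rw [periodic_add_int hp]; exact hcr.2)
      have h1 := abs_le.1 hdz.1
      have h2 := abs_le.1 hdz.2
      rw [abs_le]; constructor <;> linarith
    choose! f hf1 hf2 using hex
    symm
    -- Each crossing goes to the perturbed one beside it. Injectivity comes from the gap,
    -- surjectivity from local uniqueness.
    refine ncard_congr (fun p _ => (Int.fract (f p).1, Int.fract (f p).2))
      (fun p hpc => (hf2 p hpc).fract_mem hpξ) ?_ ?_
    · intro p q hpc hqc he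
      simp only [Prod.mk.injEq] at he
      obtain ⟨k, hk⟩ := Int.fract_eq_fract.1 he.1
      obtain ⟨l, hl⟩ := Int.fract_eq_fract.1 he.2
      have a1 := hd1 _ _ (hf1 p hpc)
      have a2 := hd1 _ _ (hf1 q hqc)
      have c1 := cross_of_mem_crossPairs hpc
      have c2 := (cross_of_mem_crossPairs hqc).add_int hp k l
      have b1 := abs_le.1 a1.1
      have b2 := abs_le.1 a1.2
      have b3 := abs_le.1 a2.1
      have b4 := abs_le.1 a2.2
      have e1 := Hg _ _ _ _ c1 c2 (by rw [abs_lt]; constructor <;> linarith)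
      have e2 := Hg _ _ _ _ c1.symm c2.symm (by rw [abs_lt]; constructor <;> linarith)
      exact Prod.ext (eq_of_Ico_of_eq_add_int hpc.1 hqc.1 e1)
        (eq_of_Ico_of_eq_add_int hpc.2.1 hqc.2.1 e2)
    · intro q hq
      obtain ⟨p', hp', hd⟩ := H₃ q (cross_of_mem_crossPairs hq)
      have hm := hp'.fract_mem hp
      refine ⟨(Int.fract p'.1, Int.fract p'.2), hm, ?_⟩
      have a1 := hd1 _ _ (hf1 _ hm)
      have hz := hf2 _ hm
      set z := f (Int.fract p'.1, Int.fract p'.2) with hzdef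
      have hz' := hz.add_int hpξ ⌊p'.1⌋ ⌊p'.2⌋
      have hzd : ((z.1 + ⌊p'.1⌋, z.2 + ⌊p'.2⌋) : ℝ × ℝ) ∈ Metric.closedBall p' r₀ := by
        rw [Metric.mem_closedBall, Prod.dist_eq, Real.dist_eq, Real.dist_eq]
        refine (max_le ?_ ?_).trans hrr₀
        · refine le_trans (le_of_eq ?_) a1.1
          simp only [Int.fract]; congr 1; ring
        · refine le_trans (le_of_eq ?_) a1.2
          simp only [Int.fract]; congr 1; ring
      have heq := (H₂ p' hp').1 _ hzd q (Metric.mem_closedBall.2 (hd.trans hrr₀)) hz'.2 hq.2.2.2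
      have e1 : z.1 + ⌊p'.1⌋ = q.1 := congrArg Prod.fst heq
      have e2 : z.2 + ⌊p'.2⌋ = q.2 := congrArg Prod.snd heq
      have f1 : Int.fract z.1 = q.1 := by
        rw [← Int.fract_add_intCast z.1 ⌊p'.1⌋, e1]; exact Int.fract_eq_self.2 hq.1
      have f2 : Int.fract z.2 = q.2 := by
        rw [← Int.fract_add_intCast z.2 ⌊p'.2⌋, e2]; exact Int.fract_eq_self.2 hq.2.1
      exact Prod.ext f1 f2


/-! ### Regular homotopies -/

theorem IsRegularHomotopy.comp_time {H : ℝ → ℝ → ℂ} (hH : IsRegularHomotopy H) {f : ℝ → ℝ}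
    (hf : Continuous f) (hmaps : MapsTo f (Icc 0 1) (Icc 0 1)) :
    IsRegularHomotopy fun t => H (f t) := by
  have hm : MapsTo (fun p : ℝ × ℝ => (f p.1, p.2)) (Icc 0 1 ×ˢ univ) (Icc 0 1 ×ˢ univ) :=
    fun p hp => ⟨hmaps hp.1, trivial⟩
  have hc : ContinuousOn (fun p : ℝ × ℝ => (f p.1, p.2)) (Icc 0 1 ×ˢ univ) := by fun_prop
  exact ⟨fun t ht => hH.immersed _ (hmaps ht), hH.cont.comp hc hm, hH.cont_deriv.comp hc hm⟩

/-- Concatenation of two homotopies. -/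
noncomputable def concat (H G : ℝ → ℝ → ℂ) (t : ℝ) : ℝ → ℂ :=
  if t ≤ 1 / 2 then H (2 * t) else G (2 * t - 1)

theorem concat_of_le {H G : ℝ → ℝ → ℂ} {t : ℝ} (h : t ≤ 1 / 2) : concat H G t = H (2 * t) :=
  if_pos h

theorem concat_of_ge {H G : ℝ → ℝ → ℂ} (hHG : H 1 = G 0) {t : ℝ} (h : 1 / 2 ≤ t) :
    concat H G t = G (2 * t - 1) := by
  rcases h.eq_or_lt with rfl | h
  · rw [concat_of_le le_rfl]; norm_num [hHG]
  · exact if_neg (not_le.2 h)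

theorem continuousOn_concat {F H G : ℝ → ℝ → ℂ}
    (h1 : ∀ t ≤ 1 / 2, F t = H (2 * t)) (h2 : ∀ t, 1 / 2 ≤ t → F t = G (2 * t - 1))
    (cH : ContinuousOn (fun p : ℝ × ℝ => H p.1 p.2) (Icc (0 : ℝ) 1 ×ˢ univ))
    (cG : ContinuousOn (fun p : ℝ × ℝ => G p.1 p.2) (Icc (0 : ℝ) 1 ×ˢ univ)) :
    ContinuousOn (fun p : ℝ × ℝ => F p.1 p.2) (Icc (0 : ℝ) 1 ×ˢ univ) := by
  have e : (Icc (0 : ℝ) 1 ×ˢ univ : Set (ℝ × ℝ)) =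
      (Icc (0 : ℝ) (1 / 2) ×ˢ univ) ∪ (Icc (1 / 2 : ℝ) 1 ×ˢ univ) := by
    rw [← union_prod, Icc_union_Icc_eq_Icc (by norm_num) (by norm_num)]
  rw [e]
  refine ContinuousOn.union_of_isClosed ?_ ?_ (isClosed_Icc.prod isClosed_univ)
    (isClosed_Icc.prod isClosed_univ)
  · refine (cH.comp (f := fun p : ℝ × ℝ => (2 * p.1, p.2)) (by fun_prop)
      fun p hp => ⟨⟨by linarith [hp.1.1], by linarith [hp.1.2]⟩, trivial⟩).congr ?_
    intro p hp
    simp [h1 p.1 hp.1.2]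
  · refine (cG.comp (f := fun p : ℝ × ℝ => (2 * p.1 - 1, p.2)) (by fun_prop)
      fun p hp => ⟨⟨by linarith [hp.1.1], by linarith [hp.1.2]⟩, trivial⟩).congr ?_
    intro p hp
    simp [h2 p.1 hp.1.1]

theorem IsRegularHomotopy.concat {H G : ℝ → ℝ → ℂ} (hH : IsRegularHomotopy H)
    (hG : IsRegularHomotopy G) (hHG : H 1 = G 0) : IsRegularHomotopy (concat H G) := by
  refine ⟨fun t ht => ?_, ?_, ?_⟩
  · rcases le_total t (1 / 2) with h | h
    · rw [concat_of_le h]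
      exact hH.immersed _ ⟨by linarith [ht.1], by linarith⟩
    · rw [concat_of_ge hHG h]
      exact hG.immersed _ ⟨by linarith, by linarith [ht.2]⟩
  · exact continuousOn_concat (fun t => concat_of_le) (fun t => concat_of_ge hHG) hH.cont hG.cont
  · exact continuousOn_concat (F := fun t => deriv (ArnoldLoop.concat H G t))
      (H := fun t => deriv (H t)) (G := fun t => deriv (G t))
      (fun t ht => by rw [concat_of_le ht]) (fun t ht => by rw [concat_of_ge hHG ht])
      hH.cont_deriv hG.cont_deriv

theorem eventually_close_of_periodic {F : ℝ → ℝ → ℂ}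
    (hc : ContinuousOn (fun p : ℝ × ℝ => F p.1 p.2) (Icc (0 : ℝ) 1 ×ˢ univ))
    (hp : ∀ t ∈ Icc (0 : ℝ) 1, Function.Periodic (F t) 1) {s : ℝ} (hs : s ∈ Icc (0 : ℝ) 1)
    {ε : ℝ} (hε : 0 < ε) : ∀ᶠ t in 𝓝[Icc 0 1] s, ∀ x, ‖F t x - F s x‖ ≤ ε := by
  have hu := (isCompact_Icc.prod isCompact_Icc).uniformContinuousOn_of_continuous
    (hc.mono (Set.prod_mono (Subset.refl (Icc (0 : ℝ) 1)) (subset_univ (Icc (0 : ℝ) 1))))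
  obtain ⟨r, hr, H⟩ := Metric.uniformContinuousOn_iff.1 hu ε hε
  filter_upwards [self_mem_nhdsWithin, mem_nhdsWithin_of_mem_nhds (Metric.ball_mem_nhds s hr)]
    with t ht htr x
  rw [← periodic_fract (hp t ht) x, ← periodic_fract (hp s hs) x, ← dist_eq_norm]
  have hx : Int.fract x ∈ Icc (0 : ℝ) 1 := ⟨(fract_mem_Ico x).1, (fract_mem_Ico x).2.le⟩
  refine (H (t, Int.fract x) ⟨ht, hx⟩ (s, Int.fract x) ⟨hs, hx⟩ ?_).le
  rw [Prod.dist_eq, dist_self]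
  exact max_lt htr hr

theorem IsRegularHomotopy.eventually_close {H : ℝ → ℝ → ℂ} (hH : IsRegularHomotopy H) {s : ℝ}
    (hs : s ∈ Icc (0 : ℝ) 1) {ε : ℝ} (hε : 0 < ε) :
    ∀ᶠ t in 𝓝[Icc 0 1] s, C1Close ε (H s) (H t) := by
  have h1 := eventually_close_of_periodic hH.cont (fun t ht => (hH.immersed t ht).periodic) hs hε
  have h2 := eventually_close_of_periodic (F := fun t => deriv (H t)) hH.cont_deriv
    (fun t ht => periodic_deriv (hH.immersed t ht).periodic) hs hε
  filter_upwards [h1, h2] with t ht1 ht2 x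
  exact ⟨ht1 x, ht2 x⟩

/-- The quotient of the two tangents stays in the right half-plane, where the argument is
continuous. Adding this periodic argument to the angle function of `γ` gives one for `ξ`. -/
theorem HasWindingNumber.of_close {γ ξ : ℝ → ℂ} {ω : ℤ} (h : HasWindingNumber γ ω)
    (hγ : IsC1Loop γ) (hξ : IsC1Loop ξ) (hc : ∀ x, ‖deriv ξ x - deriv γ x‖ < ‖deriv γ x‖) :
    HasWindingNumber ξ ω := by
  obtain ⟨θ, hθ, hpol, hper⟩ := h
  have h0 : ∀ x, deriv γ x ≠ 0 := fun x => norm_pos_iff.1 ((norm_nonneg _).trans_lt (hc x))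
  have hslit : ∀ x, deriv ξ x / deriv γ x ∈ Complex.slitPlane := by
    intro x
    refine Or.inl ?_
    have h1 : ‖deriv ξ x / deriv γ x - 1‖ < 1 := by
      rw [div_sub_one (h0 x), norm_div, div_lt_one (norm_pos_iff.2 (h0 x))]
      exact hc x
    have h2 := (abs_le.1 (Complex.abs_re_le_norm (deriv ξ x / deriv γ x - 1))).1
    rw [Complex.sub_re, Complex.one_re] at h2
    linarith
  refine ⟨fun x => θ x + Complex.arg (deriv ξ x / deriv γ x), ?_, fun x => ?_, fun x => ?_⟩
  · refine hθ.add (continuous_iff_continuousAt.2 fun x => ?_)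
    refine (Complex.continuousAt_arg (hslit x)).comp (f := fun x => deriv ξ x / deriv γ x) ?_
    exact ((hξ.contDiff.continuous_deriv le_rfl).div (hγ.contDiff.continuous_deriv le_rfl)
      h0).continuousAt
  · have h1 := Complex.norm_mul_exp_arg_mul_I (deriv ξ x / deriv γ x)
    have h2 : deriv ξ x = deriv γ x * (deriv ξ x / deriv γ x) := (mul_div_cancel₀ _ (h0 x)).symm
    set z := deriv ξ x / deriv γ x
    have h3 : ‖deriv ξ x‖ = ‖deriv γ x‖ * ‖z‖ := by rw [h2, norm_mul]
    rw [h3, Complex.ofReal_mul, Complex.ofReal_add, add_mul, Complex.exp_add]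
    calc deriv ξ x = deriv γ x * z := h2
      _ = (‖deriv γ x‖ * Complex.exp (θ x * Complex.I)) *
          (‖z‖ * Complex.exp (z.arg * Complex.I)) := by rw [h1, ← hpol x]
      _ = _ := by ring
  · simp only [hper, periodic_deriv hγ.periodic x, periodic_deriv hξ.periodic x]
    ring

/-- Connectedness of [0,1]: a transitive symmetric relation that holds between nearby times holds
between all times. It propagates discrete invariants along homotopies. -/
theorem unitInterval_induction {P : ℝ → ℝ → Prop}
    (hloc : ∀ s ∈ Icc (0 : ℝ) 1, ∀ᶠ t in 𝓝[Icc 0 1] s, P s t)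
    (htrans : ∀ r s t, P r s → P s t → P r t) (hsymm : ∀ s t, P s t → P t s)
    {s t : ℝ} (hs : s ∈ Icc (0 : ℝ) 1) (ht : t ∈ Icc (0 : ℝ) 1) : P s t :=
  isPreconnected_Icc.induction₂ P hloc (fun {x y z} _ _ _ => htrans x y z)
    (fun {x y} _ _ => hsymm x y) hs ht

theorem IsRegularHomotopy.hasWindingNumber {H : ℝ → ℝ → ℂ} (hH : IsRegularHomotopy H) {ω : ℤ}
    (h0 : HasWindingNumber (H 0) ω) : HasWindingNumber (H 1) ω := by
  have key := unitInterval_induction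
    (P := fun s t => HasWindingNumber (H s) ω ↔ HasWindingNumber (H t) ω) ?_
    (fun _ _ _ h1 h2 => h1.trans h2) (fun _ _ h => h.symm)
    (s := 0) (t := 1) (by simp) (by simp)
  · exact key.1 h0
  · intro s hs
    have hi := hH.immersed s hs
    obtain ⟨m, hm, hm'⟩ := exists_lower_bound_of_periodic hi.continuous_deriv
      (periodic_deriv hi.periodic) hi.deriv_ne_zero
    -- With `m / 3` the perturbed speed stays above `2 * m / 3`, so the strict comparison is
    -- available in both directions.
    filter_upwards [hH.eventually_close hs (ε := m / 3) (by positivity), self_mem_nhdsWithin]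
      with t htc ht
    have hc1 := hi.isC1Loop
    have hc2 := (hH.immersed t ht).isC1Loop
    constructor
    · intro h
      exact h.of_close hc1 hc2 fun x => by linarith [(htc x).2, hm' x]
    · intro h
      refine h.of_close hc2 hc1 fun x => ?_
      rw [norm_sub_rev]
      have h1 := norm_sub_norm_le (deriv (H s) x) (deriv (H t) x)
      rw [norm_sub_rev] at h1
      linarith [(htc x).2, hm' x]

theorem IsRegularHomotopy.ncard_crossPairs {H : ℝ → ℝ → ℂ} (hH : IsRegularHomotopy H)
    (hg : ∀ t ∈ Icc (0 : ℝ) 1, IsGeneric (H t)) :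
    (crossPairs (H 1)).ncard = (crossPairs (H 0)).ncard := by
  refine unitInterval_induction
    (P := fun s t => (crossPairs (H s)).ncard = (crossPairs (H t)).ncard) ?_
    (fun _ _ _ h1 h2 => h1.trans h2) (fun _ _ h => h.symm)
    (s := 1) (t := 0) (by simp) (by simp)
  intro s hs
  obtain ⟨ε, hε, Hε⟩ := (hg s hs).exists_stable
  filter_upwards [hH.eventually_close hs hε, self_mem_nhdsWithin] with t htc ht
  exact (Hε _ (hH.immersed t ht).isC1Loop htc).2.symm

/-! ### Extending generic paths -/

theorem eventually_concat_left {H G : ℝ → ℝ → ℂ} {t : ℝ} (ht : t < 1) :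
    ∀ᶠ s in 𝓝 (t / 2), concat H G s = H (2 * s) := by
  filter_upwards [eventually_lt_nhds (show t / 2 < 1 / 2 by linarith)] with s hs
  exact concat_of_le hs.le

theorem tendsto_two_mul_nhdsLT (t : ℝ) : Tendsto (fun s : ℝ => 2 * s) (𝓝[<] (t / 2)) (𝓝[<] t) := by
  refine tendsto_nhdsWithin_iff.2 ⟨?_, ?_⟩
  · have : Tendsto (fun s : ℝ => 2 * s) (𝓝 (t / 2)) (𝓝 (2 * (t / 2))) :=
      (continuous_const.mul continuous_id).tendsto _
    rw [mul_div_cancel₀ t two_ne_zero] at this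
    exact this.mono_left nhdsWithin_le_nhds
  · filter_upwards [self_mem_nhdsWithin] with s hs
    have : s < t / 2 := hs
    exact mem_Iio.2 (by linarith)

theorem tendsto_two_mul_nhdsGT (t : ℝ) : Tendsto (fun s : ℝ => 2 * s) (𝓝[>] (t / 2)) (𝓝[>] t) := by
  refine tendsto_nhdsWithin_iff.2 ⟨?_, ?_⟩
  · have : Tendsto (fun s : ℝ => 2 * s) (𝓝 (t / 2)) (𝓝 (2 * (t / 2))) :=
      (continuous_const.mul continuous_id).tendsto _
    rw [mul_div_cancel₀ t two_ne_zero] at this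
    exact this.mono_left nhdsWithin_le_nhds
  · filter_upwards [self_mem_nhdsWithin] with s hs
    have : t / 2 < s := hs
    exact mem_Ioi.2 (by linarith)

theorem TangencySign.concat {H : ℝ → ℝ → ℂ} {t : ℝ} {ε : ℤ} (h : TangencySign H t ε) (ht : t < 1)
    (G : ℝ → ℝ → ℂ) : TangencySign (concat H G) (t / 2) ε := by
  refine ⟨h.1, ?_⟩
  have e := eventually_concat_left (H := H) (G := G) ht
  filter_upwards [(tendsto_two_mul_nhdsLT t).eventually h.2, e.filter_mono nhdsWithin_le_nhds]
    with s hs hse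
  filter_upwards [(tendsto_two_mul_nhdsGT t).eventually hs, e.filter_mono nhdsWithin_le_nhds]
    with s' hs' hse'
  rw [hse, hse']
  exact hs'

theorem TripleCrossing.concat {H : ℝ → ℝ → ℂ} {t : ℝ} {ε : ℤ} (h : TripleCrossing H t ε)
    (ht : t < 1) (G : ℝ → ℝ → ℂ) : TripleCrossing (concat H G) (t / 2) ε := by
  obtain ⟨h1, a, b, c, habc, hr⟩ := h
  have e := eventually_concat_left (H := H) (G := G) ht
  refine ⟨h1, a, b, c, ?_, fun r hr0 => ⟨?_, ?_⟩⟩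
  · rw [concat_of_le (by linarith), mul_div_cancel₀ t two_ne_zero]; exact habc
  · filter_upwards [(tendsto_two_mul_nhdsLT t).eventually (hr r hr0).1,
      e.filter_mono nhdsWithin_le_nhds] with s hs hse
    rw [hse]; exact hs
  · filter_upwards [(tendsto_two_mul_nhdsGT t).eventually (hr r hr0).2,
      e.filter_mono nhdsWithin_le_nhds] with s hs hse
    rw [hse]; exact hs

/-- A homotopy through generic immersions is appended to the defining generic path. It contributes
no crossing, and the old crossing times are merely halved. -/
theorem HasArnoldInvariants.of_homotopy {G : ℝ → ℝ → ℂ} {jp jm s ω : ℤ}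
    (h : HasArnoldInvariants (G 0) jp jm s ω) (hG : IsRegularHomotopy G)
    (hgen : ∀ t ∈ Icc (0 : ℝ) 1, IsGeneric (G t)) : HasArnoldInvariants (G 1) jp jm s ω := by
  obtain ⟨H, D, I, T, ε, hH, h0, h1, hjp, hjm, hs⟩ := h
  have hinj : Function.Injective fun t : ℝ => t / 2 := fun a b hab => by
    simp only at hab; linarith
  have hsum : ∀ F : Finset ℝ, ∑ t ∈ F.image (fun t : ℝ => t / 2), ε (2 * t) = ∑ t ∈ F, ε t := by
    intro F
    rw [Finset.sum_image fun a _ b _ hab => hinj hab]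
    refine Finset.sum_congr rfl fun t _ => ?_
    rw [mul_div_cancel₀ t two_ne_zero]
  have hnm : ∀ (F : Finset ℝ) (t : ℝ), t ∉ F.image (fun t : ℝ => t / 2) → 2 * t ∉ F := by
    intro F t ht h2
    exact ht (Finset.mem_image.2 ⟨2 * t, h2, by ring⟩)
  refine ⟨concat H G, D.image (fun t => t / 2), I.image (fun t => t / 2),
    T.image (fun t => t / 2), fun t => ε (2 * t), ⟨hH.homotopy.concat hG h1, ?_, ?_, ?_, ?_⟩,
    ?_, ?_, ?_, ?_, ?_⟩
  · intro t ht
    obtain ⟨s, hs, rfl⟩ := Finset.mem_image.1 ht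
    obtain ⟨h01, hst, hsg⟩ := hH.direct s hs
    refine ⟨⟨by linarith [h01.1], by linarith [h01.2]⟩, ?_, ?_⟩
    · rw [concat_of_le (by linarith [h01.2]), mul_div_cancel₀ s two_ne_zero]; exact hst
    · simp only [mul_div_cancel₀ s (two_ne_zero' ℝ)]; exact hsg.concat h01.2 G
  · intro t ht
    obtain ⟨s, hs, rfl⟩ := Finset.mem_image.1 ht
    obtain ⟨h01, hst, hsg⟩ := hH.inverse s hs
    refine ⟨⟨by linarith [h01.1], by linarith [h01.2]⟩, ?_, ?_⟩
    · rw [concat_of_le (by linarith [h01.2]), mul_div_cancel₀ s two_ne_zero]; exact hst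
    · simp only [mul_div_cancel₀ s (two_ne_zero' ℝ)]; exact hsg.concat h01.2 G
  · intro t ht
    obtain ⟨s, hs, rfl⟩ := Finset.mem_image.1 ht
    obtain ⟨h01, hsg⟩ := hH.triple s hs
    refine ⟨⟨by linarith [h01.1], by linarith [h01.2]⟩, ?_⟩
    simp only [mul_div_cancel₀ s (two_ne_zero' ℝ)]; exact hsg.concat h01.2 G
  · intro t ht hD hI hT
    rcases le_total t (1 / 2) with h | h
    · rw [concat_of_le h]
      exact hH.generic _ ⟨by linarith [ht.1], by linarith⟩ (hnm _ _ hD) (hnm _ _ hI) (hnm _ _ hT)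
    · rw [concat_of_ge h1 h]
      exact hgen _ ⟨by linarith, by linarith [ht.2]⟩
  · rw [concat_of_le (by norm_num), mul_zero, h0]
  · rw [concat_of_ge h1 (by norm_num)]; norm_num
  · rw [hsum]; exact hjp
  · rw [hsum]; exact hjm
  · rw [hsum]; exact hs

theorem genericClass_of_homotopy {G : ℝ → ℝ → ℂ} {jp jm s ω : ℤ}
    (h : G 0 ∈ genericClass jp jm s ω) (hG : IsRegularHomotopy G)
    (hgen : ∀ t ∈ Icc (0 : ℝ) 1, IsGeneric (G t)) {t : ℝ} (ht : t ∈ Icc (0 : ℝ) 1) :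
    G t ∈ genericClass jp jm s ω := by
  -- Multiplying the time by `t` truncates the homotopy, so that `G t` becomes its endpoint.
  have hmaps : MapsTo (fun r : ℝ => r * t) (Icc 0 1) (Icc 0 1) := fun r hr =>
    ⟨mul_nonneg hr.1 ht.1, mul_le_one₀ hr.2 ht.1 ht.2⟩
  have hG' := hG.comp_time (f := fun r => r * t) (by fun_prop) hmaps
  have hg' : ∀ r ∈ Icc (0 : ℝ) 1, IsGeneric (G (r * t)) := fun r hr => hgen _ (hmaps hr)
  have h0 : G (0 * t) ∈ genericClass jp jm s ω := by rwa [zero_mul]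
  have e : G t = G (1 * t) := by rw [one_mul]
  rw [e]
  refine ⟨hg' 1 (by simp), ?_, ?_⟩
  · exact hG'.hasWindingNumber h0.2.1
  · exact HasArnoldInvariants.of_homotopy (G := fun r => G (r * t)) h0.2.2 hG' hg'

/-! ### Compartments -/

variable {jp jm s ω : ℤ} {C : Set (ℝ → ℂ)}

theorem IsCompartment.nonempty (hC : IsCompartment jp jm s ω C) : C.Nonempty := by
  obtain ⟨γ₀, h0, rfl⟩ := hC
  refine ⟨γ₀, fun _ => γ₀, ⟨fun _ _ => h0.1.immersed, ?_, ?_⟩, rfl, rfl, fun _ _ => h0⟩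
  · exact (h0.1.immersed.continuous.comp continuous_snd).continuousOn
  · exact (h0.1.immersed.continuous_deriv.comp continuous_snd).continuousOn

theorem IsCompartment.subset (hC : IsCompartment jp jm s ω C) : C ⊆ genericClass jp jm s ω := by
  obtain ⟨γ₀, h0, rfl⟩ := hC
  rintro γ ⟨H, _, _, rfl, hH⟩
  exact hH 1 (by simp)

theorem IsCompartment.isGeneric (hC : IsCompartment jp jm s ω C) {γ : ℝ → ℂ} (h : γ ∈ C) :
    IsGeneric γ := (hC.subset h).1

theorem IsCompartment.mem_of_homotopy (hC : IsCompartment jp jm s ω C) {G : ℝ → ℝ → ℂ}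
    (h : G 0 ∈ C) (hG : IsRegularHomotopy G) (hgen : ∀ t ∈ Icc (0 : ℝ) 1, IsGeneric (G t)) :
    G 1 ∈ C := by
  have h0 := hC.subset h
  obtain ⟨γ₀, h00, rfl⟩ := hC
  obtain ⟨H, hH, hH0, hH1, hHC⟩ := h
  refine ⟨concat H G, hH.concat hG hH1, ?_, ?_, fun t ht => ?_⟩
  · rw [concat_of_le (by norm_num), mul_zero, hH0]
  · rw [concat_of_ge hH1 (by norm_num)]; norm_num
  · rcases le_total t (1 / 2) with h | h
    · rw [concat_of_le h]
      exact hHC _ ⟨by linarith [ht.1], by linarith⟩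
    · rw [concat_of_ge hH1 h]
      exact genericClass_of_homotopy h0 hG hgen ⟨by linarith, by linarith [ht.2]⟩

/-- Stability makes the number of double points locally constant along a path of generic immersions.
The cancellation of crossing energies between two curves of a compartment depends on this. -/
theorem IsCompartment.ncard_eq (hC : IsCompartment jp jm s ω C) {γ ξ : ℝ → ℂ} (h : γ ∈ C)
    (h' : ξ ∈ C) : (crossPairs γ).ncard = (crossPairs ξ).ncard := by
  obtain ⟨γ₀, h00, rfl⟩ := hC
  obtain ⟨H, hH, hH0, rfl, hHC⟩ := h
  obtain ⟨G, hG, hG0, rfl, hGC⟩ := h'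
  rw [hH.ncard_crossPairs fun t ht => (hHC t ht).1, hG.ncard_crossPairs fun t ht => (hGC t ht).1,
    hH0, hG0]

/-- The linear homotopy between two curves. -/
noncomputable def linHomotopy (γ ξ : ℝ → ℂ) (t : ℝ) : ℝ → ℂ := fun x => γ x + t • (ξ x - γ x)

theorem deriv_linHomotopy {γ ξ : ℝ → ℂ} (hγ : IsC1Loop γ) (hξ : IsC1Loop ξ) (t x : ℝ) :
    deriv (linHomotopy γ ξ t) x = deriv γ x + t • (deriv ξ x - deriv γ x) := by
  have h1 := (hγ.differentiable x).hasDerivAt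
  have h2 := (hξ.differentiable x).hasDerivAt
  exact (h1.add ((h2.sub h1).const_smul t)).deriv

theorem isC1Loop_linHomotopy {γ ξ : ℝ → ℂ} (hγ : IsC1Loop γ) (hξ : IsC1Loop ξ) (t : ℝ) :
    IsC1Loop (linHomotopy γ ξ t) := by
  refine ⟨fun x => ?_, ?_⟩
  · simp only [linHomotopy, hγ.periodic x, hξ.periodic x]
  · exact hγ.contDiff.add ((hξ.contDiff.sub hγ.contDiff).const_smul t)

theorem isRegularHomotopy_linHomotopy {γ ξ : ℝ → ℂ} (hγ : IsC1Loop γ) (hξ : IsC1Loop ξ)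
    (h : ∀ t ∈ Icc (0 : ℝ) 1, ∀ x, deriv (linHomotopy γ ξ t) x ≠ 0) :
    IsRegularHomotopy (linHomotopy γ ξ) := by
  have h1 := hγ.contDiff.continuous_deriv le_rfl
  have h2 := hξ.contDiff.continuous_deriv le_rfl
  have h3 := hγ.contDiff.continuous
  have h4 := hξ.contDiff.continuous
  refine ⟨fun t ht => ⟨(isC1Loop_linHomotopy hγ hξ t).1, (isC1Loop_linHomotopy hγ hξ t).2,
    h t ht⟩, ?_, ?_⟩
  · unfold linHomotopy; fun_prop
  · simp only [deriv_linHomotopy hγ hξ]; fun_prop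

theorem norm_add_smul_sub_le {a b c : ℂ} {ε t : ℝ} (ht : t ∈ Icc (0 : ℝ) 1) (ha : ‖a - c‖ ≤ ε)
    (hb : ‖b - c‖ ≤ ε) : ‖a + t • (b - a) - c‖ ≤ ε := by
  have h := (convex_closedBall c ε) (x := a) (by simpa [dist_eq_norm] using ha) (y := b)
    (by simpa [dist_eq_norm] using hb) (a := 1 - t) (b := t) (by linarith [ht.2]) ht.1 (by ring)
  rw [Metric.mem_closedBall, dist_eq_norm] at h
  have e : a + t • (b - a) = (1 - t) • a + t • b := by rw [smul_sub, sub_smul, one_smul]; abel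
  rwa [e]

theorem IsCompartment.mem_of_linHomotopy (hC : IsCompartment jp jm s ω C) {γ ξ : ℝ → ℂ}
    (hγ : γ ∈ C) (hξ : IsC1Loop ξ)
    (hgen : ∀ t ∈ Icc (0 : ℝ) 1, IsGeneric (linHomotopy γ ξ t)) : ξ ∈ C := by
  have e0 : linHomotopy γ ξ 0 = γ := by funext x; simp [linHomotopy]
  have e1 : linHomotopy γ ξ 1 = ξ := by funext x; simp [linHomotopy]
  rw [← e1]
  exact hC.mem_of_homotopy (by rwa [e0])
    (isRegularHomotopy_linHomotopy (hC.isGeneric hγ).immersed.isC1Loop hξ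
      fun t ht => (hgen t ht).immersed.deriv_ne_zero) hgen

/-- Near a generic immersion, all loops belong to the same compartment. -/
theorem IsCompartment.exists_mem_of_close (hC : IsCompartment jp jm s ω C) {Γ : ℝ → ℂ}
    (hΓ : IsGeneric Γ) : ∃ ε > 0, ∀ γ ξ, γ ∈ C → C1Close ε Γ γ → IsC1Loop ξ → C1Close ε Γ ξ →
      ξ ∈ C := by
  obtain ⟨ε, hε, H⟩ := hΓ.exists_stable
  refine ⟨ε, hε, fun γ ξ hγ hγc hξ hξc => ?_⟩
  have h1 := (hC.isGeneric hγ).immersed.isC1Loop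
  refine hC.mem_of_linHomotopy hγ hξ fun t ht => (H _ (isC1Loop_linHomotopy h1 hξ t) ?_).1
  intro x
  refine ⟨norm_add_smul_sub_le ht (hγc x).1 (hξc x).1, ?_⟩
  rw [deriv_linHomotopy h1 hξ]
  exact norm_add_smul_sub_le ht (hγc x).2 (hξc x).2

/-! ### Invariance under reparametrization and translation -/

theorem IsGeneric.of_deriv_smul {γ ξ : ℝ → ℂ} (h : IsGeneric γ) (hξ : IsImmersedLoop ξ)
    (φ : ℝ → ℝ) (c : ℝ → ℝ) (hd : ∀ x, deriv ξ x = c x • deriv γ (φ x))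
    (hcr : ∀ x y, Cross ξ x y → Cross γ (φ x) (φ y)) : IsGeneric ξ := by
  refine IsGeneric.of_cross hξ (fun x y hxy => ?_) fun x y z h1 h2 h3 =>
    h.not_triple (hcr _ _ h1) (hcr _ _ h2) (hcr _ _ h3)
  have h1 := transverseAt_iff.1 (h.transverse_of_cross (hcr _ _ hxy))
  have hc : ∀ x, c x ≠ 0 := fun x h0 => hξ.deriv_ne_zero x (by rw [hd, h0, zero_smul])
  rw [transverseAt_iff, hd, hd, det_smul_left, det_smul_right]
  exact mul_ne_zero (hc x) (mul_ne_zero (hc y) h1)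

theorem IsGeneric.add_const {γ : ℝ → ℂ} (h : IsGeneric γ) (c : ℂ) :
    IsGeneric fun x => γ x + c := by
  have hd : ∀ x, deriv (fun x => γ x + c) x = deriv γ x := fun x => by simp
  refine h.of_deriv_smul ⟨fun x => by simp only [h.immersed.periodic x],
    h.immersed.contDiff.add contDiff_const, fun x => by rw [hd]; exact h.immersed.deriv_ne_zero x⟩
    id 1 (fun x => by simp) fun x y hxy => ⟨hxy.1, by simpa using hxy.2⟩

theorem IsCompartment.add_const (hC : IsCompartment jp jm s ω C) {γ : ℝ → ℂ} (hγ : γ ∈ C) (c : ℂ) :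
    (fun x => γ x + c) ∈ C := by
  have hg := hC.isGeneric hγ
  refine hC.mem_of_linHomotopy hγ (hg.add_const c).immersed.isC1Loop fun t _ => ?_
  have : linHomotopy γ (fun x => γ x + c) t = fun x => γ x + t • c := by
    funext x; simp [linHomotopy]
  rw [this]
  exact hg.add_const _


/-! ### Deformations by diffeomorphisms of the plane -/

/-- For `K < 1` this makes every map of the isotopy from the identity to `z ↦ z + V z` injective, so
composition creates no new crossing. -/
theorem one_sub_mul_norm_le {V : ℂ → ℂ} {K : ℝ}
    (hK : ∀ z w, ‖V z - V w‖ ≤ K * ‖z - w‖) {t : ℝ} (ht : t ∈ Icc (0 : ℝ) 1) (z w : ℂ) :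
    (1 - K) * ‖z - w‖ ≤ ‖(z + t • V z) - (w + t • V w)‖ := by
  have e : (z + t • V z) - (w + t • V w) = (z - w) - (-(t • (V z - V w))) := by
    rw [smul_sub]; abel
  rw [e]
  have h1 := norm_sub_norm_le (z - w) (-(t • (V z - V w)))
  rw [norm_neg, norm_smul, Real.norm_eq_abs, abs_of_nonneg ht.1] at h1
  have h2 : t * ‖V z - V w‖ ≤ 1 * ‖V z - V w‖ :=
    mul_le_mul_of_nonneg_right ht.2 (norm_nonneg _)
  linarith [hK z w]

variable {jp jm s ω : ℤ} {C : Set (ℝ → ℂ)}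

theorem hasDerivAt_add_comp {γ : ℝ → ℂ} (hγ : IsC1Loop γ) {V : ℂ → ℂ} (hV : ContDiff ℝ 1 V)
    (t x : ℝ) : HasDerivAt (fun x => γ x + t • V (γ x))
      (deriv γ x + t • fderiv ℝ V (γ x) (deriv γ x)) x := by
  have h1 := (hγ.differentiable x).hasDerivAt
  have h2 := ((hV.differentiable one_ne_zero (γ x)).hasFDerivAt).comp_hasDerivAt x h1
  exact h1.add (h2.const_smul t)

/-- The map `z ↦ z + t • V z` is injective with injective differential. Crossings correspond to
crossings, and both tangents at one are moved by the same linear isomorphism. -/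
theorem IsGeneric.add_comp {γ : ℝ → ℂ} (h : IsGeneric γ) {V : ℂ → ℂ} (hV : ContDiff ℝ 1 V)
    {K : ℝ} (hK0 : 0 ≤ K) (hK1 : K < 1) (hK : ∀ z w, ‖V z - V w‖ ≤ K * ‖z - w‖) {t : ℝ}
    (ht : t ∈ Icc (0 : ℝ) 1) : IsGeneric fun x => γ x + t • V (γ x) := by
  have hc1 := h.immersed.isC1Loop
  have hnorm : ∀ z, ‖fderiv ℝ V z‖ ≤ K := fun z => by
    have : LipschitzWith ⟨K, hK0⟩ V := LipschitzWith.of_dist_le_mul fun z w => by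
      rw [dist_eq_norm, dist_eq_norm]; exact hK z w
    exact norm_fderiv_le_of_lipschitz ℝ this
  have hker : ∀ z v, v + t • fderiv ℝ V z v = 0 → v = 0 := by
    intro z v hv
    have h1 : ‖v‖ = t * ‖fderiv ℝ V z v‖ := by
      rw [eq_neg_of_add_eq_zero_left hv, norm_neg, norm_smul, Real.norm_eq_abs,
        abs_of_nonneg ht.1, ← eq_neg_of_add_eq_zero_left hv]
    have h2 := (fderiv ℝ V z).le_of_opNorm_le (hnorm z) v
    have h3 : t * ‖fderiv ℝ V z v‖ ≤ 1 * ‖fderiv ℝ V z v‖ :=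
      mul_le_mul_of_nonneg_right ht.2 (norm_nonneg _)
    have h4 : ‖v‖ = 0 := le_antisymm (by nlinarith [norm_nonneg v]) (norm_nonneg _)
    exact norm_eq_zero.1 h4
  have hcross : ∀ x y, Cross (fun x => γ x + t • V (γ x)) x y → Cross γ x y := by
    intro x y hxy
    refine ⟨hxy.1, ?_⟩
    have h1 := one_sub_mul_norm_le hK ht (γ x) (γ y)
    have h2 : γ x + t • V (γ x) = γ y + t • V (γ y) := hxy.2
    rw [h2, sub_self, norm_zero] at h1
    have h3 : ‖γ x - γ y‖ = 0 := le_antisymm (by nlinarith [norm_nonneg (γ x - γ y)])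
      (norm_nonneg _)
    exact sub_eq_zero.1 (norm_eq_zero.1 h3)
  have hd : ∀ x, deriv (fun x => γ x + t • V (γ x)) x =
      deriv γ x + t • fderiv ℝ V (γ x) (deriv γ x) := fun x => (hasDerivAt_add_comp hc1 hV t x).deriv
  refine IsGeneric.of_cross ⟨fun x => ?_, ?_, fun x h0 => ?_⟩ (fun x y hxy => ?_)
    fun x y z h1 h2 h3 => h.not_triple (hcross _ _ h1) (hcross _ _ h2) (hcross _ _ h3)
  · simp only [h.immersed.periodic x]
  · exact hc1.contDiff.add ((hV.comp hc1.contDiff).const_smul t)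
  · rw [hd] at h0
    exact h.immersed.deriv_ne_zero x (hker _ _ h0)
  · have hcr := hcross _ _ hxy
    have h1 : LinearIndependent ℝ ![deriv γ x, deriv γ y] := h.transverse_of_cross hcr
    let A : ℂ →ₗ[ℝ] ℂ := LinearMap.id + t • (fderiv ℝ V (γ x)).toLinearMap
    have h2 := h1.map' A (by
      rw [LinearMap.ker_eq_bot']
      intro v hv
      exact hker (γ x) v (by simpa [A] using hv))
    unfold TransverseAt
    rw [hd, hd, ← hcr.2]
    have e : ![deriv γ x + t • fderiv ℝ V (γ x) (deriv γ x),
        deriv γ y + t • fderiv ℝ V (γ x) (deriv γ y)] = A ∘ ![deriv γ x, deriv γ y] := by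
      funext i
      fin_cases i <;> simp [A]
    rw [e]
    exact h2

/-- A compartment is invariant under plane diffeomorphisms close to the identity. -/
theorem IsCompartment.add_comp (hC : IsCompartment jp jm s ω C) {γ : ℝ → ℂ} (hγ : γ ∈ C)
    {V : ℂ → ℂ} (hV : ContDiff ℝ 1 V) {K : ℝ} (hK0 : 0 ≤ K) (hK1 : K < 1)
    (hK : ∀ z w, ‖V z - V w‖ ≤ K * ‖z - w‖) : (fun x => γ x + V (γ x)) ∈ C := by
  have hg := hC.isGeneric hγ
  refine hC.mem_of_linHomotopy hγ ?_ fun t ht => ?_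
  · have := (hg.add_comp hV hK0 hK1 hK (t := 1) (by simp)).immersed.isC1Loop
    simpa using this
  · have := hg.add_comp hV hK0 hK1 hK ht
    convert this using 2
    simp [linHomotopy]

/-- Stretching by the factor `1 + c` in the direction `e`. -/
noncomputable def stretch (c : ℝ) (e a : ℂ) : ℂ := a + (c * inner ℝ a e) • e

theorem inner_stretch {e : ℂ} (he : ‖e‖ = 1) (c : ℝ) (a : ℂ) :
    inner ℝ (stretch c e a) e = (1 + c) * inner ℝ a e := by
  rw [stretch, inner_add_left, inner_smul_left, real_inner_self_eq_norm_sq, he]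
  simp; ring

theorem stretch_stretch {e : ℂ} (he : ‖e‖ = 1) (c d : ℝ) (a : ℂ) :
    stretch d e (stretch c e a) = stretch ((1 + c) * (1 + d) - 1) e a := by
  conv_lhs => rw [stretch, inner_stretch he, stretch]
  rw [stretch, add_assoc, ← add_smul]
  congr 2; ring

theorem inner_stretch_stretch {e : ℂ} (he : ‖e‖ = 1) (c : ℝ) (a b : ℂ) :
    inner ℝ (stretch c e a) (stretch c e b) =
      inner ℝ a b + ((1 + c) ^ 2 - 1) * (inner ℝ a e * inner ℝ b e) := by
  conv_lhs => rw [stretch.eq_1 c e b]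
  rw [inner_add_right, inner_smul_right, inner_stretch he, stretch, inner_add_left,
    inner_smul_left, real_inner_comm b e]
  simp; ring

/-- Two independent vectors become orthogonal after a suitable stretching. -/
theorem exists_stretch_orthogonal {a b : ℂ} (h : det a b ≠ 0) :
    ∃ e : ℂ, ‖e‖ = 1 ∧ ∃ l > 0, inner ℝ (stretch (l - 1) e a) (stretch (l - 1) e b) = 0 := by
  have ha : a ≠ 0 := fun h0 => h (by simp [h0, det])
  have hb : b ≠ 0 := fun h0 => h (by simp [h0, det])
  have hna := norm_pos_iff.2 ha
  have hnb := norm_pos_iff.2 hb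
  have hsq := inner_sq_add_det_sq a b
  set A := ‖a‖
  set B := ‖b‖
  set k := inner ℝ a b / (A * B) with hk
  have hab : inner ℝ a b = k * (A * B) := by rw [hk]; field_simp
  have hk2 : k ^ 2 < 1 := by
    have h1 : 0 < det a b ^ 2 := by positivity
    have h2 : 0 < (A * B) ^ 2 := by positivity
    rw [hab] at hsq
    nlinarith
  have hk' := (sq_lt_one_iff_abs_lt_one k).1 hk2
  rw [abs_lt] at hk'
  -- Stretching along the bisector of the two directions. If `k` is the cosine of their angle, the
  -- half angle has squared tangent (1 - k)/(1 + k), and this must be the square of the stretching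
  -- factor.
  set u : ℂ := A⁻¹ • a + B⁻¹ • b with hu
  have hau : inner ℝ a u = A * (1 + k) := by
    rw [hu, inner_add_right, inner_smul_right, inner_smul_right, real_inner_self_eq_norm_sq, hab]
    change A⁻¹ * A ^ 2 + _ = _
    field_simp
  have hbu : inner ℝ b u = B * (1 + k) := by
    rw [hu, inner_add_right, inner_smul_right, inner_smul_right, real_inner_self_eq_norm_sq,
      real_inner_comm, hab]
    change _ + B⁻¹ * B ^ 2 = _
    field_simp; ring
  have huu : ‖u‖ ^ 2 = 2 * (1 + k) := by
    rw [← real_inner_self_eq_norm_sq]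
    conv_lhs => rw [hu, inner_add_left, inner_smul_left, inner_smul_left, ← hu, hau, hbu]
    simp only [conj_trivial]
    field_simp; ring
  have hu0 : 0 < ‖u‖ := by
    refine norm_pos_iff.2 fun h0 => ?_
    rw [h0] at huu
    simp at huu
    linarith
  refine ⟨‖u‖⁻¹ • u, by rw [norm_smul, norm_inv, norm_norm, inv_mul_cancel₀ hu0.ne'],
    Real.sqrt ((1 - k) / (1 + k)), Real.sqrt_pos.2 (div_pos (by linarith) (by linarith)), ?_⟩
  rw [inner_stretch_stretch (by rw [norm_smul, norm_inv, norm_norm, inv_mul_cancel₀ hu0.ne']),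
    inner_smul_right, inner_smul_right, hau, hbu, hab]
  have h1 : (1 + (Real.sqrt ((1 - k) / (1 + k)) - 1)) ^ 2 = (1 - k) / (1 + k) := by
    rw [add_sub_cancel, Real.sq_sqrt (div_nonneg (by linarith) (by linarith))]
  rw [h1]
  have h2 : ‖u‖⁻¹ * (A * (1 + k)) * (‖u‖⁻¹ * (B * (1 + k))) =
      (‖u‖ ^ 2)⁻¹ * (A * B * (1 + k) ^ 2) := by
    rw [sq ‖u‖, mul_inv]; ring
  rw [h2, huu]
  have h3 : 1 + k ≠ 0 := by linarith
  field_simp; ring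

/-- The linear field is cut off and rescaled as ρ·f(z/ρ), which leaves its Lipschitz constant
unchanged. So `L` does not depend on `ρ`, and the support can be shrunk around one crossing at no
cost. -/
theorem exists_stretch_field : ∃ L > 0, ∀ (P e : ℂ) (ρ c : ℝ), ‖e‖ = 1 → 0 < ρ →
    ∃ V : ℂ → ℂ, ContDiff ℝ 1 V ∧ (∀ z w, ‖V z - V w‖ ≤ |c| * L * ‖z - w‖) ∧
      (∀ z, ‖z - P‖ ≤ ρ → V z = (c * inner ℝ (z - P) e) • e) ∧
      ∀ z, 2 * ρ ≤ ‖z - P‖ → V z = 0 := by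
  let f : ContDiffBump (0 : ℂ) := ⟨1, 2, one_pos, one_lt_two⟩
  have hcd : ContDiff ℝ 1 fun w : ℂ => f w • w := f.contDiff.smul contDiff_id
  have hcs : HasCompactSupport fun w : ℂ => f w • w := f.hasCompactSupport.smul_right
  obtain ⟨K, hK⟩ := hcd.lipschitzWith_of_hasCompactSupport hcs one_ne_zero
  refine ⟨K + 1, by positivity, fun P e ρ c he hρ => ?_⟩
  set g : ℂ → ℂ := fun z => ρ • (f (ρ⁻¹ • (z - P)) • (ρ⁻¹ • (z - P))) with hg
  have hgcd : ContDiff ℝ 1 g :=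
    (hcd.comp (g := fun w : ℂ => f w • w) (f := fun z => ρ⁻¹ • (z - P))
      (by fun_prop)).const_smul ρ
  have hglip : ∀ z w, ‖g z - g w‖ ≤ K * ‖z - w‖ := by
    intro z w
    have h1 := hK.dist_le_mul (ρ⁻¹ • (z - P)) (ρ⁻¹ • (w - P))
    rw [dist_eq_norm, dist_eq_norm, ← smul_sub, norm_smul, sub_sub_sub_cancel_right] at h1
    rw [hg]
    simp only
    rw [← smul_sub, norm_smul]
    rw [norm_inv, Real.norm_eq_abs, abs_of_pos hρ] at h1
    rw [Real.norm_eq_abs, abs_of_pos hρ]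
    calc _ ≤ ρ * (K * (ρ⁻¹ * ‖z - w‖)) := mul_le_mul_of_nonneg_left h1 hρ.le
      _ = K * ‖z - w‖ := by field_simp
  have hnorm : ∀ z, ‖ρ⁻¹ • (z - P)‖ = ‖z - P‖ / ρ := fun z => by
    rw [norm_smul, norm_inv, Real.norm_eq_abs, abs_of_pos hρ]; ring
  refine ⟨fun z => (c * inner ℝ (g z) e) • e, ?_, fun z w => ?_, fun z hz => ?_, fun z hz => ?_⟩
  · exact (contDiff_const.mul (hgcd.inner ℝ contDiff_const)).smul contDiff_const
  · rw [← sub_smul, norm_smul, he, mul_one, ← mul_sub, ← inner_sub_left, norm_mul,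
      Real.norm_eq_abs, mul_assoc]
    refine mul_le_mul_of_nonneg_left ?_ (abs_nonneg c)
    calc ‖inner ℝ (g z - g w) e‖ ≤ ‖g z - g w‖ * ‖e‖ := norm_inner_le_norm _ _
      _ ≤ K * ‖z - w‖ := by rw [he, mul_one]; exact hglip z w
      _ ≤ (K + 1) * ‖z - w‖ := by gcongr; linarith
  · have h1 : f (ρ⁻¹ • (z - P)) = 1 := f.one_of_mem_closedBall (by
      rw [Metric.mem_closedBall, dist_zero_right, hnorm, div_le_iff₀ hρ]
      change _ ≤ 1 * ρ
      linarith)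
    have h2 : g z = z - P := by
      change ρ • (f (ρ⁻¹ • (z - P)) • (ρ⁻¹ • (z - P))) = _
      rw [h1, one_smul, smul_smul, mul_inv_cancel₀ hρ.ne', one_smul]
    simp only [h2]
  · have h1 : f (ρ⁻¹ • (z - P)) = 0 := f.zero_of_le_dist (by
      rw [dist_zero_right, hnorm, le_div_iff₀ hρ]
      exact hz)
    have h2 : g z = 0 := by
      change ρ • (f (ρ⁻¹ • (z - P)) • (ρ⁻¹ • (z - P))) = _
      rw [h1, zero_smul, smul_zero]
    simp only [h2, inner_zero_left, mul_zero, zero_smul]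

theorem crossPairs_eq_of_iff {γ ξ : ℝ → ℂ} (h : ∀ x y, γ x = γ y ↔ ξ x = ξ y) :
    crossPairs γ = crossPairs ξ := by
  ext p; simp only [crossPairs, mem_ofPred_eq, h]

theorem selfIntParams_congr {γ ξ : ℝ → ℂ} (h : crossPairs γ = crossPairs ξ) :
    selfIntParams γ = selfIntParams ξ := by
  ext u; simp only [mem_selfIntParams_iff, h]

/-- One can stretch a curve near one of its double points, within its compartment and leaving the
other double points as they are. -/
theorem IsCompartment.exists_stretch_small (hC : IsCompartment jp jm s ω C) :
    ∃ L > 0, ∀ γ ∈ C, ∀ (P e : ℂ) (c : ℝ), ‖e‖ = 1 → |c| * L < 1 →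
      ∃ ξ ∈ C, crossPairs ξ = crossPairs γ ∧ ∀ x ∈ selfIntParams γ, ξ x = γ x ∧
        (γ x = P → deriv ξ x = stretch c e (deriv γ x)) ∧ (γ x ≠ P → deriv ξ x = deriv γ x) := by
  obtain ⟨L, hL, HL⟩ := exists_stretch_field
  refine ⟨L, hL, fun γ hγ P e c he hc => ?_⟩
  have hgen := hC.isGeneric hγ
  have hc1 := hgen.immersed.isC1Loop
  -- `g` bounds from below the distance of `P` to the other double points. The field vanishes beyond
  -- `g / 2` and leaves the curve near them unchanged.
  obtain ⟨g, hg, Hg⟩ := exists_pos_le_of_finite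
    (S := ((fun x => ‖γ x - P‖) '' selfIntParams γ) ∩ Ioi 0)
    ((hgen.finite_selfIntParams.image _).inter_of_left _) fun s hs => hs.2
  obtain ⟨V, hV, hlip, hV1, hV2⟩ := HL P e (g / 4) c he (by positivity)
  have hK0 : 0 ≤ |c| * L := by positivity
  have hmem := hC.add_comp hγ hV hK0 hc hlip
  refine ⟨_, hmem, (crossPairs_eq_of_iff fun x y => ?_).symm, fun x hx => ?_⟩
  · constructor
    · intro h; simp only [h]
    · intro h
      have h1 := one_sub_mul_norm_le hlip (t := 1) (by simp) (γ x) (γ y)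
      simp only [one_smul] at h1
      rw [h, sub_self, norm_zero] at h1
      have h3 : ‖γ x - γ y‖ = 0 := le_antisymm (by nlinarith [norm_nonneg (γ x - γ y)])
        (norm_nonneg _)
      exact sub_eq_zero.1 (norm_eq_zero.1 h3)
  · by_cases hP : γ x = P
    · have h1 : V (γ x) = 0 := by rw [hV1 _ (by rw [hP, sub_self, norm_zero]; positivity), hP]; simp
      refine ⟨by simp [h1], fun _ => ?_, fun h => absurd hP h⟩
      have h2 : (fun y => γ y + V (γ y)) =ᶠ[𝓝 x] fun y => γ y + (c * inner ℝ (γ y - P) e) • e := by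
        filter_upwards [hc1.contDiff.continuous.continuousAt.preimage_mem_nhds
          (Metric.closedBall_mem_nhds (γ x) (show 0 < g / 4 by positivity))] with y hy
        rw [hV1 (γ y)]
        rwa [mem_preimage, Metric.mem_closedBall, dist_eq_norm, hP] at hy
      have h3 := (hc1.differentiable x).hasDerivAt
      have h4 := (h3.sub_const P).inner ℝ (hasDerivAt_const x e)
      have h5 : HasDerivAt (fun y => γ y + (c * inner ℝ (γ y - P) e) • e) _ x :=
        h3.add ((h4.const_mul c).smul_const e)
      rw [h2.deriv_eq, h5.deriv, stretch]
      simp only [inner_zero_right, zero_add]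
    · have hgx : g ≤ ‖γ x - P‖ := Hg _ ⟨⟨x, hx, rfl⟩, norm_pos_iff.2 (sub_ne_zero.2 hP)⟩
      have h1 : V (γ x) = 0 := hV2 _ (by linarith)
      refine ⟨by simp [h1], fun h => absurd h hP, fun _ => ?_⟩
      have h2 : (fun y => γ y + V (γ y)) =ᶠ[𝓝 x] γ := by
        filter_upwards [hc1.contDiff.continuous.continuousAt.preimage_mem_nhds
          (Metric.ball_mem_nhds (γ x) (show 0 < g / 2 by positivity))] with y hy
        rw [hV2 (γ y), add_zero]
        rw [mem_preimage, Metric.mem_ball, dist_eq_norm, norm_sub_rev] at hy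
        have := norm_add_le (γ x - γ y) (γ y - P)
        rw [sub_add_sub_cancel] at this
        linarith
      rw [h2.deriv_eq]

/-- One deformation close to the identity allows only a small stretch, but stretches in a fixed
direction compose by multiplying their factors. -/
theorem IsCompartment.exists_stretch_pow {L : ℝ} (n : ℕ)
    (H : ∀ γ ∈ C, ∀ (P e : ℂ) (c : ℝ), ‖e‖ = 1 → |c| * L < 1 →
      ∃ ξ ∈ C, crossPairs ξ = crossPairs γ ∧ ∀ x ∈ selfIntParams γ, ξ x = γ x ∧
        (γ x = P → deriv ξ x = stretch c e (deriv γ x)) ∧ (γ x ≠ P → deriv ξ x = deriv γ x))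
    {γ : ℝ → ℂ} (hγ : γ ∈ C) (P e : ℂ) (c : ℝ) (he : ‖e‖ = 1) (hc : |c| * L < 1) :
    ∃ ξ ∈ C, crossPairs ξ = crossPairs γ ∧ ∀ x ∈ selfIntParams γ, ξ x = γ x ∧
      (γ x = P → deriv ξ x = stretch ((1 + c) ^ n - 1) e (deriv γ x)) ∧
      (γ x ≠ P → deriv ξ x = deriv γ x) := by
  induction n with
  | zero => exact ⟨γ, hγ, rfl, fun x _ => ⟨rfl, by simp [stretch], fun _ => rfl⟩⟩
  | succ n ih =>
    obtain ⟨ξ, hξ, h1, h2⟩ := ih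
    obtain ⟨ζ, hζ, h3, h4⟩ := H ξ hξ P e c he hc
    refine ⟨ζ, hζ, h3.trans h1, fun x hx => ?_⟩
    obtain ⟨a1, a2, a3⟩ := h2 x hx
    obtain ⟨b1, b2, b3⟩ := h4 x (by rwa [selfIntParams_congr h1])
    rw [a1] at b1 b2 b3
    refine ⟨b1, fun h => ?_, fun h => by rw [b3 h, a3 h]⟩
    rw [b2 h, a2 h, stretch_stretch he]
    congr 1; ring

/-- An arbitrary factor `l` is reached by `n` stretches of factor `l ^ (1/n)`, which tends to 1 and
is eventually within the admissible range. -/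
theorem IsCompartment.exists_stretch (hC : IsCompartment jp jm s ω C) {γ : ℝ → ℂ} (hγ : γ ∈ C)
    (P e : ℂ) (he : ‖e‖ = 1) {l : ℝ} (hl : 0 < l) :
    ∃ ξ ∈ C, crossPairs ξ = crossPairs γ ∧ ∀ x ∈ selfIntParams γ, ξ x = γ x ∧
      (γ x = P → deriv ξ x = stretch (l - 1) e (deriv γ x)) ∧
      (γ x ≠ P → deriv ξ x = deriv γ x) := by
  obtain ⟨L, hL, H⟩ := hC.exists_stretch_small
  have hlim : Tendsto (fun n : ℕ => |l ^ ((n : ℝ)⁻¹) - 1| * L) atTop (𝓝 0) := by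
    have h1 : Tendsto (fun n : ℕ => l ^ ((n : ℝ)⁻¹)) atTop (𝓝 (l ^ (0 : ℝ))) :=
      tendsto_const_nhds.rpow tendsto_inv_atTop_nhds_zero_nat (Or.inl hl.ne')
    have h2 := ((h1.sub_const 1).abs).mul_const L
    simpa using h2
  obtain ⟨n, hn, hn0⟩ := ((hlim.eventually_lt_const one_pos).and (eventually_gt_atTop 0)).exists
  have := exists_stretch_pow (C := C) n H hγ P e _ he hn
  rw [add_sub_cancel, Real.rpow_inv_natCast_pow hl.le hn0.ne'] at this
  exact this

theorem IsGeneric.eq_or_eq_of_same_point {γ : ℝ → ℂ} (h : IsGeneric γ) {p : ℝ × ℝ}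
    (hp : p ∈ crossPairs γ) {x : ℝ} (hx : x ∈ Ico (0 : ℝ) 1) (he : γ x = γ p.1) :
    x = p.1 ∨ x = p.2 := by
  by_contra hne
  rw [not_or] at hne
  have h1 : Cross γ x p.1 := cross_of_mem_crossPairs (p := (x, p.1)) ⟨hx, hp.1, hne.1, he⟩
  have h2 : Cross γ x p.2 :=
    cross_of_mem_crossPairs (p := (x, p.2)) ⟨hx, hp.2.1, hne.2, he.trans hp.2.2.2⟩
  exact h.not_triple h1 (cross_of_mem_crossPairs hp) h2

/-- Every compartment contains a curve with orthogonal self-intersections. -/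
theorem IsCompartment.exists_orthogonal (hC : IsCompartment jp jm s ω C) :
    ∃ γ ∈ C, ∀ p ∈ crossPairs γ, inner ℝ (deriv γ p.1) (deriv γ p.2) = 0 := by
  -- Induction on the number of non-orthogonal crossing pairs: correcting one crossing leaves the
  -- tangents at all others unchanged.
  have key : ∀ n : ℕ, ∀ γ ∈ C,
      {p ∈ crossPairs γ | inner ℝ (deriv γ p.1) (deriv γ p.2) ≠ 0}.ncard = n →
      ∃ γ ∈ C, ∀ p ∈ crossPairs γ, inner ℝ (deriv γ p.1) (deriv γ p.2) = 0 := by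
    intro n
    induction n using Nat.strong_induction_on with
    | _ n ih =>
      intro γ hγ hn
      by_cases hall : ∀ p ∈ crossPairs γ, inner ℝ (deriv γ p.1) (deriv γ p.2) = 0
      · exact ⟨γ, hγ, hall⟩
      push Not at hall
      obtain ⟨p, hp, hp0⟩ := hall
      have hgen := hC.isGeneric hγ
      obtain ⟨e, he, l, hl, hort⟩ := exists_stretch_orthogonal
        (transverseAt_iff.1 (hgen.transverse_of_cross (cross_of_mem_crossPairs hp)))
      obtain ⟨ξ, hξ, hcr, H⟩ := hC.exists_stretch hγ (γ p.1) e he hl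
      have hpar1 : ∀ q ∈ crossPairs γ, q.1 ∈ selfIntParams γ :=
        fun q hq => mem_selfIntParams_iff.2 ⟨q.2, hq⟩
      have hpar2 : ∀ q ∈ crossPairs γ, q.2 ∈ selfIntParams γ :=
        fun q hq => mem_selfIntParams_iff.2 ⟨q.1, hq.2.1, hq.1, hq.2.2.1.symm, hq.2.2.2.symm⟩
      have d1 := (H _ (hpar1 p hp)).2.1 rfl
      have d2 := (H _ (hpar2 p hp)).2.1 hp.2.2.2.symm
      have hnew : ∀ q ∈ crossPairs γ, γ q.1 = γ p.1 →
          inner ℝ (deriv ξ q.1) (deriv ξ q.2) = 0 := by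
        intro q hq hqp
        have hq1 := hgen.eq_or_eq_of_same_point hp hq.1 hqp
        have hq2 := hgen.eq_or_eq_of_same_point hp hq.2.1 (hq.2.2.2.symm.trans hqp)
        rcases hq1 with h1 | h1 <;> rcases hq2 with h2 | h2
        · exact absurd (h1.trans h2.symm) hq.2.2.1
        · rw [h1, h2, d1, d2]; exact hort
        · rw [h1, h2, d1, d2, real_inner_comm]; exact hort
        · exact absurd (h1.trans h2.symm) hq.2.2.1
      refine ih _ ?_ ξ hξ rfl
      rw [← hn]
      refine ncard_lt_ncard ?_ (hgen.finite_crossPairs.sep _)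
      refine (ssubset_iff_of_subset ?_).2 ⟨p, ⟨hp, hp0⟩, fun hpn => hpn.2 (hnew p hp rfl)⟩
      rintro q ⟨hq, hq0⟩
      rw [hcr] at hq
      have hne : γ q.1 ≠ γ p.1 := fun h => hq0 (hnew q hq h)
      refine ⟨hq, ?_⟩
      rw [(H _ (hpar1 q hq)).2.2 hne,
        (H _ (hpar2 q hq)).2.2 (by rw [← hq.2.2.2]; exact hne)] at hq0
      exact hq0
  obtain ⟨γ, hγ⟩ := hC.nonempty
  exact key _ γ hγ rfl


/-! ### Smoothing and straightening -/

/-- Steklov means: `C²`-loops are `C¹`-dense. -/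
theorem IsC1Loop.exists_smooth_close {γ : ℝ → ℂ} (h : IsC1Loop γ) {ε : ℝ} (hε : 0 < ε) :
    ∃ ζ : ℝ → ℂ, Function.Periodic ζ 1 ∧ ContDiff ℝ 2 ζ ∧ C1Close ε γ ζ := by
  have hc := h.contDiff.continuous
  have hc' := h.contDiff.continuous_deriv le_rfl
  obtain ⟨r₁, hr₁, H₁⟩ := exists_uniform_of_periodic hc h.periodic hε
  obtain ⟨r₂, hr₂, H₂⟩ := exists_uniform_of_periodic hc' (periodic_deriv h.periodic) hε
  set η := min r₁ r₂ with hη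
  have hη0 : 0 < η := by positivity
  -- The primitive need not be periodic, but its increment over a step `η` is. The mean over [x, x +
  -- η] gains one derivative.
  set F : ℝ → ℂ := fun x => ∫ t in (0 : ℝ)..x, γ t with hF
  have hFd : ∀ x, HasDerivAt F (γ x) x := fun x =>
    intervalIntegral.integral_hasDerivAt_right (hc.intervalIntegrable _ _)
      hc.aestronglyMeasurable.stronglyMeasurableAtFilter hc.continuousAt
  have hFdiff : Differentiable ℝ F := fun x => (hFd x).differentiableAt
  have hFderiv : deriv F = γ := funext fun x => (hFd x).deriv
  have hF2 : ContDiff ℝ 2 F := by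
    rw [show (2 : WithTop ℕ∞) = 1 + 1 by norm_num, contDiff_succ_iff_deriv]
    exact ⟨hFdiff, by simp, by rw [hFderiv]; exact h.contDiff⟩
  have hFper : ∀ x, F (x + 1 + η) - F (x + 1) = F (x + η) - F x := by
    intro x
    have e : ∀ a b : ℝ, F b - F a = ∫ t in a..b, γ t := fun a b => by
      rw [hF]
      simp only
      rw [intervalIntegral.integral_interval_sub_left (hc.intervalIntegrable _ _)
        (hc.intervalIntegrable _ _)]
    rw [e, e, show x + 1 + η = x + η + 1 by ring, ← intervalIntegral.integral_comp_add_right]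
    simp only [h.periodic _]
  have hd : ∀ x, HasDerivAt (fun x => η⁻¹ • (F (x + η) - F x)) (η⁻¹ • (γ (x + η) - γ x)) x :=
    fun x => (((hFd (x + η)).comp_add_const x η).sub (hFd x)).const_smul η⁻¹
  have happ : ∀ (f : ℝ → ℂ), Differentiable ℝ f →
      (∀ x y, |x - y| ≤ η → ‖deriv f x - deriv f y‖ ≤ ε) → ∀ x,
      ‖η⁻¹ • (f (x + η) - f x) - deriv f x‖ ≤ ε := by
    intro f hf hosc x
    have h1 := norm_sub_sub_le hf (x := x) (y := x + η) (v := deriv f x) (c := ε) fun t ht => by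
      rw [uIcc_of_le (by linarith)] at ht
      exact hosc t x (by rw [abs_le]; constructor <;> linarith [ht.1, ht.2])
    have e : η⁻¹ • (f (x + η) - f x) - deriv f x =
        η⁻¹ • (f (x + η) - f x - (x + η - x) • deriv f x) := by
      rw [smul_sub η⁻¹ (f (x + η) - f x), smul_smul, add_sub_cancel_left, inv_mul_cancel₀ hη0.ne',
        one_smul]
    rw [e, norm_smul, norm_inv, Real.norm_eq_abs, abs_of_pos hη0, inv_mul_le_iff₀ hη0]
    refine h1.trans (le_of_eq ?_)
    rw [add_sub_cancel_left, abs_of_pos hη0, mul_comm]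
  refine ⟨fun x => η⁻¹ • (F (x + η) - F x), fun x => by simp only [hFper x], ?_, fun x => ⟨?_, ?_⟩⟩
  · exact ((hF2.comp (contDiff_id.add contDiff_const)).sub hF2).const_smul _
  · have := happ F hFdiff (fun x y hxy => by
      rw [hFderiv]; exact H₁ x y (hxy.trans (min_le_left _ _))) x
    rwa [hFderiv] at this
  · rw [(hd x).deriv]
    exact happ γ h.differentiable (fun x y hxy => H₂ x y (hxy.trans (min_le_right _ _))) x

/-- A periodic curve tracing a straight segment in the tangent line of `γ` at `u`. -/
noncomputable def segmentArc (γ : ℝ → ℂ) (u x : ℝ) : ℂ :=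
  γ u + (Real.sin (2 * Real.pi * (x - u)) / (2 * Real.pi)) • deriv γ u

theorem hasDerivAt_segmentArc (γ : ℝ → ℂ) (u x : ℝ) :
    HasDerivAt (segmentArc γ u) (Real.cos (2 * Real.pi * (x - u)) • deriv γ u) x := by
  have h1 : HasDerivAt (fun x : ℝ => 2 * Real.pi * (x - u)) (2 * Real.pi) x := by
    simpa using ((hasDerivAt_id x).sub_const u).const_mul (2 * Real.pi)
  have h2 := (h1.sin.div_const (2 * Real.pi)).smul_const (deriv γ u)
  rw [mul_div_cancel_right₀ _ Real.two_pi_pos.ne'] at h2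
  exact h2.const_add _

theorem contDiff_segmentArc (γ : ℝ → ℂ) (u : ℝ) : ContDiff ℝ 2 (segmentArc γ u) := by
  unfold segmentArc
  exact contDiff_const.add (((Real.contDiff_sin.comp (by fun_prop)).div_const _).smul contDiff_const)

theorem periodic_segmentArc (γ : ℝ → ℂ) (u : ℝ) : Function.Periodic (segmentArc γ u) 1 := by
  intro x
  unfold segmentArc
  rw [show 2 * Real.pi * (x + 1 - u) = 2 * Real.pi * (x - u) + 2 * Real.pi by ring,
    Real.sin_add_two_pi]

theorem segmentArc_self (γ : ℝ → ℂ) (u : ℝ) : segmentArc γ u u = γ u := by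
  simp [segmentArc]

/-- The standard bump function of the line. -/
noncomputable def lineBump : ContDiffBump (0 : ℝ) := ⟨1, 2, one_pos, one_lt_two⟩

/-- A smooth `1`-periodic cut-off function that is concentrated near `u`. -/
noncomputable def circleBump (ρ u x : ℝ) : ℝ := lineBump (ρ⁻¹ * Real.sin (Real.pi * (x - u)))

theorem contDiff_circleBump (ρ u : ℝ) : ContDiff ℝ 2 (circleBump ρ u) := by
  unfold circleBump
  exact lineBump.contDiff.comp (contDiff_const.mul (Real.contDiff_sin.comp (by fun_prop)))

theorem periodic_circleBump (ρ u : ℝ) : Function.Periodic (circleBump ρ u) 1 := by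
  intro x
  unfold circleBump
  -- The sine changes sign under a unit shift; the bump function is even.
  rw [show Real.pi * (x + 1 - u) = Real.pi * (x - u) + Real.pi by ring, Real.sin_add_pi,
    mul_neg, lineBump.neg]

theorem exists_deriv_circleBump_le :
    ∃ K > 0, ∀ ρ > 0, ∀ u x, ‖deriv (circleBump ρ u) x‖ ≤ K / ρ := by
  obtain ⟨K, hK⟩ := (lineBump.contDiff (n := 1)).lipschitzWith_of_hasCompactSupport
    lineBump.hasCompactSupport one_ne_zero
  refine ⟨Real.pi * (K + 1), by positivity, fun ρ hρ u x => ?_⟩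
  have h1 : HasDerivAt (fun x : ℝ => Real.pi * (x - u)) Real.pi x := by
    simpa using ((hasDerivAt_id x).sub_const u).const_mul Real.pi
  have h2 := h1.sin.const_mul ρ⁻¹
  have h3 := ((lineBump.contDiff (n := 1)).differentiable one_ne_zero
    (ρ⁻¹ * Real.sin (Real.pi * (x - u)))).hasDerivAt.comp x h2
  have h4 : deriv (circleBump ρ u) x = _ := h3.deriv
  rw [h4, norm_mul, norm_mul, norm_mul]
  have h5 : ‖deriv lineBump (ρ⁻¹ * Real.sin (Real.pi * (x - u)))‖ ≤ K :=
    norm_deriv_le_of_lipschitz hK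
  have h6 : ‖Real.cos (Real.pi * (x - u))‖ ≤ 1 := Real.abs_cos_le_one _
  have h7 : ‖Real.pi‖ = Real.pi := by rw [Real.norm_eq_abs, abs_of_pos Real.pi_pos]
  rw [h7, norm_inv, Real.norm_eq_abs ρ, abs_of_pos hρ]
  calc _ ≤ (K + 1 : ℝ) * (ρ⁻¹ * (1 * Real.pi)) := by gcongr; linarith
    _ = _ := by field_simp

theorem two_mul_abs_le_abs_sin {y : ℝ} (h : |y| ≤ 1 / 2) : 2 * |y| ≤ |Real.sin (Real.pi * y)| := by
  wlog hy : 0 ≤ y generalizing y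
  · have := this (y := -y) (by rwa [abs_neg]) (by linarith)
    rwa [abs_neg, mul_neg, Real.sin_neg, abs_neg] at this
  rw [abs_of_nonneg hy] at h ⊢
  have h1 := Real.mul_le_sin (x := Real.pi * y) (by positivity) (by nlinarith [Real.pi_pos])
  have h2 : 2 / Real.pi * (Real.pi * y) = 2 * y := by field_simp
  rw [h2] at h1
  exact h1.trans (le_abs_self _)

theorem exists_int_near_of_sin {x u ρ : ℝ} (h : |Real.sin (Real.pi * (x - u))| ≤ 2 * ρ) :
    ∃ k : ℤ, |x - k - u| ≤ ρ := by
  refine ⟨round (x - u), ?_⟩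
  have h1 := abs_sub_round (x - u)
  have h2 := two_mul_abs_le_abs_sin h1
  have h3 : |Real.sin (Real.pi * (x - u - round (x - u)))| = |Real.sin (Real.pi * (x - u))| := by
    rw [mul_sub, mul_comm Real.pi (round (x - u) : ℝ), Real.sin_sub_int_mul_pi, abs_mul,
      abs_zpow]
    simp
  rw [h3] at h2
  rw [show x - (round (x - u) : ℝ) - u = x - u - round (x - u) by ring]
  linarith

theorem circleBump_eq_one {ρ u x : ℝ} (hρ : 0 < ρ) (h : |Real.sin (Real.pi * (x - u))| ≤ ρ) :
    circleBump ρ u x = 1 := by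
  refine lineBump.one_of_mem_closedBall ?_
  rw [mem_closedBall_zero_iff, norm_mul, norm_inv, Real.norm_eq_abs, Real.norm_eq_abs,
    abs_of_pos hρ, inv_mul_le_iff₀ hρ]
  change _ ≤ ρ * 1
  linarith

theorem circleBump_eq_zero {ρ u x : ℝ} (hρ : 0 < ρ)
    (h : 2 * ρ ≤ |Real.sin (Real.pi * (x - u))|) : circleBump ρ u x = 0 := by
  refine lineBump.zero_of_le_dist ?_
  rw [dist_zero_right, norm_mul, norm_inv, Real.norm_eq_abs, Real.norm_eq_abs, abs_of_pos hρ,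
    le_inv_mul_iff₀ hρ]
  change ρ * 2 ≤ _
  linarith

theorem circleBump_nonneg (ρ u x : ℝ) : 0 ≤ circleBump ρ u x := lineBump.nonneg

theorem circleBump_le_one (ρ u x : ℝ) : circleBump ρ u x ≤ 1 := lineBump.le_one

/-- The correction that makes a curve straight near `u`. -/
noncomputable def straightening (γ ζ : ℝ → ℂ) (ρ u x : ℝ) : ℂ :=
  circleBump ρ u x • (segmentArc γ u x - ζ x)

theorem periodic_straightening {γ ζ : ℝ → ℂ} (hζ : Function.Periodic ζ 1) (ρ u : ℝ) :
    Function.Periodic (straightening γ ζ ρ u) 1 := by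
  intro x
  simp only [straightening, periodic_circleBump ρ u x, periodic_segmentArc γ u x, hζ x]

theorem hasDerivAt_straightening {γ ζ : ℝ → ℂ} (hζ : IsC1Loop ζ) (ρ u x : ℝ) :
    HasDerivAt (straightening γ ζ ρ u)
      (circleBump ρ u x • (deriv (segmentArc γ u) x - deriv ζ x) +
        deriv (circleBump ρ u) x • (segmentArc γ u x - ζ x)) x := by
  have h1 := ((contDiff_circleBump ρ u).differentiable two_ne_zero x).hasDerivAt
  have h2 := ((contDiff_segmentArc γ u).differentiable two_ne_zero x).hasDerivAt
  exact h1.smul (h2.sub (hζ.differentiable x).hasDerivAt)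

/-- The cut-off has slope of order 1/ρ, but within distance ρ of `u` the straight arc, tangent to
`γ` there, differs from `γ` only by a small multiple of ρ, and the powers of ρ cancel. For the same
reason `ζ` must be close to `γ` at scale ρ, so `ε'` may depend on `ρ`. -/
theorem IsC1Loop.exists_straightening_small {γ : ℝ → ℂ} (h : IsC1Loop γ) {ε : ℝ} (hε : 0 < ε) :
    ∃ ρ₀ > 0, ∀ ρ, 0 < ρ → ρ ≤ ρ₀ → ∃ ε' > 0, ∀ ζ, IsC1Loop ζ → C1Close ε' γ ζ → ∀ u x,
      ‖straightening γ ζ ρ u x‖ ≤ ε ∧ ‖deriv (straightening γ ζ ρ u) x‖ ≤ ε := by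
  obtain ⟨K, hK, HK⟩ := exists_deriv_circleBump_le
  have hc' := h.contDiff.continuous_deriv le_rfl
  obtain ⟨B, hB, HB⟩ := exists_bound_of_periodic hc' (periodic_deriv h.periodic)
  -- The product rule yields the total 2w + (K/ρ)·2wρ = (2K + 2)w.
  set w := ε / (2 * K + 2) with hw
  have hw0 : 0 < w := by positivity
  obtain ⟨r₁, hr₁, H₁⟩ := exists_uniform_of_periodic hc' (periodic_deriv h.periodic)
    (half_pos hw0)
  have hcos : Continuous fun t : ℝ => Real.cos (2 * Real.pi * t) := by fun_prop
  obtain ⟨r₂, hr₂, H₂⟩ := Metric.continuous_iff.1 hcos 0 (w / (2 * B)) (by positivity)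
  refine ⟨min (min r₁ (r₂ / 2)) 1, by positivity, fun ρ hρ hρ' => ?_⟩
  have hρ1 : ρ ≤ r₁ := hρ'.trans ((min_le_left _ _).trans (min_le_left _ _))
  have hρ2 : ρ ≤ r₂ / 2 := hρ'.trans ((min_le_left _ _).trans (min_le_right _ _))
  have hρ3 : ρ ≤ 1 := hρ'.trans (min_le_right _ _)
  refine ⟨min (w * ρ) w, by positivity, fun ζ hζ hcl u x => ?_⟩
  have hdarc : ∀ t, |t - u| ≤ ρ → ‖deriv (segmentArc γ u) t - deriv γ t‖ ≤ w := by
    intro t ht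
    rw [(hasDerivAt_segmentArc γ u t).deriv]
    have h1 := H₁ u t (by rw [abs_sub_comm]; exact ht.trans hρ1)
    have h2 := H₂ (t - u) (by rw [Real.dist_eq, sub_zero]; linarith)
    rw [Real.dist_eq, mul_zero, Real.cos_zero] at h2
    have h3 : ‖(Real.cos (2 * Real.pi * (t - u)) - 1) • deriv γ u‖ ≤ w / 2 := by
      rw [norm_smul, Real.norm_eq_abs]
      calc _ ≤ w / (2 * B) * B := mul_le_mul h2.le (HB u) (norm_nonneg _) (by positivity)
        _ = w / 2 := by field_simp
    calc ‖Real.cos (2 * Real.pi * (t - u)) • deriv γ u - deriv γ t‖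
        = ‖(Real.cos (2 * Real.pi * (t - u)) - 1) • deriv γ u + (deriv γ u - deriv γ t)‖ := by
          rw [sub_smul, one_smul]; congr 1; abel
      _ ≤ w / 2 + w / 2 := (norm_add_le _ _).trans (add_le_add h3 h1)
      _ = w := by ring
  by_cases hx : |Real.sin (Real.pi * (x - u))| ≤ 2 * ρ
  · obtain ⟨k, hk⟩ := exists_int_near_of_sin hx
    have e1 := periodic_add_int (periodic_straightening (γ := γ) hζ.periodic ρ u) x (-k)
    have e2 := periodic_add_int (periodic_deriv
      (periodic_straightening (γ := γ) hζ.periodic ρ u)) x (-k)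
    rw [← e1, ← e2]
    set y := x + ((-k : ℤ) : ℝ) with hy
    have hyu : |y - u| ≤ ρ := by
      rw [hy]; push_cast; rw [← sub_eq_add_neg]; exact hk
    have h1 : ‖segmentArc γ u y - γ y‖ ≤ w * ρ := by
      have := norm_sub_sub_le (γ := fun t => segmentArc γ u t - γ t) (x := u) (y := y) (v := 0)
        (c := w) (((contDiff_segmentArc γ u).differentiable two_ne_zero).sub h.differentiable)
        (fun t ht => by
          rw [sub_zero]
          have e : deriv (fun t => segmentArc γ u t - γ t) t =
              deriv (segmentArc γ u) t - deriv γ t :=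
            ((hasDerivAt_segmentArc γ u t).differentiableAt.hasDerivAt.sub
              (h.differentiable t).hasDerivAt).deriv
          rw [e]
          refine hdarc t ?_
          have := abs_sub_left_of_mem_uIcc ht
          linarith)
      rw [segmentArc_self, sub_self, sub_zero, smul_zero, sub_zero] at this
      exact this.trans (mul_le_mul_of_nonneg_left hyu hw0.le)
    have h2 := (hcl y).1.trans (min_le_left _ _)
    have h3 := (hcl y).2.trans (min_le_right _ _)
    have h4 : ‖segmentArc γ u y - ζ y‖ ≤ 2 * w * ρ := by
      calc ‖segmentArc γ u y - ζ y‖ = ‖(segmentArc γ u y - γ y) - (ζ y - γ y)‖ := by congr 1; abel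
        _ ≤ w * ρ + w * ρ := (norm_sub_le _ _).trans (add_le_add h1 h2)
        _ = _ := by ring
    have h5 : ‖deriv (segmentArc γ u) y - deriv ζ y‖ ≤ 2 * w := by
      calc ‖deriv (segmentArc γ u) y - deriv ζ y‖
          = ‖(deriv (segmentArc γ u) y - deriv γ y) - (deriv ζ y - deriv γ y)‖ := by
            congr 1; abel
        _ ≤ w + w := (norm_sub_le _ _).trans (add_le_add (hdarc y hyu) h3)
        _ = _ := by ring
    have h6 : ‖circleBump ρ u y‖ ≤ 1 := by
      rw [Real.norm_eq_abs, abs_of_nonneg (circleBump_nonneg _ _ _)]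
      exact circleBump_le_one _ _ _
    have hεw : (2 * K + 2) * w = ε := by rw [hw]; field_simp
    constructor
    · rw [straightening, norm_smul]
      calc _ ≤ 1 * (2 * w * ρ) := mul_le_mul h6 h4 (norm_nonneg _) zero_le_one
        _ ≤ ε := by nlinarith [mul_pos hK hw0]
    · rw [(hasDerivAt_straightening hζ ρ u y).deriv]
      calc _ ≤ ‖circleBump ρ u y‖ * ‖deriv (segmentArc γ u) y - deriv ζ y‖ +
            ‖deriv (circleBump ρ u) y‖ * ‖segmentArc γ u y - ζ y‖ := by
            refine (norm_add_le _ _).trans ?_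
            rw [norm_smul, norm_smul]
        _ ≤ 1 * (2 * w) + K / ρ * (2 * w * ρ) := by
            gcongr
            exact HK ρ hρ u y
        _ = ε := by rw [← hεw]; field_simp; ring
  · push Not at hx
    have hz : straightening γ ζ ρ u =ᶠ[𝓝 x] fun _ => 0 := by
      have hcs : ContinuousAt (fun x : ℝ => |Real.sin (Real.pi * (x - u))|) x := by fun_prop
      filter_upwards [hcs.eventually (lt_mem_nhds hx)] with y hy
      rw [straightening, circleBump_eq_zero hρ hy.le, zero_smul]
    rw [hz.deriv_eq, hz.eq_of_nhds]
    simp [hε.le]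

variable {jp jm s ω : ℤ} {C : Set (ℝ → ℂ)}

/-- Every compartment contains a curve of class `C²` with orthogonal self-intersections that is
straight near its self-intersections. -/
theorem IsCompartment.exists_straight (hC : IsCompartment jp jm s ω C) :
    ∃ β ξ : ℝ → ℂ, IsImmersedLoop β ∧ ξ ∈ C ∧ ContDiff ℝ 2 ξ ∧
      (∀ u ∈ selfIntParams ξ, ξ =ᶠ[𝓝 u] segmentArc β u) ∧
      ∀ p ∈ crossPairs ξ, inner ℝ (deriv ξ p.1) (deriv ξ p.2) = 0 := by
  obtain ⟨γ, hγ, hort⟩ := hC.exists_orthogonal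
  have hgen := hC.isGeneric hγ
  have hc1 := hgen.immersed.isC1Loop
  obtain ⟨ε, hε, Hε⟩ := hC.exists_mem_of_close hgen
  have hT := hgen.finite_selfIntParams
  set T := hT.toFinset with hTdef
  have hTmem : ∀ u, u ∈ T ↔ u ∈ selfIntParams γ := fun u => hT.mem_toFinset
  -- One share of `ε` for the smoothing and one for each straightened parameter.
  set n : ℝ := T.card + 1 with hn
  have hn0 : 0 < n := by positivity
  obtain ⟨ρ₀, hρ₀, H⟩ := hc1.exists_straightening_small (ε := ε / n) (by positivity)
  obtain ⟨g, hg, Hg⟩ := exists_gap hT selfIntParams_subset_Ico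
  set ρ := min ρ₀ (g / 4) with hρdef
  have hρ : 0 < ρ := by positivity
  obtain ⟨ε', hε', H⟩ := H ρ hρ (min_le_left _ _)
  obtain ⟨ζ, hζp, hζ2, hζc⟩ := hc1.exists_smooth_close (ε := min ε' (ε / n)) (by positivity)
  have hζ : IsC1Loop ζ := ⟨hζp, hζ2.of_le (by norm_num)⟩
  have H := H ζ hζ (hζc.mono (min_le_left _ _))
  set ξ : ℝ → ℂ := fun x => ζ x + ∑ u ∈ T, straightening γ ζ ρ u x with hξdef
  have hst2 : ∀ u, ContDiff ℝ 2 (straightening γ ζ ρ u) := fun u =>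
    (contDiff_circleBump ρ u).smul ((contDiff_segmentArc γ u).sub hζ2)
  have hξ2 : ContDiff ℝ 2 ξ := hζ2.add (ContDiff.sum fun u _ => hst2 u)
  have hξ1 : IsC1Loop ξ := by
    refine ⟨fun x => ?_, hξ2.of_le (by norm_num)⟩
    simp only [hξdef, hζp x, fun u => periodic_straightening (γ := γ) hζp ρ u x]
  have hξd : ∀ x, deriv ξ x = deriv ζ x + ∑ u ∈ T, deriv (straightening γ ζ ρ u) x := fun x => by
    have h1 : HasDerivAt (fun x => ∑ u ∈ T, straightening γ ζ ρ u x)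
        (∑ u ∈ T, deriv (straightening γ ζ ρ u) x) x := by
      refine HasDerivAt.fun_sum fun u _ => ?_
      exact ((hst2 u).differentiable two_ne_zero x).hasDerivAt
    exact ((hζ.differentiable x).hasDerivAt.add h1).deriv
  have hsum : ∀ (f : ℝ → ℂ), (∀ u, ‖f u‖ ≤ ε / n) → ‖∑ u ∈ T, f u‖ ≤ T.card * (ε / n) := by
    intro f hf
    refine (norm_sum_le _ _).trans ((Finset.sum_le_sum fun u _ => hf u).trans ?_)
    rw [Finset.sum_const, nsmul_eq_mul]
  have hnε : ε / n + T.card * (ε / n) = ε := by rw [hn]; field_simp; ring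
  have hcl : C1Close ε γ ξ := by
    intro x
    constructor
    · calc ‖ξ x - γ x‖ = ‖(ζ x - γ x) + ∑ u ∈ T, straightening γ ζ ρ u x‖ := by
            congr 1; simp only [hξdef]; abel
        _ ≤ ε / n + T.card * (ε / n) := (norm_add_le _ _).trans (add_le_add
            ((hζc x).1.trans (min_le_right _ _)) (hsum _ fun u => (H u x).1))
        _ = ε := hnε
    · calc ‖deriv ξ x - deriv γ x‖
          = ‖(deriv ζ x - deriv γ x) + ∑ u ∈ T, deriv (straightening γ ζ ρ u) x‖ := by
            rw [hξd]; congr 1; abel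
        _ ≤ ε / n + T.card * (ε / n) := (norm_add_le _ _).trans (add_le_add
            ((hζc x).2.trans (min_le_right _ _)) (hsum _ fun u => (H u x).2))
        _ = ε := hnε
  have hξC : ξ ∈ C := Hε γ ξ hγ (C1Close.refl hε.le γ) hξ1 hcl
  have hloc : ∀ u ∈ selfIntParams γ, ξ =ᶠ[𝓝 u] segmentArc γ u := by
    intro u hu
    have e1 : ∀ᶠ x in 𝓝 u, ∀ v ∈ T, v ≠ u → straightening γ ζ ρ v x = 0 := by
      refine (Finset.eventually_all T).2 fun v hv => ?_
      by_cases hvu : v = u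
      · exact Eventually.of_forall fun _ h => absurd hvu h
      have h1 : 2 * ρ < |Real.sin (Real.pi * (u - v))| := by
        by_contra hle
        rw [not_lt] at hle
        obtain ⟨k, hk⟩ := exists_int_near_of_sin hle
        have h2 : u ≠ v + k := fun he =>
          hvu (eq_of_Ico_of_eq_add_int (selfIntParams_subset_Ico hu)
            (selfIntParams_subset_Ico ((hTmem v).1 hv)) he).symm
        have h3 := Hg u hu v ((hTmem v).1 hv) k h2
        rw [show u - (v + k) = u - k - v by ring] at h3
        have h4 : ρ ≤ g / 4 := min_le_right _ _
        linarith
      have hcs : ContinuousAt (fun x : ℝ => |Real.sin (Real.pi * (x - v))|) u := by fun_prop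
      filter_upwards [hcs.eventually (lt_mem_nhds h1)] with y hy _
      rw [straightening, circleBump_eq_zero hρ hy.le, zero_smul]
    have e2 : ∀ᶠ x in 𝓝 u, circleBump ρ u x = 1 := by
      have hcs : ContinuousAt (fun x : ℝ => |Real.sin (Real.pi * (x - u))|) u := by fun_prop
      have h0 : |Real.sin (Real.pi * (u - u))| < ρ := by simpa using hρ
      filter_upwards [hcs.eventually (gt_mem_nhds h0)] with y hy
      exact circleBump_eq_one hρ hy.le
    filter_upwards [e1, e2] with x h1 h2
    simp only [hξdef]
    rw [Finset.sum_eq_single_of_mem u ((hTmem u).2 hu) (fun v hv hvu => h1 v hv hvu),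
      straightening, h2, one_smul]
    abel
  have hval : ∀ u ∈ selfIntParams γ, ξ u = γ u ∧ deriv ξ u = deriv γ u := by
    intro u hu
    refine ⟨by rw [(hloc u hu).eq_of_nhds, segmentArc_self], ?_⟩
    rw [(hloc u hu).deriv_eq, (hasDerivAt_segmentArc γ u u).deriv]
    simp
  have hp1 : ∀ p ∈ crossPairs γ, p.1 ∈ selfIntParams γ ∧ p.2 ∈ selfIntParams γ := fun p hp =>
    ⟨mem_selfIntParams_iff.2 ⟨p.2, hp⟩,
      mem_selfIntParams_iff.2 ⟨p.1, hp.2.1, hp.1, hp.2.2.1.symm, hp.2.2.2.symm⟩⟩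
  -- The new curve keeps the old crossings because its values there are unchanged. Equal counts
  -- within the compartment exclude any others.
  have hcp : crossPairs γ = crossPairs ξ := by
    refine eq_of_subset_of_ncard_le (fun p hp => ⟨hp.1, hp.2.1, hp.2.2.1, ?_⟩)
      (hC.ncard_eq hξC hγ).le (hC.isGeneric hξC).finite_crossPairs
    rw [(hval _ (hp1 p hp).1).1, (hval _ (hp1 p hp).2).1, hp.2.2.2]
  refine ⟨γ, ξ, hgen.immersed, hξC, hξ2, ?_, ?_⟩
  · rw [← selfIntParams_congr hcp]; exact hloc
  · intro p hp
    rw [← hcp] at hp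
    rw [(hval _ (hp1 p hp).1).2, (hval _ (hp1 p hp).2).2]
    exact hort p hp


/-! ### Reparametrization by arclength -/

theorem add_int_of_add_one {φ : ℝ → ℝ} (h : ∀ x, φ (x + 1) = φ x + 1) (x : ℝ) (k : ℤ) :
    φ (x + k) = φ x + k := by
  have hp : Function.Periodic (fun x => φ x - x) 1 := fun x => by simp only [h]; ring
  have : φ (x + k) - (x + k) = φ x - x := periodic_add_int hp x k
  linarith

variable {jp jm s ω : ℤ} {C : Set (ℝ → ℂ)}

/-- A compartment is invariant under scaling and reparametrization. -/
theorem IsCompartment.smul_comp (hC : IsCompartment jp jm s ω C) {ξ : ℝ → ℂ} (hξ : ξ ∈ C)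
    {φ φ' : ℝ → ℝ} (hφ : ∀ x, HasDerivAt φ (φ' x) x) (hφc : Continuous φ') (hpos : ∀ x, 0 < φ' x)
    (hφ1 : ∀ x, φ (x + 1) = φ x + 1) {l : ℝ} (hl : 0 < l) : (fun x => l • ξ (φ x)) ∈ C := by
  have hgen := hC.isGeneric hξ
  have hc1 := hgen.immersed.isC1Loop
  have hξc := hgen.immersed.continuous
  have hξc' := hgen.immersed.continuous_deriv
  -- Orientation preserving reparametrizations and positive scalings both form convex sets, so
  -- straight interpolation stays among them.
  set Φ : ℝ → ℝ → ℝ := fun t x => (1 - t) * x + t * φ x with hΦ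
  set c : ℝ → ℝ := fun t => 1 - t + t * l with hc
  have hΦd : ∀ t x, HasDerivAt (Φ t) ((1 - t) + t * φ' x) x := fun t x => by
    have := ((hasDerivAt_id x).const_mul (1 - t)).add ((hφ x).const_mul t)
    rw [mul_one] at this
    exact this
  have hΦ1 : ∀ t x, Φ t (x + 1) = Φ t x + 1 := fun t x => by simp only [hΦ, hφ1]; ring
  have hφcont : Continuous φ := continuous_iff_continuousAt.2 fun x => (hφ x).continuousAt
  have hconv : ∀ t ∈ Icc (0 : ℝ) 1, ∀ a : ℝ, 0 < a → 0 < 1 - t + t * a := by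
    intro t ht a ha
    rcases ht.1.eq_or_lt with h | h
    · rw [← h]; norm_num
    · have := mul_pos h ha; linarith [ht.2]
  set G : ℝ → ℝ → ℂ := fun t x => c t • ξ (Φ t x) with hG
  have hGd : ∀ t x, HasDerivAt (G t) ((c t * ((1 - t) + t * φ' x)) • deriv ξ (Φ t x)) x := by
    intro t x
    have := (((hc1.differentiable (Φ t x)).hasDerivAt).scomp x (hΦd t x)).const_smul (c t)
    rw [smul_smul] at this
    exact this
  have hGd' : ∀ t x, deriv (G t) x = (c t * ((1 - t) + t * φ' x)) • deriv ξ (Φ t x) :=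
    fun t x => (hGd t x).deriv
  have himm : ∀ t ∈ Icc (0 : ℝ) 1, IsImmersedLoop (G t) := by
    intro t ht
    refine ⟨fun x => ?_, ?_, fun x => ?_⟩
    · simp only [hG, hΦ1, hc1.periodic _]
    · refine contDiff_one_iff_deriv.2 ⟨fun x => (hGd t x).differentiableAt, ?_⟩
      rw [show deriv (G t) = _ from funext (hGd' t)]
      fun_prop
    · rw [hGd']
      exact smul_ne_zero (mul_pos (hconv t ht l hl) (hconv t ht _ (hpos x))).ne'
        (hgen.immersed.deriv_ne_zero _)
  have hmono : ∀ t ∈ Icc (0 : ℝ) 1, StrictMono (Φ t) := fun t ht =>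
    strictMono_of_deriv_pos fun x => by rw [(hΦd t x).deriv]; exact hconv t ht _ (hpos x)
  have hcross : ∀ t ∈ Icc (0 : ℝ) 1, ∀ x y, Cross (G t) x y → Cross ξ (Φ t x) (Φ t y) := by
    intro t ht x y hxy
    refine ⟨fun k hk => hxy.1 k ?_, ?_⟩
    · rw [← add_int_of_add_one (hΦ1 t)] at hk
      exact (hmono t ht).injective hk
    · exact smul_right_injective ℂ (hconv t ht l hl).ne' hxy.2
  have e0 : G 0 = ξ := by funext x; simp [hG, hΦ, hc]
  have e1 : G 1 = fun x => l • ξ (φ x) := by funext x; simp [hG, hΦ, hc]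
  rw [← e1]
  refine hC.mem_of_homotopy (by rwa [e0]) ⟨himm, ?_, ?_⟩ fun t ht =>
    hgen.of_deriv_smul (himm t ht) (Φ t) _ (hGd' t) (hcross t ht)
  · simp only [hG, hΦ, hc]; fun_prop
  · simp only [hGd', hΦ, hc]; fun_prop

theorem lipschitzWith_of_periodic {f : ℝ → ℂ} (hf : ContDiff ℝ 1 f) (hp : Function.Periodic f 1) :
    ∃ K, LipschitzWith K f := by
  obtain ⟨B, hB, HB⟩ := exists_bound_of_periodic (hf.continuous_deriv le_rfl) (periodic_deriv hp)
  exact ⟨⟨B, hB.le⟩, lipschitzWith_of_nnnorm_deriv_le (hf.differentiable one_ne_zero) HB⟩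

/-- Every compartment contains an arclength parametrized curve of class `C^{1,1}` with orthogonal
self-intersections that is straight near its self-intersections. -/
theorem IsCompartment.exists_arclength (hC : IsCompartment jp jm s ω C) :
    ∃ γ ∈ C, (∀ x, ‖deriv γ x‖ = 1) ∧ (∃ K, LipschitzWith K (deriv γ)) ∧
      (∀ x y, Cross γ x y → inner ℝ (deriv γ x) (deriv γ y) = 0) ∧
      ∀ x y, Cross γ x y → deriv γ =ᶠ[𝓝 x] fun _ => deriv γ x := by
  obtain ⟨β, ξ, hβ, hξ, hξ2, hloc, hort⟩ := hC.exists_straight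
  have hgen := hC.isGeneric hξ
  have hp := hgen.immersed.periodic
  have hpd := periodic_deriv hp
  have h0 := hgen.immersed.deriv_ne_zero
  have hc := hgen.immersed.continuous_deriv
  set σ : ℝ → ℝ := fun x => ‖deriv ξ x‖ with hσ
  have hσc : Continuous σ := hc.norm
  have hσ0 : ∀ x, 0 < σ x := fun x => norm_pos_iff.2 (h0 x)
  have hσp : Function.Periodic σ 1 := fun x => by simp only [hσ, hpd x]
  set L : ℝ := ∫ t in (0 : ℝ)..1, σ t with hL
  have hL0 : 0 < L := intervalIntegral.intervalIntegral_pos_of_pos_on (hσc.intervalIntegrable _ _)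
    (fun x _ => hσ0 x) one_pos
  -- Arclength normalized by the total length. Its inverse `ψ` commutes with unit shifts, and
  -- scaling by `L⁻¹` then makes the speed equal to 1.
  set S : ℝ → ℝ := fun x => L⁻¹ * ∫ t in (0 : ℝ)..x, σ t with hS
  have hSd : ∀ x, HasDerivAt S (L⁻¹ * σ x) x := fun x =>
    (intervalIntegral.integral_hasDerivAt_right (hσc.intervalIntegrable _ _)
      hσc.aestronglyMeasurable.stronglyMeasurableAtFilter hσc.continuousAt).const_mul _
  have hSpos : ∀ x, 0 < L⁻¹ * σ x := fun x => mul_pos (inv_pos.2 hL0) (hσ0 x)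
  have hSmono : StrictMono S := strictMono_of_deriv_pos fun x => by
    rw [(hSd x).deriv]; exact hSpos x
  have hScont : Continuous S := continuous_iff_continuousAt.2 fun x => (hSd x).continuousAt
  have hS1 : ∀ x, S (x + 1) = S x + 1 := by
    intro x
    simp only [hS]
    rw [← intervalIntegral.integral_add_adjacent_intervals (b := x)
      (hσc.intervalIntegrable _ _) (hσc.intervalIntegrable _ _),
      hσp.intervalIntegral_add_eq x 0, zero_add, mul_add, ← hL, inv_mul_cancel₀ hL0.ne']
  have hS0 : S 0 = 0 := by simp [hS]
  have hSk : ∀ k : ℤ, S k = k := fun k => by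
    have := add_int_of_add_one hS1 0 k
    rwa [zero_add, hS0, zero_add] at this
  have hSsurj : Function.Surjective S := by
    intro y
    have h1 := intermediate_value_Icc (f := S) (a := (⌊y⌋ : ℝ)) (b := ((⌊y⌋ + 1 : ℤ) : ℝ))
      (by push_cast; linarith) hScont.continuousOn
    rw [hSk, hSk] at h1
    obtain ⟨x, _, hx⟩ := h1 ⟨Int.floor_le y, by push_cast; exact (Int.lt_floor_add_one y).le⟩
    exact ⟨x, hx⟩
  let e := hSmono.orderIsoOfSurjective S hSsurj
  set ψ : ℝ → ℝ := fun y => e.symm y with hψ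
  have hSψ : ∀ y, S (ψ y) = y := fun y => e.apply_symm_apply y
  have hψS : ∀ x, ψ (S x) = x := fun x => e.symm_apply_apply x
  have hψc : Continuous ψ := e.symm.continuous
  have hψd : ∀ y, HasDerivAt ψ (L⁻¹ * σ (ψ y))⁻¹ y := fun y =>
    HasDerivAt.of_local_left_inverse hψc.continuousAt (hSd (ψ y)) (hSpos _).ne'
      (Eventually.of_forall hSψ)
  have hψ1 : ∀ y, ψ (y + 1) = ψ y + 1 := fun y => hSmono.injective (by rw [hSψ, hS1, hSψ])
  have hmem := hC.smul_comp hξ hψd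
    ((continuous_const.mul (hσc.comp hψc)).inv₀ fun y => (hSpos _).ne')
    (fun y => inv_pos.2 (hSpos _)) hψ1 (inv_pos.2 hL0)
  set τ : ℝ → ℂ := fun x => (σ x)⁻¹ • deriv ξ x with hτ
  have hder : ∀ y, deriv (fun y => L⁻¹ • ξ (ψ y)) y = τ (ψ y) := by
    intro y
    have h1 := (((hgen.immersed.hasDerivAt (ψ y)).scomp y (hψd y)).const_smul L⁻¹)
    have h2 : deriv (fun y => L⁻¹ • ξ (ψ y)) y = _ := h1.deriv
    rw [h2, smul_smul, hτ]
    simp only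
    congr 1
    rw [mul_inv, inv_inv, ← mul_assoc, inv_mul_cancel₀ hL0.ne', one_mul]
  have hτ1 : ContDiff ℝ 1 τ := by
    have h1 : ContDiff ℝ 1 (deriv ξ) := by
      rw [show (2 : WithTop ℕ∞) = 1 + 1 by norm_num, contDiff_succ_iff_deriv] at hξ2
      exact hξ2.2.2
    exact ((h1.norm ℝ h0).inv fun x => (hσ0 x).ne').smul h1
  have hτp : Function.Periodic τ 1 := fun x => by simp only [hτ, hσp x, hpd x]
  have hcross : ∀ x y, Cross (fun y => L⁻¹ • ξ (ψ y)) x y → Cross ξ (ψ x) (ψ y) := by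
    intro x y hxy
    refine ⟨fun k hk => hxy.1 k ?_, smul_right_injective ℂ (inv_pos.2 hL0).ne' hxy.2⟩
    rw [← add_int_of_add_one hψ1] at hk
    exact e.symm.injective hk
  refine ⟨_, hmem, fun y => ?_, ?_, fun x y hxy => ?_, fun x y hxy => ?_⟩
  · rw [hder, hτ]
    simp only
    rw [norm_smul, norm_inv, Real.norm_eq_abs, abs_of_pos (hσ0 _), inv_mul_cancel₀ (hσ0 _).ne']
  · obtain ⟨K, hK⟩ := lipschitzWith_of_periodic hτ1 hτp
    obtain ⟨m, hm, hm'⟩ := exists_lower_bound_of_periodic hc hpd h0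
    have hψL : LipschitzWith ⟨L * m⁻¹, by positivity⟩ ψ := by
      refine lipschitzWith_of_nnnorm_deriv_le (fun y => (hψd y).differentiableAt) fun y => ?_
      change ‖deriv ψ y‖ ≤ L * m⁻¹
      rw [(hψd y).deriv, norm_inv, Real.norm_eq_abs, abs_of_pos (hSpos _), mul_inv, inv_inv]
      exact mul_le_mul_of_nonneg_left (inv_anti₀ hm (hm' _)) hL0.le
    rw [show deriv (fun y => L⁻¹ • ξ (ψ y)) = τ ∘ ψ from funext hder]
    exact ⟨_, hK.comp hψL⟩
  · have h1 := hcross x y hxy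
    have h2 := hort _ (h1.fract_mem hp)
    simp only [periodic_fract hpd] at h2
    rw [hder, hder, hτ]
    simp only
    rw [inner_smul_left, inner_smul_right, h2]
    simp
  · have h1 := hcross x y hxy
    have h2 := hloc _ (h1.fract_mem_selfIntParams hp)
    set u := Int.fract (ψ x) with hu
    -- On the straight arc the derivative is a cosine multiple of a fixed vector. Where the cosine
    -- is positive its direction is constant, which is what survives reparametrization.
    have h3 : ∀ᶠ z in 𝓝 u, τ z = (‖deriv β u‖)⁻¹ • deriv β u := by
      have hcos : ContinuousAt (fun z : ℝ => Real.cos (2 * Real.pi * (z - u))) u := by fun_prop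
      have h0c : 0 < Real.cos (2 * Real.pi * (u - u)) := by simp
      filter_upwards [h2.eventuallyEq_nhds, hcos.eventually (lt_mem_nhds h0c)] with z hz hz0
      rw [hτ]
      simp only [hσ]
      rw [hz.deriv_eq, (hasDerivAt_segmentArc β u z).deriv, norm_smul, Real.norm_eq_abs,
        abs_of_pos hz0, smul_smul]
      congr 1
      field_simp
    have h4 : ∀ᶠ z in 𝓝 x, τ (ψ z) = (‖deriv β u‖)⁻¹ • deriv β u := by
      have hcont : Tendsto (fun z => ψ z - ⌊ψ x⌋) (𝓝 x) (𝓝 u) :=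
        (hψc.sub continuous_const).tendsto x
      filter_upwards [hcont.eventually h3] with z hz
      rw [← hz]
      have := periodic_add_int hτp (ψ z) (-⌊ψ x⌋)
      rw [← this]; simp [sub_eq_add_neg]
    filter_upwards [h4] with z hz
    rw [hder, hder, hz, h4.self_of_nhds]

/-! ### Distances, gaps and angles of arclength parametrized curves -/

theorem intrinsicDist_eq {γ : ℝ → ℂ} (h : ∀ x, ‖deriv γ x‖ = 1) (x y : ℝ) :
    intrinsicDist γ x y = ⨅ k : ℤ, |y + k - x| := by
  unfold intrinsicDist
  simp [h]

theorem intrinsicDist_lt_iff {γ : ℝ → ℂ} (h : ∀ x, ‖deriv γ x‖ = 1) {x y δ : ℝ} :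
    intrinsicDist γ x y < δ ↔ ∃ k : ℤ, |x - (y + k)| < δ := by
  rw [intrinsicDist_eq h, ciInf_lt_iff ⟨0, by rintro _ ⟨k, rfl⟩; exact abs_nonneg _⟩]
  simp only [abs_sub_comm]

theorem le_intrinsicDist_iff {γ : ℝ → ℂ} (h : ∀ x, ‖deriv γ x‖ = 1) {x y δ : ℝ} :
    δ ≤ intrinsicDist γ x y ↔ ∀ k : ℤ, δ ≤ |x - (y + k)| := by
  rw [← not_lt, intrinsicDist_lt_iff h]; push Not; rfl

theorem le_minGap_iff {γ : ℝ → ℂ} (hp : Function.Periodic γ 1) (h : ∀ x, ‖deriv γ x‖ = 1)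
    {δ : ℝ} : ENNReal.ofReal δ ≤ minGap γ ↔ ∀ a a' b b' : ℝ, Cross γ a a' → Cross γ b b' →
      a ≠ b → (∀ k : ℤ, a ≠ b + k) → δ ≤ |a - b| := by
  unfold minGap
  simp only [le_iInf_iff]
  constructor
  · intro H a a' b b' ha hb hab hk
    have h1 := H _ (ha.fract_mem_selfIntParams hp) _ (hb.fract_mem_selfIntParams hp) (by
      intro he
      obtain ⟨z, hz⟩ := Int.fract_eq_fract.1 he
      exact hk z (by linarith))
    by_cases hδ : δ ≤ 0
    · exact hδ.trans (abs_nonneg _)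
    push Not at hδ
    have h2 : δ ≤ intrinsicDist γ (Int.fract a) (Int.fract b) := by
      by_contra hlt
      push Not at hlt
      exact absurd h1 (not_le.2 ((ENNReal.ofReal_lt_ofReal_iff hδ).2 hlt))
    have h3 := (le_intrinsicDist_iff h).1 h2 (⌊b⌋ - ⌊a⌋)
    rw [show Int.fract a - (Int.fract b + ((⌊b⌋ - ⌊a⌋ : ℤ) : ℝ)) = a - b by
      unfold Int.fract; push_cast; ring] at h3
    exact h3
  · intro H a ha b hb hab
    obtain ⟨a', ha'⟩ := mem_selfIntParams_iff.1 ha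
    obtain ⟨b', hb'⟩ := mem_selfIntParams_iff.1 hb
    refine ENNReal.ofReal_le_ofReal ((le_intrinsicDist_iff h).2 fun k => ?_)
    have h1 : ∀ m : ℤ, a ≠ b + m := fun m hm => hab (eq_of_Ico_of_eq_add_int
      (selfIntParams_subset_Ico ha) (selfIntParams_subset_Ico hb) hm)
    refine H a a' (b + k) (b' + k) (cross_of_mem_crossPairs ha')
      ((cross_of_mem_crossPairs hb').add_int hp k k) (h1 k) fun m hm => h1 (k + m) ?_
    rw [hm]; push_cast; ring

theorem intersectionAngle_eq_iff {γ : ℝ → ℂ} {u v : ℝ} :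
    intersectionAngle γ u v = Real.pi / 2 ↔ inner ℝ (deriv γ u) (deriv γ v) = 0 := by
  rw [InnerProductGeometry.inner_eq_zero_iff_angle_eq_pi_div_two, intersectionAngle]
  constructor
  · intro h
    rcases min_choice (InnerProductGeometry.angle (deriv γ u) (deriv γ v))
      (Real.pi - InnerProductGeometry.angle (deriv γ u) (deriv γ v)) with h1 | h1 <;>
      rw [h1] at h <;> linarith
  · intro h
    rw [h, sub_half, min_self]

theorem rightAngled_iff {γ : ℝ → ℂ} (hp : Function.Periodic γ 1) :
    RightAngled γ ↔ ∀ x y, Cross γ x y → inner ℝ (deriv γ x) (deriv γ y) = 0 := by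
  have hpd := periodic_deriv hp
  constructor
  · intro h x y hxy
    rw [← periodic_fract hpd x, ← periodic_fract hpd y]
    rcases mem_selfInt_or (hxy.fract_mem hp) with h1 | h1
    · exact intersectionAngle_eq_iff.1 (h (_, _) h1)
    · rw [real_inner_comm]
      exact intersectionAngle_eq_iff.1 (h (_, _) h1)
  · intro h p hpp
    exact intersectionAngle_eq_iff.2 (h _ _ (Cross.of_mem_selfInt hpp))

/-- There are finitely many crossing parameters, hence a common radius of straightness and a common
gap. A single curve then serves all sufficiently small η. -/
theorem IsCompartment.exists_rightAngleThreshold (hC : IsCompartment jp jm s ω C) :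
    ∃ η₁ : ℝ, IsRightAngleThreshold jp jm s ω C η₁ := by
  obtain ⟨γ, hγ, hunit, hlip, hort, hloc⟩ := hC.exists_arclength
  have hgen := hC.isGeneric hγ
  have hp := hgen.immersed.periodic
  obtain ⟨g, hg, Hg⟩ := hgen.exists_gap_cross
  have hT := hgen.finite_selfIntParams
  have hr : ∀ u, ∃ r > 0, u ∈ selfIntParams γ → ∀ x, |x - u| < r → deriv γ x = deriv γ u := by
    intro u
    by_cases hu : u ∈ selfIntParams γ
    · obtain ⟨v, hv⟩ := mem_selfIntParams_iff.1 hu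
      obtain ⟨r, hr, H⟩ := Metric.eventually_nhds_iff.1 (hloc _ _ (cross_of_mem_crossPairs hv))
      exact ⟨r, hr, fun _ x hx => H hx⟩
    · exact ⟨1, one_pos, fun h => absurd h hu⟩
  choose r hr0 hr using hr
  obtain ⟨R, hR, HR⟩ := exists_pos_le_of_finite (hT.image r) (by
    rintro _ ⟨u, _, rfl⟩; exact hr0 u)
  refine ⟨min (min R (g / 2)) (1 / 2), ⟨by positivity, ?_⟩, fun η hη => ⟨γ, ⟨?_, hγ⟩, hlip,
    (rightAngled_iff hp).2 hort⟩⟩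
  · exact (min_le_right _ _).trans_lt (by norm_num)
  have hηR : η ≤ R := hη.2.trans ((min_le_left _ _).trans (min_le_left _ _))
  have hηg : η ≤ g / 2 := hη.2.trans ((min_le_left _ _).trans (min_le_right _ _))
  refine ⟨hC.subset hγ, hunit, (le_minGap_iff hp hunit).2 fun a a' b b' ha hb hab _ => ?_,
    fun u hu => ?_⟩
  · by_contra hlt
    push Not at hlt
    exact hab (Hg a a' b b' ha hb (by linarith))
  · refine ⟨γ u - u • deriv γ u, deriv γ u, fun x hx => ?_⟩
    have hx' : |x - u| < η := by
      rw [abs_lt]; constructor <;> linarith [hx.1, hx.2]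
    have := norm_sub_sub_le hgen.immersed.isC1Loop.differentiable (x := u) (y := x)
      (v := deriv γ u) (c := 0) fun t ht => by
        have h1 := abs_sub_left_of_mem_uIcc ht
        rw [hr u hu t (by linarith [HR _ ⟨u, hu, rfl⟩]), sub_self, norm_zero]
    rw [zero_mul, norm_le_zero_iff, sub_eq_zero] at this
    rw [sub_add_eq_add_sub, add_sub_assoc, ← sub_smul, ← this]
    abel


/-! ### Admissible curves in terms of lifted self-intersections -/

/-- Generic arclength parametrized curves that are straight within distance `η` of their
self-intersections, which have mutual distance at least `2η`. -/
structure IsStraightGeneric (η : ℝ) (γ : ℝ → ℂ) : Prop where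
  generic : IsGeneric γ
  unit : ∀ x, ‖deriv γ x‖ = 1
  gap : ∀ a a' b b', Cross γ a a' → Cross γ b b' → (∀ k : ℤ, a ≠ b + k) → 2 * η ≤ |a - b|
  straight : ∀ u v, Cross γ u v → ∀ x, |x - u| < η → γ x = γ u + (x - u) • deriv γ u

theorem IsStraightGeneric.periodic {η : ℝ} {γ : ℝ → ℂ} (h : IsStraightGeneric η γ) :
    Function.Periodic γ 1 := h.generic.immersed.periodic

theorem mem_admissible_iff {η : ℝ} (hη : 0 < η) {jp jm s ω : ℤ} {γ : ℝ → ℂ} :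
    γ ∈ admissible η jp jm s ω ↔ γ ∈ genericClass jp jm s ω ∧ IsStraightGeneric η γ := by
  constructor
  · rintro ⟨h1, h2, h3, h4⟩
    have hp := h1.1.immersed.periodic
    refine ⟨h1, h1.1, h2, fun a a' b b' ha hb hk => ?_, fun u v huv x hx => ?_⟩
    · exact (le_minGap_iff hp h2).1 h3 a a' b b' ha hb (by simpa using hk 0) hk
    · obtain ⟨p, w, hpw⟩ := h4 _ (huv.fract_mem_selfIntParams hp)
      set u' := Int.fract u with hu'
      have hu0 : u' ∈ Ioo (u' - η) (u' + η) := ⟨by linarith, by linarith⟩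
      have hder : deriv γ u' = w := by
        have h5 : γ =ᶠ[𝓝 u'] fun x => p + x • w := by
          filter_upwards [isOpen_Ioo.mem_nhds hu0] with y hy using hpw y hy
        have h6 : HasDerivAt (fun x : ℝ => p + x • w) w u' := by
          simpa using ((hasDerivAt_id u').smul_const w).const_add p
        rw [h5.deriv_eq, h6.deriv]
      have e1 : γ u = γ u' := (periodic_fract hp u).symm
      have e2 : deriv γ u = deriv γ u' := (periodic_fract (periodic_deriv hp) u).symm
      have e3 : γ x = γ (x - ⌊u⌋) := by
        have := periodic_add_int hp x (-⌊u⌋)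
        rw [← this]; simp [sub_eq_add_neg]
      have hx' : x - ⌊u⌋ ∈ Ioo (u' - η) (u' + η) := by
        rw [abs_lt] at hx
        rw [hu', Int.fract]
        constructor <;> linarith
      rw [e1, e2, e3, hder, hpw _ hx', hpw _ hu0, hu', Int.fract, add_assoc, ← add_smul]
      congr 2; ring
  · rintro ⟨h1, h2⟩
    refine ⟨h1, h2.unit, (le_minGap_iff h2.periodic h2.unit).2
      fun a a' b b' ha hb _ hk => h2.gap a a' b b' ha hb hk, fun u hu => ?_⟩
    obtain ⟨v, hv⟩ := mem_selfIntParams_iff.1 hu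
    refine ⟨γ u - u • deriv γ u, deriv γ u, fun x hx => ?_⟩
    rw [h2.straight u v (cross_of_mem_crossPairs hv) x (by
      rw [abs_lt]; constructor <;> linarith [hx.1, hx.2]), sub_smul]
    abel

/-- The two parameters of a crossing are at most 1/2 apart on a circle of length 1, and at least 2η
apart by the gap condition. -/
theorem IsStraightGeneric.eta_le {η : ℝ} {γ : ℝ → ℂ} (h : IsStraightGeneric η γ) {u v : ℝ}
    (huv : Cross γ u v) : η ≤ 1 / 4 := by
  have h1 := abs_sub_round (u - v)
  have h2 := h.gap u v (v + round (u - v)) (u + round (u - v)) huv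
    (huv.symm.add_int h.periodic _ _) fun k hk => huv.1 (round (u - v) + k) (by
      push_cast; linarith)
  rw [show u - (v + (round (u - v) : ℝ)) = u - v - round (u - v) by ring] at h2
  linarith

/-! ### The energy density -/

/-- The tangent-point kernel of an arclength parametrized curve. -/
noncomputable def tpKernel (γ : ℝ → ℂ) (x y : ℝ) : ℝ :=
  2 * |det (deriv γ y) (γ x - γ y)| / ‖γ y - γ x‖ ^ 2

theorem infDist_tangentLine {γ : ℝ → ℂ} (h : ∀ x, ‖deriv γ x‖ = 1) (x y : ℝ) :
    Metric.infDist (γ x) (tangentLine γ y) = |det (deriv γ y) (γ x - γ y)| := by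
  set d := deriv γ y with hd
  have hd1 : ‖d‖ = 1 := h y
  refine le_antisymm ?_ ?_
  · have hmem : γ y + (inner ℝ d (γ x - γ y)) • d ∈ tangentLine γ y := ⟨_, rfl⟩
    refine (Metric.infDist_le_dist_of_mem hmem).trans ?_
    rw [dist_eq_norm]
    refine abs_le_of_sq_le_sq' ?_ (abs_nonneg _) |>.2
    rw [sq_abs, show γ x - (γ y + inner ℝ d (γ x - γ y) • d) =
      (γ x - γ y) - inner ℝ d (γ x - γ y) • d by abel]
    have h1 := inner_sq_add_det_sq d (γ x - γ y)
    have h2 := norm_sub_sq_real (γ x - γ y) (inner ℝ d (γ x - γ y) • d)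
    rw [inner_smul_right, norm_smul, hd1, mul_one, Real.norm_eq_abs, sq_abs,
      real_inner_comm (γ x - γ y) d, real_inner_comm d (γ x - γ y)] at h2
    rw [hd1, one_pow, one_mul] at h1
    have e := real_inner_comm d (γ x - γ y)
    nlinarith
  · refine (Metric.le_infDist (range_nonempty _)).2 ?_
    rintro _ ⟨r, rfl⟩
    have h1 := abs_det_le d (γ x - (γ y + r • d))
    rw [hd1, one_mul, show γ x - (γ y + r • d) = (γ x - γ y) - r • d by abel, det_sub_right,
      det_smul_right, det_self, mul_zero, sub_zero] at h1
    rw [dist_eq_norm, show γ x - (γ y + r • deriv γ y) = (γ x - γ y) - r • d by rw [hd]; abel]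
    exact h1

/-- The density of the tangent-point energy. -/
noncomputable def tpDensity (q : ℝ) (γ : ℝ → ℂ) (z : ℝ × ℝ) : ℝ≥0∞ :=
  ENNReal.ofReal (tpKernel γ z.1 z.2 ^ q)

theorem tpKernel_nonneg (γ : ℝ → ℂ) (x y : ℝ) : 0 ≤ tpKernel γ x y := by
  unfold tpKernel; positivity

theorem measurable_tpDensity {γ : ℝ → ℂ} (h : IsC1Loop γ) (q : ℝ) :
    Measurable (tpDensity q γ) := by
  have h1 : Continuous γ := h.contDiff.continuous
  have h2 : Continuous (deriv γ) := h.contDiff.continuous_deriv le_rfl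
  have h3 : Continuous fun z : ℝ × ℝ => det (deriv γ z.2) (γ z.1 - γ z.2) :=
    continuous_det.comp (f := fun z : ℝ × ℝ => (deriv γ z.2, γ z.1 - γ z.2)) (by fun_prop)
  unfold tpDensity tpKernel
  refine ENNReal.measurable_ofReal.comp (Measurable.pow_const (Measurable.div ?_ ?_) q)
  · exact (continuous_const.mul h3.abs).measurable
  · exact Continuous.measurable (by fun_prop)

theorem tpKernel_add_int {γ : ℝ → ℂ} (hp : Function.Periodic γ 1) (x y : ℝ) (k l : ℤ) :
    tpKernel γ (x + k) (y + l) = tpKernel γ x y := by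
  unfold tpKernel
  rw [periodic_add_int hp, periodic_add_int hp, periodic_add_int (periodic_deriv hp)]

theorem mem_cutout_iff {γ : ℝ → ℂ} (hp : Function.Periodic γ 1) (h : ∀ x, ‖deriv γ x‖ = 1)
    {δ : ℝ} {z : ℝ × ℝ} :
    z ∈ cutout δ γ ↔ ∃ u v, Cross γ u v ∧ |z.1 - u| < δ ∧ |z.2 - v| < δ := by
  simp only [cutout, mem_ofPred_eq, intrinsicDist_lt_iff h]
  constructor
  · rintro ⟨p, hpp, ⟨⟨k, hk⟩, l, hl⟩ | ⟨⟨k, hk⟩, l, hl⟩⟩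
    · exact ⟨_, _, (Cross.of_mem_selfInt hpp).add_int hp k l, hk, hl⟩
    · exact ⟨_, _, (Cross.of_mem_selfInt hpp).symm.add_int hp k l, hk, hl⟩
  · rintro ⟨u, v, huv, hu, hv⟩
    have e1 : Int.fract u + ⌊u⌋ = u := Int.fract_add_floor u
    have e2 : Int.fract v + ⌊v⌋ = v := Int.fract_add_floor v
    rcases mem_selfInt_or (huv.fract_mem hp) with h1 | h1
    · exact ⟨_, h1, Or.inl ⟨⟨⌊u⌋, by simpa only [e1] using hu⟩, ⌊v⌋, by simpa only [e2] using hv⟩⟩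
    · exact ⟨_, h1, Or.inr ⟨⟨⌊u⌋, by simpa only [e1] using hu⟩, ⌊v⌋, by simpa only [e2] using hv⟩⟩

theorem isOpen_cutout {γ : ℝ → ℂ} (hp : Function.Periodic γ 1) (h : ∀ x, ‖deriv γ x‖ = 1)
    (δ : ℝ) : IsOpen (cutout δ γ) := by
  have : cutout δ γ = ⋃ p ∈ {p : ℝ × ℝ | Cross γ p.1 p.2},
      {z : ℝ × ℝ | |z.1 - p.1| < δ ∧ |z.2 - p.2| < δ} := by
    ext z
    rw [mem_cutout_iff hp h]
    simp only [mem_iUnion, mem_ofPred_eq, exists_prop, Prod.exists]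
  rw [this]
  refine isOpen_biUnion fun p _ => IsOpen.and ?_ ?_
  · exact isOpen_lt (by fun_prop) continuous_const
  · exact isOpen_lt (by fun_prop) continuous_const

theorem add_int_mem_cutout_iff {γ : ℝ → ℂ} (hp : Function.Periodic γ 1)
    (h : ∀ x, ‖deriv γ x‖ = 1) {δ x y : ℝ} (k l : ℤ) :
    (x + k, y + l) ∈ cutout δ γ ↔ (x, y) ∈ cutout δ γ := by
  have key : ∀ (x y : ℝ) (k l : ℤ), (x, y) ∈ cutout δ γ → (x + k, y + l) ∈ cutout δ γ := by
    intro x y k l hxy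
    rw [mem_cutout_iff hp h] at hxy ⊢
    obtain ⟨u, v, huv, hu, hv⟩ := hxy
    refine ⟨u + k, v + l, huv.add_int hp k l, ?_, ?_⟩
    · simpa using hu
    · simpa using hv
  refine ⟨fun hxy => ?_, key x y k l⟩
  have := key _ _ (-k) (-l) hxy
  simpa using this

/-- The density of the tangent-point energy off the cut out region. -/
noncomputable def offDensity (q δ : ℝ) (γ : ℝ → ℂ) : ℝ × ℝ → ℝ≥0∞ :=
  (cutout δ γ)ᶜ.indicator (tpDensity q γ)

theorem measurable_offDensity {γ : ℝ → ℂ} (hγ : IsC1Loop γ) (h : ∀ x, ‖deriv γ x‖ = 1)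
    (q δ : ℝ) : Measurable (offDensity q δ γ) :=
  (measurable_tpDensity hγ q).indicator (isOpen_cutout hγ.periodic h δ).measurableSet.compl

theorem offDensity_add_int {γ : ℝ → ℂ} (hp : Function.Periodic γ 1) (h : ∀ x, ‖deriv γ x‖ = 1)
    (q δ x y : ℝ) (k l : ℤ) : offDensity q δ γ (x + k, y + l) = offDensity q δ γ (x, y) := by
  unfold offDensity
  by_cases hm : (x, y) ∈ cutout δ γ
  · rw [indicator_of_notMem (by simpa using (add_int_mem_cutout_iff hp h k l).2 hm),
      indicator_of_notMem (by simpa using hm)]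
  · rw [indicator_of_mem (by simpa using fun h' => hm ((add_int_mem_cutout_iff hp h k l).1 h')),
      indicator_of_mem (by simpa using hm)]
    simp only [tpDensity, tpKernel_add_int hp]

theorem truncatedTP_eq {γ : ℝ → ℂ} (hγ : IsC1Loop γ) (h : ∀ x, ‖deriv γ x‖ = 1) (q δ : ℝ) :
    truncatedTP q δ γ = ∫⁻ z in Ico (0 : ℝ) 1 ×ˢ Ico (0 : ℝ) 1, offDensity q δ γ z := by
  unfold truncatedTP offDensity
  rw [setLIntegral_indicator (isOpen_cutout hγ.periodic h δ).measurableSet.compl, inter_comm,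
    ← sdiff_eq]
  refine lintegral_congr fun z => ?_
  rw [h, h, mul_one, mul_one, infDist_tangentLine h]
  rfl

/-! ### Integrals of periodic functions -/

theorem lintegral_periodic {f : ℝ → ℝ≥0∞} (hf : Function.Periodic f 1) (a : ℝ) :
    ∫⁻ x in Ico a (a + 1), f x = ∫⁻ x in Ico (0 : ℝ) 1, f x := by
  have h := (isAddFundamentalDomain_Ioc one_pos a volume).setLIntegral_eq
    (isAddFundamentalDomain_Ioc one_pos (0 : ℝ) volume) f (by
      rintro ⟨g, hg⟩ x
      obtain ⟨k, rfl⟩ := AddSubgroup.mem_zmultiples_iff.1 hg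
      change f (k • (1 : ℝ) + x) = f x
      rw [add_comm, zsmul_eq_mul, mul_one]
      exact periodic_add_int hf x k)
  rw [zero_add] at h
  rwa [setLIntegral_congr Ico_ae_eq_Ioc, setLIntegral_congr (Ico_ae_eq_Ioc (a := (0 : ℝ)))]

theorem lintegral_biperiodic {F : ℝ × ℝ → ℝ≥0∞} (hF : Measurable F)
    (hper : ∀ (x y : ℝ) (k l : ℤ), F (x + k, y + l) = F (x, y)) (a b : ℝ) :
    ∫⁻ z in Ico a (a + 1) ×ˢ Ico b (b + 1), F z =
      ∫⁻ z in Ico (0 : ℝ) 1 ×ˢ Ico (0 : ℝ) 1, F z := by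
  have e : ∀ a b : ℝ, ∫⁻ z in Ico a (a + 1) ×ˢ Ico b (b + 1), F z =
      ∫⁻ x in Ico a (a + 1), ∫⁻ y in Ico b (b + 1), F (x, y) := by
    intro a b
    rw [Measure.volume_eq_prod, ← Measure.prod_restrict, lintegral_prod _ hF.aemeasurable]
  have h1 : ∀ x, Function.Periodic (fun y => F (x, y)) 1 := fun x y => by
    simpa using hper x y 0 1
  have h2 : Function.Periodic (fun x => ∫⁻ y in Ico (0 : ℝ) 1, F (x, y)) 1 := fun x => by
    refine lintegral_congr fun y => ?_
    simpa using hper x y 1 0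
  have e0 := e 0 0
  rw [zero_add] at e0
  rw [e0, e a b]
  simp only [lintegral_periodic (h1 _) b]
  exact lintegral_periodic h2 a

theorem IsStraightGeneric.isC1Loop {η : ℝ} {γ : ℝ → ℂ} (h : IsStraightGeneric η γ) : IsC1Loop γ :=
  h.generic.immersed.isC1Loop

/-! ### The energy near the self-intersections -/

/-- The square annulus `δ ≤ max(|s|,|t|) < η`. -/
def squareAnnulus (δ η : ℝ) : Set (ℝ × ℝ) :=
  {z | |z.1| < η ∧ |z.2| < η ∧ ¬ (|z.1| < δ ∧ |z.2| < δ)}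

theorem measurableSet_squareAnnulus (δ η : ℝ) : MeasurableSet (squareAnnulus δ η) := by
  have h1 : ∀ r : ℝ, MeasurableSet {z : ℝ × ℝ | |z.1| < r} := fun r =>
    (isOpen_lt (by fun_prop) continuous_const).measurableSet
  have h2 : ∀ r : ℝ, MeasurableSet {z : ℝ × ℝ | |z.2| < r} := fun r =>
    (isOpen_lt (by fun_prop) continuous_const).measurableSet
  exact (h1 η).inter ((h2 η).inter ((h1 δ).inter (h2 δ)).compl)

/-- The energy of two crossing straight lines whose directions have inner product `c`. -/
noncomputable def crossEnergy (q δ η c : ℝ) : ℝ≥0∞ :=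
  ∫⁻ z in squareAnnulus δ η, ENNReal.ofReal
    ((2 * (|z.1| * √(1 - c ^ 2)) / (z.1 ^ 2 + z.2 ^ 2 - 2 * (z.1 * z.2) * c)) ^ q)

/-- The part of the torus near the pair `p` of parameters. -/
def pairBall (p : ℝ × ℝ) (r : ℝ) : Set (ℝ × ℝ) :=
  {z | ∃ k l : ℤ, |z.1 - (p.1 + k)| < r ∧ |z.2 - (p.2 + l)| < r}

theorem mem_cutout_iff_pairBall {γ : ℝ → ℂ} (hp : Function.Periodic γ 1)
    (h : ∀ x, ‖deriv γ x‖ = 1) {δ : ℝ} {z : ℝ × ℝ} :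
    z ∈ cutout δ γ ↔ ∃ p ∈ crossPairs γ, z ∈ pairBall p δ := by
  rw [mem_cutout_iff hp h]
  constructor
  · rintro ⟨u, v, huv, hu, hv⟩
    refine ⟨_, huv.fract_mem hp, ⌊u⌋, ⌊v⌋, ?_, ?_⟩
    · simpa only [Int.fract_add_floor] using hu
    · simpa only [Int.fract_add_floor] using hv
  · rintro ⟨p, hpc, k, l, h1, h2⟩
    exact ⟨_, _, (cross_of_mem_crossPairs hpc).add_int hp k l, h1, h2⟩

theorem isOpen_pairBall (p : ℝ × ℝ) (r : ℝ) : IsOpen (pairBall p r) := by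
  unfold pairBall
  simp only [ofPred_exists]
  refine isOpen_iUnion fun k => isOpen_iUnion fun l => IsOpen.and ?_ ?_
  · exact isOpen_lt (by fun_prop) continuous_const
  · exact isOpen_lt (by fun_prop) continuous_const

theorem pairBall_mono {p : ℝ × ℝ} {r r' : ℝ} (h : r ≤ r') : pairBall p r ⊆ pairBall p r' := by
  rintro z ⟨k, l, h1, h2⟩
  exact ⟨k, l, h1.trans_le h, h2.trans_le h⟩

theorem add_int_mem_pairBall {p : ℝ × ℝ} {r x y : ℝ} (k l : ℤ) :
    (x + k, y + l) ∈ pairBall p r ↔ (x, y) ∈ pairBall p r := by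
  constructor
  · rintro ⟨k', l', h1, h2⟩
    refine ⟨k' - k, l' - l, ?_, ?_⟩
    · convert h1 using 2; push_cast; ring
    · convert h2 using 2; push_cast; ring
  · rintro ⟨k', l', h1, h2⟩
    refine ⟨k' + k, l' + l, ?_, ?_⟩
    · convert h1 using 2; push_cast; ring
    · convert h2 using 2; push_cast; ring

/-- Distinct crossing parameters are at least 2η apart, so the open squares of half-side η around
different crossing pairs are disjoint. -/
theorem IsStraightGeneric.eq_of_pairBall {η : ℝ} {γ : ℝ → ℂ} (h : IsStraightGeneric η γ)
    {p p' : ℝ × ℝ} (hp : p ∈ crossPairs γ) (hp' : p' ∈ crossPairs γ) {z : ℝ × ℝ}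
    (hz : z ∈ pairBall p η) (hz' : z ∈ pairBall p' η) : p = p' := by
  obtain ⟨k, l, h1, h2⟩ := hz
  obtain ⟨k', l', h3, h4⟩ := hz'
  have key : ∀ a a' b b' : ℝ, (a, a') ∈ crossPairs γ → (b, b') ∈ crossPairs γ → ∀ (x : ℝ) (k k' : ℤ),
      |x - (a + k)| < η → |x - (b + k')| < η → a = b := by
    intro a a' b b' ha hb x k k' hk hk'
    by_contra hne
    have h5 := h.gap (a + k) (a' + k) (b + k') (b' + k')
      ((cross_of_mem_crossPairs ha).add_int h.periodic _ _)
      ((cross_of_mem_crossPairs hb).add_int h.periodic _ _) fun m hm =>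
        hne (eq_of_Ico_of_eq_add_int ha.1 hb.1 (k := k' + m - k) (by push_cast; linarith))
    rw [abs_lt] at hk hk'
    rcases abs_cases (a + k - (b + k')) with ⟨e, _⟩ | ⟨e, _⟩ <;> rw [e] at h5 <;> linarith
  have hs : ∀ p ∈ crossPairs γ, (p.2, p.1) ∈ crossPairs γ := fun p hp =>
    ⟨hp.2.1, hp.1, hp.2.2.1.symm, hp.2.2.2.symm⟩
  exact Prod.ext (key _ _ _ _ hp hp' _ _ _ h1 h3) (key _ _ _ _ (hs p hp) (hs p' hp') _ _ _ h2 h4)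

theorem eq_zero_of_abs_sub_add_int_lt {x p η : ℝ} (hη : η ≤ 1 / 4) (hx : x ∈ Ico (p - 1 / 2) (p - 1 / 2 + 1))
    {k : ℤ} (h : |x - (p + k)| < η) : k = 0 := by
  rw [abs_lt] at h
  have h1 : (k : ℝ) < 1 := by linarith [hx.2]
  have h2 : (-1 : ℝ) < k := by linarith [hx.1]
  have h3 : k < 1 := by exact_mod_cast h1
  have h4 : -1 < k := by exact_mod_cast h2
  omega

/-- Both strands are straight: the distance to the tangent line is |s| times the sine of the angle,
and the squared chord is given by the law of cosines. -/
theorem tpKernel_near_cross {η : ℝ} {γ : ℝ → ℂ} (h : IsStraightGeneric η γ) {u v : ℝ}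
    (huv : Cross γ u v) {s t : ℝ} (hs : |s| < η) (ht : |t| < η) :
    tpKernel γ (u + s) (v + t) = 2 * (|s| * √(1 - (inner ℝ (deriv γ u) (deriv γ v)) ^ 2)) /
      (s ^ 2 + t ^ 2 - 2 * (s * t) * inner ℝ (deriv γ u) (deriv γ v)) := by
  have hη : 0 < η := (abs_nonneg s).trans_lt hs
  have e1 := h.straight u v huv (u + s) (by simpa using hs)
  have e2 := h.straight v u huv.symm (v + t) (by simpa using ht)
  have e3 : deriv γ (v + t) = deriv γ v := by
    have h5 : γ =ᶠ[𝓝 (v + t)] fun x => γ v + (x - v) • deriv γ v := by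
      have : ContinuousAt (fun x : ℝ => |x - v|) (v + t) := by fun_prop
      filter_upwards [this.eventually (gt_mem_nhds (show |v + t - v| < η by simpa using ht))]
        with y hy using h.straight v u huv.symm y hy
    have h6 : HasDerivAt (fun x : ℝ => γ v + (x - v) • deriv γ v) (deriv γ v) (v + t) := by
      simpa using (((hasDerivAt_id (v + t)).sub_const v).smul_const (deriv γ v)).const_add (γ v)
    rw [h5.deriv_eq, h6.deriv]
  rw [add_sub_cancel_left] at e1 e2
  set a := deriv γ u
  set b := deriv γ v
  have ha : ‖a‖ = 1 := h.unit u
  have hb : ‖b‖ = 1 := h.unit v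
  have hsq := inner_sq_add_det_sq a b
  rw [ha, hb, one_pow, one_mul] at hsq
  unfold tpKernel
  rw [e1, e2, e3, huv.2]
  congr 1
  · rw [add_sub_add_left_eq_sub, det_sub_right, det_smul_right, det_smul_right, det_self, mul_zero,
      sub_zero, abs_mul]
    congr 2
    rw [show 1 - inner ℝ a b ^ 2 = det b a ^ 2 by rw [det_swap a b]; linarith, Real.sqrt_sq_eq_abs]
  · rw [add_sub_add_left_eq_sub, norm_sub_sq_real, inner_smul_left, inner_smul_right, norm_smul,
      norm_smul, ha, hb, real_inner_comm a b]
    simp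
    ring

theorem lintegral_pairBall {η : ℝ} {γ : ℝ → ℂ} (h : IsStraightGeneric η γ) {p : ℝ × ℝ}
    (hp : p ∈ crossPairs γ) (q δ : ℝ) :
    ∫⁻ z in Ico (0 : ℝ) 1 ×ˢ Ico (0 : ℝ) 1,
      (pairBall p η \ pairBall p δ).indicator (tpDensity q γ) z =
    crossEnergy q δ η (inner ℝ (deriv γ p.1) (deriv γ p.2)) := by
  have hcr := cross_of_mem_crossPairs hp
  have hη4 := h.eta_le hcr
  have hm : MeasurableSet (pairBall p η \ pairBall p δ) :=
    (isOpen_pairBall p η).measurableSet.diff (isOpen_pairBall p δ).measurableSet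
  have hmeas : Measurable ((pairBall p η \ pairBall p δ).indicator (tpDensity q γ)) :=
    (measurable_tpDensity h.isC1Loop q).indicator hm
  -- The fundamental square is centred at `p`. Since η ≤ 1/4, only the untranslated copy of the ball
  -- around `p` meets it.
  rw [← lintegral_biperiodic hmeas ?_ (p.1 - 1 / 2) (p.2 - 1 / 2)]
  · rw [← lintegral_indicator (measurableSet_Ico.prod measurableSet_Ico),
      ← lintegral_add_left_eq_self (μ := volume) _ p, crossEnergy,
      ← lintegral_indicator (measurableSet_squareAnnulus δ η)]
    refine lintegral_congr fun z => ?_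
    by_cases hz : z ∈ squareAnnulus δ η
    · obtain ⟨z1, z2, z3⟩ := id hz
      have hin : p + z ∈ Ico (p.1 - 1 / 2) (p.1 - 1 / 2 + 1) ×ˢ
          Ico (p.2 - 1 / 2) (p.2 - 1 / 2 + 1) := by
        rw [abs_lt] at z1 z2
        refine ⟨⟨?_, ?_⟩, ⟨?_, ?_⟩⟩ <;> simp only [Prod.fst_add, Prod.snd_add] <;> linarith
      have hin2 : p + z ∈ pairBall p η \ pairBall p δ := by
        refine ⟨⟨0, 0, by simpa using z1, by simpa using z2⟩, ?_⟩
        rintro ⟨k, l, hk, hl⟩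
        by_cases hδ : δ ≤ η
        · have k0 := eq_zero_of_abs_sub_add_int_lt hη4 hin.1 (hk.trans_le hδ)
          have l0 := eq_zero_of_abs_sub_add_int_lt hη4 hin.2 (hl.trans_le hδ)
          subst k0 l0
          exact z3 ⟨by simpa using hk, by simpa using hl⟩
        · push Not at hδ
          exact z3 ⟨z1.trans hδ, z2.trans hδ⟩
      rw [indicator_of_mem hz, indicator_of_mem hin, indicator_of_mem hin2, tpDensity,
        Prod.fst_add, Prod.snd_add, tpKernel_near_cross h hcr z1 z2]
    · rw [indicator_of_notMem hz]
      by_cases hin : p + z ∈ Ico (p.1 - 1 / 2) (p.1 - 1 / 2 + 1) ×ˢ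
          Ico (p.2 - 1 / 2) (p.2 - 1 / 2 + 1)
      · rw [indicator_of_mem hin, indicator_of_notMem]
        rintro ⟨⟨k, l, hk, hl⟩, hnot⟩
        have k0 := eq_zero_of_abs_sub_add_int_lt hη4 hin.1 hk
        have l0 := eq_zero_of_abs_sub_add_int_lt hη4 hin.2 hl
        subst k0 l0
        refine hz ⟨by simpa using hk, by simpa using hl, fun hh => hnot ⟨0, 0, ?_, ?_⟩⟩
        · simpa using hh.1
        · simpa using hh.2
      · rw [indicator_of_notMem hin]
  · intro x y k l
    by_cases hm : (x, y) ∈ pairBall p η \ pairBall p δ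
    · rw [indicator_of_mem hm, indicator_of_mem (by
        simpa only [Set.mem_sdiff, add_int_mem_pairBall] using hm)]
      simp only [tpDensity, tpKernel_add_int h.periodic]
    · rw [indicator_of_notMem hm, indicator_of_notMem (by
        simpa only [Set.mem_sdiff, add_int_mem_pairBall] using hm)]

/-- The truncated energy splits into a part away from the self-intersections and the energies of
the crossings. -/
theorem truncatedTP_split {η : ℝ} {γ : ℝ → ℂ} (h : IsStraightGeneric η γ) {q δ : ℝ} (hδ : δ ≤ η) :
    truncatedTP q δ γ = truncatedTP q η γ +
      ∑ p ∈ h.generic.finite_crossPairs.toFinset,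
        crossEnergy q δ η (inner ℝ (deriv γ p.1) (deriv γ p.2)) := by
  have hper := h.periodic
  have hmem : ∀ p, p ∈ h.generic.finite_crossPairs.toFinset ↔ p ∈ crossPairs γ := fun p =>
    h.generic.finite_crossPairs.mem_toFinset
  rw [truncatedTP_eq h.isC1Loop h.unit, truncatedTP_eq h.isC1Loop h.unit,
    Finset.sum_congr rfl fun p hp => (lintegral_pairBall h ((hmem p).1 hp) q δ).symm,
    ← lintegral_finsetSum _ fun p _ => (measurable_tpDensity h.isC1Loop q).indicator
      ((isOpen_pairBall p η).measurableSet.diff (isOpen_pairBall p δ).measurableSet),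
    ← lintegral_add_left (measurable_offDensity h.isC1Loop h.unit q η)]
  refine lintegral_congr fun z => ?_
  unfold offDensity
  -- Pointwise identity of densities: inside the η-cutout exactly one crossing contributes, outside
  -- none does.
  by_cases hz : z ∈ cutout η γ
  · rw [indicator_of_notMem (s := (cutout η γ)ᶜ) (by simpa using hz), zero_add]
    obtain ⟨p, hp, hzp⟩ := (mem_cutout_iff_pairBall hper h.unit).1 hz
    rw [Finset.sum_eq_single_of_mem p ((hmem p).2 hp)]
    · by_cases hzδ : z ∈ cutout δ γ
      · rw [indicator_of_notMem (by simpa using hzδ)]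
        obtain ⟨p', hp', hzp'⟩ := (mem_cutout_iff_pairBall hper h.unit).1 hzδ
        have := h.eq_of_pairBall hp hp' hzp (pairBall_mono hδ hzp')
        subst this
        rw [indicator_of_notMem fun hh => hh.2 hzp']
      · rw [indicator_of_mem (by simpa using hzδ), indicator_of_mem]
        exact ⟨hzp, fun hh => hzδ ((mem_cutout_iff_pairBall hper h.unit).2 ⟨p, hp, hh⟩)⟩
    · intro p' hp' hne
      exact indicator_of_notMem
        (fun hh => hne (h.eq_of_pairBall ((hmem p').1 hp') hp hh.1 hzp)) _
  · have hzδ : z ∉ cutout δ γ := fun hh => hz (by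
      obtain ⟨p, hp, hzp⟩ := (mem_cutout_iff_pairBall hper h.unit).1 hh
      exact (mem_cutout_iff_pairBall hper h.unit).2 ⟨p, hp, pairBall_mono hδ hzp⟩)
    rw [indicator_of_mem (by simpa using hzδ), indicator_of_mem (by simpa using hz),
      Finset.sum_eq_zero, add_zero]
    intro p hp
    exact indicator_of_notMem (fun hh => hz
      ((mem_cutout_iff_pairBall hper h.unit).2 ⟨p, (hmem p).1 hp, hh.1⟩)) _


/-! ### The energy of a crossing is minimal for right angles -/

theorem lintegral_comp_mul {f : ℝ → ℝ≥0∞} (hf : Measurable f) {a : ℝ} (ha : a ≠ 0) :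
    ∫⁻ x, f x = ENNReal.ofReal |a| * ∫⁻ x, f (a * x) := by
  conv_lhs => rw [← Real.smul_map_volume_mul_left ha]
  rw [lintegral_smul_measure, lintegral_map hf (measurable_const_mul a), smul_eq_mul]

/-- Cases according to which lower bound for `b` is the larger one. If it is `x - k`, then S²(x² -
k²) = x² + k²(x² - S²). If it is `S`, then x² ≤ x(k + S) reduces the claim to an inequality that is
linear in `x`. -/
theorem sq_le_of_bounds {k S x a b : ℝ} (hk : 0 ≤ k) (hS1 : 1 ≤ S) (hS : S ^ 2 = 1 + k ^ 2)
    (hx : 0 ≤ x) (ha : x + k ≤ a) (hb1 : S ≤ b) (hb2 : x - k ≤ b) : x ^ 2 ≤ S ^ 2 * (a * b) := by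
  have hxk : 0 ≤ x + k := by positivity
  have hS0 : 0 ≤ S := by linarith
  rcases le_total S (x - k) with h | h
  · have h1 : (x + k) * (x - k) ≤ a * b := mul_le_mul ha hb2 (by linarith) (by linarith)
    have h2 : S ^ 2 * ((x + k) * (x - k)) ≤ S ^ 2 * (a * b) :=
      mul_le_mul_of_nonneg_left h1 (sq_nonneg S)
    refine le_trans ?_ h2
    have h3 : S ^ 2 ≤ x ^ 2 := by nlinarith
    have h4 : S ^ 2 * ((x + k) * (x - k)) = x ^ 2 + k ^ 2 * (x ^ 2 - S ^ 2) := by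
      rw [hS]; ring
    rw [h4]
    nlinarith [mul_nonneg (sq_nonneg k) (sub_nonneg.2 h3)]
  · have h1 : (x + k) * S ≤ a * b := mul_le_mul ha hb1 hS0 (by linarith)
    have h2 : S ^ 2 * ((x + k) * S) ≤ S ^ 2 * (a * b) :=
      mul_le_mul_of_nonneg_left h1 (sq_nonneg S)
    refine le_trans ?_ h2
    have h3 : x ^ 2 ≤ x * (k + S) := by nlinarith
    have h4 : S ^ 2 * ((x + k) * S) - x * (k + S) = k * (S * S ^ 2 + x * (S * k - 1)) := by
      have : S ^ 2 * ((x + k) * S) = x * S * S ^ 2 + k * (S * S ^ 2) := by ring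
      rw [this]
      conv_lhs => rw [hS]
      conv_rhs => rw [hS]
      ring
    have h5 : 0 ≤ S * S ^ 2 + x * (S * k - 1) := by
      rcases le_total 1 (S * k) with h6 | h6
      · have := mul_nonneg hx (sub_nonneg.2 h6)
        positivity
      · have h7 : x * (1 - S * k) ≤ (k + S) * (1 - S * k) :=
          mul_le_mul_of_nonneg_right (by linarith) (by linarith)
        have h8 : (k + S) * (1 - S * k) = S * (1 - k ^ 2) + k * (1 - S ^ 2) := by ring
        rw [h8, hS] at h7
        rw [hS]
        have h9 : 0 ≤ k * k ^ 2 := by positivity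
        have h10 : 0 ≤ S * k ^ 2 := by positivity
        nlinarith
    have := mul_nonneg hk h5
    linarith

/-- For p ≥ 1 this is convexity, as a + b ≥ 2x. For p ≤ 1 convexity fails; the arithmetic-geometric
mean inequality takes its place, with `sq_le_of_bounds` and S^p ≤ S making up for the loss. -/
theorem two_mul_rpow_le {k S x a b p : ℝ} (hk : 0 ≤ k) (hS1 : 1 ≤ S) (hS : S ^ 2 = 1 + k ^ 2)
    (hx : 0 ≤ x) (ha : x + k ≤ a) (hb1 : S ≤ b) (hb2 : x - k ≤ b) (hp : 0 < p) :
    2 * x ^ p ≤ S * (a ^ p + b ^ p) := by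
  have ha0 : 0 ≤ a := by linarith
  have hb0 : 0 ≤ b := by linarith
  have hsum : 0 ≤ a ^ p + b ^ p := by positivity
  rcases le_total 1 p with h1 | h1
  · have h2 := (convexOn_rpow h1).2 (mem_Ici.2 ha0) (mem_Ici.2 hb0)
      (show (0 : ℝ) ≤ 1 / 2 by norm_num) (show (0 : ℝ) ≤ 1 / 2 by norm_num) (by norm_num)
    simp only [smul_eq_mul] at h2
    have h3 : x ^ p ≤ (1 / 2 * a + 1 / 2 * b) ^ p :=
      Real.rpow_le_rpow hx (by linarith) hp.le
    nlinarith
  · have h2 := sq_le_of_bounds hk hS1 hS hx ha hb1 hb2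
    have h3 : (x ^ 2) ^ (p / 2) ≤ (S ^ 2 * (a * b)) ^ (p / 2) :=
      Real.rpow_le_rpow (sq_nonneg x) h2 (by positivity)
    have hhalf : ∀ y : ℝ, 0 ≤ y → (y ^ 2) ^ (p / 2) = y ^ p := fun y hy => by
      rw [← Real.rpow_natCast, ← Real.rpow_mul hy]; congr 1; push_cast; ring
    rw [hhalf x hx, Real.mul_rpow (sq_nonneg S) (mul_nonneg ha0 hb0), hhalf S (by linarith),
      Real.mul_rpow ha0 hb0] at h3
    have h4 : S ^ p ≤ S := by
      simpa using Real.rpow_le_rpow_of_exponent_le hS1 h1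
    have hsq : ∀ y : ℝ, 0 ≤ y → (y ^ (p / 2)) ^ 2 = y ^ p := fun y hy => by
      rw [← Real.rpow_natCast, ← Real.rpow_mul hy]; congr 1; push_cast; ring
    have h5 : 2 * (a ^ (p / 2) * b ^ (p / 2)) ≤ a ^ p + b ^ p := by
      rw [← hsq a ha0, ← hsq b hb0]
      nlinarith [sq_nonneg (a ^ (p / 2) - b ^ (p / 2))]
    have h6 : S ^ p * (a ^ p + b ^ p) ≤ S * (a ^ p + b ^ p) :=
      mul_le_mul_of_nonneg_right h4 hsum
    have h7 : 0 ≤ S ^ p := Real.rpow_nonneg (by linarith) _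
    nlinarith [mul_le_mul_of_nonneg_left h5 h7]

/-- The weight of a slope in the energy of a crossing. -/
noncomputable def slopeWeight (x : ℝ) : ℝ := max 1 |x|

theorem one_le_slopeWeight (x : ℝ) : 1 ≤ slopeWeight x := le_max_left _ _

theorem abs_le_slopeWeight (x : ℝ) : |x| ≤ slopeWeight x := le_max_right _ _

theorem slopeWeight_neg (x : ℝ) : slopeWeight (-x) = slopeWeight x := by
  simp [slopeWeight]

/-- This is the pointwise form of the minimality of the right angle, for cosine `c` and sine `σ`.
For |x| ≤ 1 it only uses that weights are at least 1, and this range provides the quantitative gain.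
-/
theorem slopeWeight_sum_ge {c σ p : ℝ} (hσ : 0 < σ) (hcσ : c ^ 2 + σ ^ 2 = 1) (hp : 0 < p) (x : ℝ) :
    2 * slopeWeight x ^ p + (if |x| ≤ 1 then 2 * (σ ^ (-1 - p) - 1) else 0) ≤
      σ ^ (-1 - p) * (slopeWeight (c + σ * x) ^ p + slopeWeight (c - σ * x) ^ p) := by
  have hge : ∀ y, 1 ≤ slopeWeight y ^ p := fun y =>
    Real.one_le_rpow (one_le_slopeWeight y) hp.le
  have hσp : 0 < σ ^ (-1 - p) := Real.rpow_pos_of_pos hσ _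
  split_ifs with hx
  · have h1 : slopeWeight x = 1 := max_eq_left hx
    rw [h1, Real.one_rpow]
    nlinarith [hge (c + σ * x), hge (c - σ * x)]
  · push Not at hx
    rw [add_zero]
    wlog hc : 0 ≤ c generalizing c
    · have := this (c := -c) (by rwa [neg_sq]) (by linarith)
      rw [show -c + σ * x = -(c - σ * x) by ring, show -c - σ * x = -(c + σ * x) by ring,
        slopeWeight_neg, slopeWeight_neg] at this
      linarith
    wlog hx0 : 0 ≤ x generalizing x
    · have := this (-x) (by rwa [abs_neg]) (by linarith)
      rw [slopeWeight_neg, mul_neg, sub_neg_eq_add, ← sub_eq_add_neg] at this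
      linarith
    rw [abs_of_nonneg hx0] at hx
    have hxw : slopeWeight x = x := by
      rw [slopeWeight, abs_of_nonneg hx0]; exact max_eq_right hx.le
    rw [hxw]
    have hσ1 : σ ≤ 1 := by nlinarith
    -- Dividing by the sine produces the cotangent `c / σ` and the cosecant `1 / σ`, which satisfy
    -- S² = 1 + k².
    have key := two_mul_rpow_le (k := c / σ) (S := 1 / σ) (x := x)
      (a := slopeWeight (c + σ * x) / σ) (b := slopeWeight (c - σ * x) / σ) (p := p)
      (by positivity) (by rw [le_div_iff₀ hσ]; linarith)
      (by field_simp; linarith) hx0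
      (by
        have := (le_abs_self _).trans (abs_le_slopeWeight (c + σ * x))
        rw [le_div_iff₀ hσ, add_mul, div_mul_cancel₀ _ hσ.ne']
        linarith)
      (div_le_div_of_nonneg_right (one_le_slopeWeight _) hσ.le)
      (by
        have := (neg_le_abs _).trans (abs_le_slopeWeight (c - σ * x))
        rw [le_div_iff₀ hσ, sub_mul, div_mul_cancel₀ _ hσ.ne']
        linarith) hp
    have hw : ∀ y, 0 ≤ slopeWeight y := fun y => zero_le_one.trans (one_le_slopeWeight y)
    rw [Real.div_rpow (hw _) hσ.le, Real.div_rpow (hw _) hσ.le] at key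
    refine key.trans (le_of_eq ?_)
    have e : σ ^ (-1 - p) = σ⁻¹ * (σ ^ p)⁻¹ := by
      rw [show -1 - p = -1 + -p by ring, Real.rpow_add hσ, Real.rpow_neg_one, Real.rpow_neg hσ.le]
    rw [e]
    field_simp

/-- The radial density of the energy of a crossing. -/
noncomputable def shellDensity (q δ η : ℝ) : ℝ → ℝ≥0∞ :=
  {s : ℝ | δ ≤ |s| ∧ |s| < η}.indicator fun s => ENNReal.ofReal (|s| ^ (1 - q))

theorem measurableSet_shell (δ η : ℝ) : MeasurableSet {s : ℝ | δ ≤ |s| ∧ |s| < η} := by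
  have h1 : MeasurableSet {s : ℝ | δ ≤ |s|} := (isClosed_le continuous_const (by fun_prop)).measurableSet
  have h2 : MeasurableSet {s : ℝ | |s| < η} := (isOpen_lt (by fun_prop) continuous_const).measurableSet
  exact h1.inter h2

theorem measurable_shellDensity (q δ η : ℝ) : Measurable (shellDensity q δ η) :=
  Measurable.indicator (by fun_prop) (measurableSet_shell δ η)

/-- The angular density of the energy of a crossing. -/
noncomputable def slopeDensity (q c x : ℝ) : ℝ :=
  slopeWeight x ^ (q - 2) * (2 * √(1 - c ^ 2) / (1 + x ^ 2 - 2 * x * c)) ^ q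

theorem measurable_slopeWeight : Measurable slopeWeight := by unfold slopeWeight; fun_prop

theorem measurable_slopeDensity (q c : ℝ) : Measurable (slopeDensity q c) := by
  unfold slopeDensity
  have := measurable_slopeWeight
  fun_prop

/-- The substitution r = m|s| turns the density |s|^(1-q) ds into m^(q-2) times itself. -/
theorem lintegral_shell_scaled (q δ η : ℝ) {m : ℝ} (hm : 0 < m) :
    ∫⁻ s, {s : ℝ | δ ≤ |s| * m ∧ |s| * m < η}.indicator
      (fun s => ENNReal.ofReal (|s| ^ (1 - q))) s =
    ENNReal.ofReal (m ^ (q - 2)) * ∫⁻ s, shellDensity q δ η s := by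
  have hms : Measurable fun s => shellDensity q δ η (m * s) :=
    (measurable_shellDensity q δ η).comp (measurable_const_mul m)
  rw [lintegral_comp_mul (measurable_shellDensity q δ η) hm.ne', ← mul_assoc,
    ← ENNReal.ofReal_mul (by positivity), abs_of_pos hm, ← lintegral_const_mul _ hms]
  refine lintegral_congr fun s => ?_
  have hiff : (m * s) ∈ {s : ℝ | δ ≤ |s| ∧ |s| < η} ↔ s ∈ {s : ℝ | δ ≤ |s| * m ∧ |s| * m < η} := by
    simp only [mem_ofPred_eq, abs_mul, abs_of_pos hm, mul_comm m]
  unfold shellDensity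
  by_cases h : s ∈ {s : ℝ | δ ≤ |s| * m ∧ |s| * m < η}
  · rw [indicator_of_mem h, indicator_of_mem (hiff.2 h), ← ENNReal.ofReal_mul (by positivity)]
    congr 1
    rw [abs_mul, abs_of_pos hm, Real.mul_rpow hm.le (abs_nonneg s), ← mul_assoc]
    have : m ^ (q - 2) * m * m ^ (1 - q) = 1 := by
      nth_rewrite 2 [← Real.rpow_one m]
      rw [← Real.rpow_add hm, ← Real.rpow_add hm]
      ring_nf
      exact Real.rpow_zero m
    rw [this, one_mul]
  · rw [indicator_of_notMem h, indicator_of_notMem fun h' => h (hiff.1 h'), mul_zero]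

theorem cross_quadratic_pos {c : ℝ} (hc : c ^ 2 < 1) (x : ℝ) : 0 < 1 + x ^ 2 - 2 * x * c := by
  nlinarith [sq_nonneg (x - c)]

/-- Substitute t = s·x. The kernel to the power q is homogeneous of degree -q, the Jacobian is |s|,
and max(|s|,|t|) = |s|·max(1,|x|), so radius and slope separate after rescaling. -/
theorem crossEnergy_eq_slope {q δ η c : ℝ} (hc : c ^ 2 < 1) :
    crossEnergy q δ η c =
      (∫⁻ s, shellDensity q δ η s) * ∫⁻ x, ENNReal.ofReal (slopeDensity q c x) := by
  set σ := √(1 - c ^ 2) with hσ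
  set F : ℝ × ℝ → ℝ≥0∞ := (squareAnnulus δ η).indicator fun z => ENNReal.ofReal
    ((2 * (|z.1| * σ) / (z.1 ^ 2 + z.2 ^ 2 - 2 * (z.1 * z.2) * c)) ^ q) with hF
  have hFm : Measurable F := Measurable.indicator (by fun_prop) (measurableSet_squareAnnulus δ η)
  set R : ℝ → ℝ → ℝ≥0∞ := fun s t => {s : ℝ | δ ≤ |s| * slopeWeight t ∧ |s| * slopeWeight t < η}.indicator
      (fun s => ENNReal.ofReal (|s| ^ (1 - q))) s with hR
  set P : ℝ → ℝ := fun t => 2 * σ / (1 + t ^ 2 - 2 * t * c) with hP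
  have hP0 : ∀ t, 0 ≤ P t := fun t =>
    div_nonneg (mul_nonneg zero_le_two (Real.sqrt_nonneg _)) (cross_quadratic_pos hc t).le
  have hRm : Measurable fun z : ℝ × ℝ => R z.1 z.2 := by
    have hsw := measurable_slopeWeight
    have h1 : MeasurableSet {z : ℝ × ℝ | δ ≤ |z.1| * slopeWeight z.2 ∧ |z.1| * slopeWeight z.2 < η} := by
      have h2 : Measurable fun z : ℝ × ℝ => |z.1| * slopeWeight z.2 := by fun_prop
      exact (measurableSet_le measurable_const h2).inter (measurableSet_lt h2 measurable_const)
    exact Measurable.indicator (f := fun z : ℝ × ℝ => ENNReal.ofReal (|z.1| ^ (1 - q)))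
      (by fun_prop) h1
  have hin : ∀ s : ℝ, s ≠ 0 → ∀ t, ENNReal.ofReal |s| * F (s, s * t) =
      ENNReal.ofReal (P t ^ q) * R s t := by
    intro s hs t
    have hs' : 0 < |s| := abs_pos.2 hs
    have hiff : (s, s * t) ∈ squareAnnulus δ η ↔
        s ∈ {s : ℝ | δ ≤ |s| * slopeWeight t ∧ |s| * slopeWeight t < η} := by
      simp only [squareAnnulus, mem_ofPred_eq, slopeWeight, abs_mul, mul_max_of_nonneg _ _ hs'.le,
        mul_one, max_lt_iff, le_max_iff, not_and_or, not_lt]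
      tauto
    by_cases h : (s, s * t) ∈ squareAnnulus δ η
    · simp only [hF, hR]
      rw [indicator_of_mem h, indicator_of_mem (hiff.1 h), ← ENNReal.ofReal_mul hs'.le,
        ← ENNReal.ofReal_mul (Real.rpow_nonneg (hP0 t) _)]
      congr 1
      have e : 2 * (|s| * σ) / (s ^ 2 + (s * t) ^ 2 - 2 * (s * (s * t)) * c) = |s|⁻¹ * P t := by
        have h1 := (cross_quadratic_pos hc t).ne'
        have h2 : s ^ 2 + (s * t) ^ 2 - 2 * (s * (s * t)) * c =
            |s| ^ 2 * (1 + t ^ 2 - 2 * t * c) := by rw [sq_abs]; ring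
        rw [h2, hP]
        field_simp
      rw [e, Real.mul_rpow (inv_nonneg.2 hs'.le) (hP0 t), Real.inv_rpow hs'.le,
        Real.rpow_sub hs', Real.rpow_one]
      field_simp
    · simp only [hF, hR]
      rw [indicator_of_notMem h, indicator_of_notMem fun h' => h (hiff.2 h'), mul_zero, mul_zero]
  have hcalc : crossEnergy q δ η c = ∫⁻ s, ∫⁻ t, ENNReal.ofReal (P t ^ q) * R s t := by
    unfold crossEnergy
    rw [← lintegral_indicator (measurableSet_squareAnnulus δ η), Measure.volume_eq_prod,
      lintegral_prod _ hFm.aemeasurable]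
    refine lintegral_congr_ae ?_
    have h0 : ∀ᵐ s : ℝ, s ≠ 0 := by
      rw [ae_iff]; simp
    filter_upwards [h0] with s hs
    have hFs : Measurable fun t => F (s, t) := hFm.comp measurable_prodMk_left
    have hFs' : Measurable fun t => F (s, s * t) := hFs.comp (measurable_const_mul s)
    rw [lintegral_comp_mul hFs hs, ← lintegral_const_mul _ hFs']
    exact lintegral_congr (hin s hs)
  rw [hcalc, lintegral_lintegral_swap]
  · have : ∀ t, ∫⁻ s, ENNReal.ofReal (P t ^ q) * R s t =
        ENNReal.ofReal (slopeDensity q c t) * ∫⁻ s, shellDensity q δ η s := by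
      intro t
      have hRt : Measurable fun s => R s t := hRm.comp (measurable_prodMk_right (y := t))
      rw [lintegral_const_mul _ hRt]
      have h1 := lintegral_shell_scaled q δ η (zero_lt_one.trans_le (one_le_slopeWeight t))
      rw [hR, h1, ← mul_assoc, ← ENNReal.ofReal_mul (Real.rpow_nonneg (hP0 t) _), slopeDensity,
        mul_comm (P t ^ q)]
    rw [lintegral_congr this, lintegral_mul_const _ (measurable_slopeDensity q c).ennreal_ofReal,
      mul_comm]
  · refine Measurable.aemeasurable ?_
    refine Measurable.mul ?_ hRm
    have : Measurable P := by simp only [hP]; fun_prop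
    have h2 : Measurable fun z : ℝ × ℝ => P z.2 := this.comp measurable_snd
    exact (h2.pow_const q).ennreal_ofReal

/-- The substitution x ↦ c + σx completes the square: 1 + x² - 2xc becomes σ²(1 + x²). All angles
are then compared against the same even weight. -/
theorem lintegral_slopeDensity_eq {q c σ : ℝ} (hσ : 0 < σ) (hcσ : c ^ 2 + σ ^ 2 = 1) :
    ∫⁻ x, ENNReal.ofReal (slopeDensity q c x) = ∫⁻ x, ENNReal.ofReal
      (σ ^ (1 - q) * slopeWeight (c + σ * x) ^ (q - 2) * (2 / (1 + x ^ 2)) ^ q) := by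
  have hs : √(1 - c ^ 2) = σ := by
    rw [show 1 - c ^ 2 = σ ^ 2 by linarith]; exact Real.sqrt_sq hσ.le
  have hm := (measurable_slopeDensity q c).ennreal_ofReal
  have hmc : Measurable fun x => ENNReal.ofReal (slopeDensity q c (c + x)) :=
    hm.comp (measurable_const_add c)
  have hmc' : Measurable fun x => ENNReal.ofReal (slopeDensity q c (c + σ * x)) :=
    hmc.comp (measurable_const_mul σ)
  rw [← lintegral_add_left_eq_self (μ := volume) _ c, lintegral_comp_mul hmc hσ.ne',
    abs_of_pos hσ, ← lintegral_const_mul _ hmc']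
  refine lintegral_congr fun x => ?_
  rw [← ENNReal.ofReal_mul hσ.le, slopeDensity, hs]
  congr 1
  have e : 2 * σ / (1 + (c + σ * x) ^ 2 - 2 * (c + σ * x) * c) = σ⁻¹ * (2 / (1 + x ^ 2)) := by
    have h1 : 1 + (c + σ * x) ^ 2 - 2 * (c + σ * x) * c = σ ^ 2 * (1 + x ^ 2) := by
      linear_combination (-1 : ℝ) * hcσ
    have h2 : 1 + x ^ 2 ≠ 0 := by positivity
    rw [h1]; field_simp
  rw [e, Real.mul_rpow (inv_nonneg.2 hσ.le) (by positivity), Real.inv_rpow hσ.le,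
    Real.rpow_sub hσ, Real.rpow_one]
  field_simp

theorem lintegral_neg_real {f : ℝ → ℝ≥0∞} (hf : Measurable f) : ∫⁻ x, f (-x) = ∫⁻ x, f x := by
  rw [lintegral_comp_mul hf (a := -1) (by norm_num)]
  simp

/-- Averaging the integrand over x and -x reduces the claim to `slopeWeight_sum_ge`. The gain is
collected on [-1,1], where the weight (2/(1 + x²))^q is at least 1. -/
theorem lintegral_slopeDensity_ge {q c σ : ℝ} (hq : 2 < q) (hσ : 0 < σ)
    (hcσ : c ^ 2 + σ ^ 2 = 1) :
    (∫⁻ x, ENNReal.ofReal (slopeDensity q 0 x)) + ENNReal.ofReal (σ ^ (1 - q) - 1) ≤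
      ∫⁻ x, ENNReal.ofReal (slopeDensity q c x) := by
  have hσ1 : σ ≤ 1 := by nlinarith [sq_nonneg c]
  have hσq : 1 ≤ σ ^ (1 - q) := Real.one_le_rpow_of_pos_of_le_one_of_nonpos hσ hσ1 (by linarith)
  set Φ : ℝ → ℝ := fun x =>
    σ ^ (1 - q) * slopeWeight (c + σ * x) ^ (q - 2) * (2 / (1 + x ^ 2)) ^ q with hΦ
  have hsw := measurable_slopeWeight
  have hΦm : Measurable Φ := by simp only [hΦ]; fun_prop
  have hw0 : ∀ y, 0 ≤ slopeWeight y := fun y => zero_le_one.trans (one_le_slopeWeight y)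
  have hΦ0 : ∀ x, 0 ≤ Φ x := fun x => by
    have := Real.rpow_nonneg (hw0 (c + σ * x)) (q - 2)
    simp only [hΦ]; positivity
  have hsymm : ∫⁻ x, ENNReal.ofReal (Φ x) = ∫⁻ x, ENNReal.ofReal ((Φ x + Φ (-x)) / 2) := by
    have h1 : ∫⁻ x, ENNReal.ofReal (Φ (-x) / 2) = ∫⁻ x, ENNReal.ofReal (Φ x / 2) :=
      lintegral_neg_real (f := fun x => ENNReal.ofReal (Φ x / 2)) (by fun_prop)
    calc ∫⁻ x, ENNReal.ofReal (Φ x) = ∫⁻ x, (ENNReal.ofReal (Φ x / 2) + ENNReal.ofReal (Φ x / 2)) :=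
          lintegral_congr fun x => by
            rw [← ENNReal.ofReal_add (by linarith [hΦ0 x]) (by linarith [hΦ0 x]), add_halves]
      _ = (∫⁻ x, ENNReal.ofReal (Φ x / 2)) + ∫⁻ x, ENNReal.ofReal (Φ (-x) / 2) := by
          rw [lintegral_add_left (by fun_prop), h1]
      _ = _ := by
          rw [← lintegral_add_left (by fun_prop)]
          refine lintegral_congr fun x => ?_
          rw [← ENNReal.ofReal_add (by linarith [hΦ0 x]) (by linarith [hΦ0 (-x)])]
          congr 1; ring
  have h0 : ∀ x, slopeDensity q 0 x = slopeWeight x ^ (q - 2) * (2 / (1 + x ^ 2)) ^ q := fun x => by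
    simp [slopeDensity]
  rw [lintegral_slopeDensity_eq hσ hcσ, hsymm]
  have hvol : ENNReal.ofReal (σ ^ (1 - q) - 1) ≤
      ∫⁻ x, (Icc (-1 : ℝ) 1).indicator (fun _ => ENNReal.ofReal (σ ^ (1 - q) - 1)) x := by
    rw [lintegral_indicator_const measurableSet_Icc, Real.volume_Icc]
    refine le_mul_of_one_le_right' ?_
    rw [show (1 : ℝ≥0∞) = ENNReal.ofReal 1 by simp]
    exact ENNReal.ofReal_le_ofReal (by norm_num)
  refine (add_le_add_right hvol _).trans ?_
  rw [← lintegral_add_left (measurable_slopeDensity q 0).ennreal_ofReal]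
  refine lintegral_mono fun x => ?_
  have key := slopeWeight_sum_ge hσ hcσ (p := q - 2) (by linarith) x
  rw [show -1 - (q - 2) = 1 - q by ring] at key
  have hg : 0 ≤ (2 / (1 + x ^ 2)) ^ q := by positivity
  have key2 := mul_le_mul_of_nonneg_right key hg
  have e : (Φ x + Φ (-x)) / 2 = σ ^ (1 - q) * (slopeWeight (c + σ * x) ^ (q - 2) +
      slopeWeight (c - σ * x) ^ (q - 2)) * (2 / (1 + x ^ 2)) ^ q / 2 := by
    simp only [hΦ, neg_sq, mul_neg, ← sub_eq_add_neg]; ring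
  rw [e]
  by_cases hx : |x| ≤ 1
  · rw [indicator_of_mem (by rwa [mem_Icc, ← abs_le]), ← ENNReal.ofReal_add
      (by rw [h0]; exact mul_nonneg (Real.rpow_nonneg (hw0 x) _) hg) (by linarith)]
    refine ENNReal.ofReal_le_ofReal ?_
    rw [if_pos hx] at key2
    have h1 : 1 ≤ (2 / (1 + x ^ 2)) ^ q := by
      refine Real.one_le_rpow ?_ (by linarith)
      rw [le_div_iff₀ (by positivity)]
      have := (sq_le_one_iff_abs_le_one x).2 hx
      linarith
    rw [h0]
    nlinarith
  · rw [indicator_of_notMem (by rwa [mem_Icc, ← abs_le]), add_zero]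
    refine ENNReal.ofReal_le_ofReal ?_
    rw [if_neg hx, add_zero] at key2
    rw [h0]
    linarith

theorem lintegral_slopeDensity_zero_lt_top {q : ℝ} (hq : 2 < q) :
    ∫⁻ x, ENNReal.ofReal (slopeDensity q 0 x) < ∞ := by
  have hint : Integrable fun x : ℝ => (2 : ℝ) ^ q * (1 + x ^ 2)⁻¹ :=
    integrable_inv_one_add_sq.const_mul _
  refine lt_of_le_of_lt (lintegral_mono fun x => ENNReal.ofReal_le_ofReal ?_)
    hint.lintegral_lt_top
  have h1 : 0 < 1 + x ^ 2 := by positivity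
  have h2 : slopeWeight x ≤ 1 + x ^ 2 := by
    refine max_le (by nlinarith [sq_nonneg x]) ?_
    nlinarith [sq_nonneg (|x| - 1), sq_abs x, abs_nonneg x]
  have h3 : slopeWeight x ^ (q - 2) ≤ (1 + x ^ 2) ^ (q - 2) :=
    Real.rpow_le_rpow (zero_le_one.trans (one_le_slopeWeight x)) h2 (by linarith)
  have e : slopeDensity q 0 x = slopeWeight x ^ (q - 2) * (2 / (1 + x ^ 2)) ^ q := by
    simp [slopeDensity]
  rw [e, Real.div_rpow zero_le_two h1.le]
  calc slopeWeight x ^ (q - 2) * (2 ^ q / (1 + x ^ 2) ^ q)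
      ≤ (1 + x ^ 2) ^ (q - 2) * (2 ^ q / (1 + x ^ 2) ^ q) := by gcongr
    _ = 2 ^ q * ((1 + x ^ 2) ^ (2 : ℝ))⁻¹ := by
        rw [Real.rpow_sub h1]; field_simp
    _ ≤ 2 ^ q * (1 + x ^ 2)⁻¹ := by
        gcongr
        rw [Real.rpow_two]
        nlinarith [sq_nonneg x]

theorem lintegral_shellDensity_lt_top {q δ η : ℝ} (hq : 2 < q) (hδ : 0 < δ) :
    ∫⁻ s, shellDensity q δ η s < ∞ := by
  unfold shellDensity
  rw [lintegral_indicator (measurableSet_shell δ η)]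
  calc ∫⁻ s in {s : ℝ | δ ≤ |s| ∧ |s| < η}, ENNReal.ofReal (|s| ^ (1 - q))
      ≤ ∫⁻ _ in {s : ℝ | δ ≤ |s| ∧ |s| < η}, ENNReal.ofReal (δ ^ (1 - q)) := by
        refine setLIntegral_mono' (measurableSet_shell δ η) fun s hs => ENNReal.ofReal_le_ofReal ?_
        exact Real.rpow_le_rpow_of_nonpos hδ hs.1 (by linarith)
    _ = ENNReal.ofReal (δ ^ (1 - q)) * volume {s : ℝ | δ ≤ |s| ∧ |s| < η} := setLIntegral_const _ _
    _ < ∞ := by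
        refine ENNReal.mul_lt_top ENNReal.ofReal_lt_top ?_
        refine lt_of_le_of_lt (measure_mono (t := Icc (-η) η) fun s hs => ?_)
          (by rw [Real.volume_Icc]; exact ENNReal.ofReal_lt_top)
        exact ⟨by linarith [(abs_lt.1 hs.2).1], (abs_lt.1 hs.2).2.le⟩

/-- The part [δ, 2δ) alone already grows like δ^(2-q); it fits below η because δ ≤ η/2. This
divergence is what penalizes oblique crossings. -/
theorem lintegral_shellDensity_ge {q δ η : ℝ} (hq : 2 < q) (hδ : 0 < δ) (hη : δ ≤ η / 2) :
    ENNReal.ofReal (2 ^ (1 - q) * δ ^ (2 - q)) ≤ ∫⁻ s, shellDensity q δ η s := by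
  unfold shellDensity
  rw [lintegral_indicator (measurableSet_shell δ η)]
  have hsub : Ico δ (2 * δ) ⊆ {s : ℝ | δ ≤ |s| ∧ |s| < η} := fun s hs => by
    have : |s| = s := abs_of_pos (hδ.trans_le hs.1)
    simp only [mem_ofPred_eq, this]
    exact ⟨hs.1, by linarith [hs.2]⟩
  calc ENNReal.ofReal (2 ^ (1 - q) * δ ^ (2 - q))
      = ENNReal.ofReal ((2 * δ) ^ (1 - q)) * volume (Ico δ (2 * δ)) := by
        rw [Real.volume_Ico, ← ENNReal.ofReal_mul (by positivity)]
        congr 1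
        rw [Real.mul_rpow zero_le_two hδ.le, show 2 - q = (1 - q) + 1 by ring, Real.rpow_add hδ,
          Real.rpow_one]
        ring
    _ = ∫⁻ _ in Ico δ (2 * δ), ENNReal.ofReal ((2 * δ) ^ (1 - q)) := (setLIntegral_const _ _).symm
    _ ≤ ∫⁻ s in Ico δ (2 * δ), ENNReal.ofReal (|s| ^ (1 - q)) := by
        refine setLIntegral_mono' measurableSet_Ico fun s hs => ENNReal.ofReal_le_ofReal ?_
        have h1 : 0 < s := hδ.trans_le hs.1
        rw [abs_of_pos h1]
        exact Real.rpow_le_rpow_of_nonpos h1 hs.2.le (by linarith)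
    _ ≤ _ := lintegral_mono_set hsub

theorem crossEnergy_zero_lt_top {q δ η : ℝ} (hq : 2 < q) (hδ : 0 < δ) :
    crossEnergy q δ η 0 < ∞ := by
  rw [crossEnergy_eq_slope (by norm_num)]
  exact ENNReal.mul_lt_top (lintegral_shellDensity_lt_top hq hδ)
    (lintegral_slopeDensity_zero_lt_top hq)

/-- The right angle is the unique minimizer, with an excess weighted by the diverging radial factor.
-/
theorem crossEnergy_ge {q δ η c : ℝ} (hq : 2 < q) (hc : c ^ 2 < 1) :
    crossEnergy q δ η 0 +
        (∫⁻ s, shellDensity q δ η s) * ENNReal.ofReal (√(1 - c ^ 2) ^ (1 - q) - 1) ≤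
      crossEnergy q δ η c := by
  rw [crossEnergy_eq_slope hc, crossEnergy_eq_slope (by norm_num), ← mul_add]
  refine mul_le_mul_right (lintegral_slopeDensity_ge hq (Real.sqrt_pos.2 (by linarith)) ?_) _
  rw [Real.sq_sqrt (by linarith)]; ring


/-! ### Hölder continuity from a tangent-point type energy -/

theorem enorm_average_sub_average_le {g : ℝ → ℂ} (hg : Continuous g) {a b a' b' D : ℝ}
    (hab : a < b) (hab' : a' < b')
    (h : ∫⁻ z in Icc a b ×ˢ Icc a' b', ‖g z.1 - g z.2‖ₑ ≤ ENNReal.ofReal (D * ((b - a) * (b' - a'))))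
    (hD : 0 ≤ D) :
    ‖((b - a)⁻¹ • ∫ s in Icc a b, g s) - (b' - a')⁻¹ • ∫ s in Icc a' b', g s‖ ≤ D := by
  have hL : 0 < b - a := sub_pos.2 hab
  have hL' : 0 < b' - a' := sub_pos.2 hab'
  have hint : Integrable (fun z : ℝ × ℝ => g z.1)
      ((volume.restrict (Icc a b)).prod (volume.restrict (Icc a' b'))) := by
    rw [Measure.prod_restrict]
    exact ContinuousOn.integrableOn_compact (isCompact_Icc.prod isCompact_Icc)
      (Continuous.continuousOn (by fun_prop))
  have hint' : Integrable (fun z : ℝ × ℝ => g z.2)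
      ((volume.restrict (Icc a b)).prod (volume.restrict (Icc a' b'))) := by
    rw [Measure.prod_restrict]
    exact ContinuousOn.integrableOn_compact (isCompact_Icc.prod isCompact_Icc)
      (Continuous.continuousOn (by fun_prop))
  have e := integral_sub hint hint'
  rw [integral_fun_fst, integral_fun_snd] at e
  have v1 : (volume.restrict (Icc a b)).real univ = b - a := by
    simp [measureReal_def, hab.le]
  have v2 : (volume.restrict (Icc a' b')).real univ = b' - a' := by
    simp [measureReal_def, hab'.le]
  rw [v1, v2] at e
  have h1 : ‖((b' - a') • ∫ s in Icc a b, g s) - (b - a) • ∫ s in Icc a' b', g s‖ ≤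
      D * ((b - a) * (b' - a')) := by
    rw [← e]
    have h2 := enorm_integral_le_lintegral_enorm (μ := (volume.restrict (Icc a b)).prod
      (volume.restrict (Icc a' b'))) fun z : ℝ × ℝ => g z.1 - g z.2
    rw [← ENNReal.ofReal_le_ofReal_iff (by positivity), ofReal_norm]
    refine h2.trans ?_
    rw [Measure.prod_restrict, ← Measure.volume_eq_prod]
    exact h
  have e2 : ((b - a)⁻¹ • ∫ s in Icc a b, g s) - (b' - a')⁻¹ • ∫ s in Icc a' b', g s =
      ((b - a) * (b' - a'))⁻¹ • (((b' - a') • ∫ s in Icc a b, g s) -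
        (b - a) • ∫ s in Icc a' b', g s) := by
    rw [smul_sub, smul_smul, smul_smul]
    congr 2 <;> field_simp
  rw [e2, norm_smul, Real.norm_of_nonneg (by positivity), inv_mul_le_iff₀ (by positivity)]
  linarith

/-- The difference of the means over an interval and one of its halves. -/
theorem norm_average_half_le {g : ℝ → ℂ} (hg : Continuous g) {q M : ℝ} (hq : 2 < q) (hM : 0 < M)
    {a b a' b' : ℝ} (hab : a < b) (hsub : Icc a' b' ⊆ Icc a b) (hhalf : b' - a' = (b - a) / 2)
    (hE : ∫⁻ z in Icc a b ×ˢ Icc a b,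
      ENNReal.ofReal ((‖g z.1 - g z.2‖ / |z.1 - z.2|) ^ q) ≤ ENNReal.ofReal M) :
    ‖((b - a)⁻¹ • ∫ s in Icc a b, g s) - (b' - a')⁻¹ • ∫ s in Icc a' b', g s‖ ≤
      3 * M ^ (1 / q) * (b - a) ^ (1 - 2 / q) := by
  set L := b - a with hL
  have hL0 : 0 < L := sub_pos.2 hab
  have hab' : a' < b' := by linarith
  -- The threshold for which the low and high parts of the difference quotient balance: lam^(1-q)·M
  -- = lam·L².
  set lam := M ^ (1 / q) * L ^ (-2 / q) with hlam
  have hlam0 : 0 < lam := by positivity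
  have e1 : 3 * M ^ (1 / q) * L ^ (1 - 2 / q) = 3 * (lam * L) := by
    rw [hlam, show 1 - 2 / q = -2 / q + 1 by ring, Real.rpow_add hL0, Real.rpow_one]; ring
  rw [e1]
  have e2 : lam ^ (1 - q) * M = lam * L ^ 2 := by
    have : lam ^ q = M * L ^ (-2 : ℝ) := by
      rw [hlam, Real.mul_rpow (by positivity) (by positivity), ← Real.rpow_mul hM.le,
        ← Real.rpow_mul hL0.le]
      congr 1
      · rw [one_div_mul_cancel (by linarith), Real.rpow_one]
      · congr 1; field_simp
    rw [Real.rpow_sub hlam0, Real.rpow_one, this, Real.rpow_neg hL0.le, Real.rpow_two]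
    field_simp
  refine enorm_average_sub_average_le hg hab hab' ?_ (by positivity)
  have hpt : ∀ z ∈ Icc a b ×ˢ Icc a' b', ‖g z.1 - g z.2‖ₑ ≤ ENNReal.ofReal (L * lam) +
      ENNReal.ofReal (L * lam ^ (1 - q)) *
        ENNReal.ofReal ((‖g z.1 - g z.2‖ / |z.1 - z.2|) ^ q) := by
    intro z hz
    have hz2 := hsub hz.2
    have hd : |z.1 - z.2| ≤ L := abs_le.2 ⟨by linarith [hz.1.1, hz2.2], by linarith [hz.1.2, hz2.1]⟩
    rw [← ENNReal.ofReal_mul (by positivity), ← ENNReal.ofReal_add (by positivity) (by positivity),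
      ← ofReal_norm]
    refine ENNReal.ofReal_le_ofReal ?_
    set n := ‖g z.1 - g z.2‖ with hn
    set k := n / |z.1 - z.2| with hk
    have hk0 : 0 ≤ k := by positivity
    have hnk : n ≤ L * k := by
      rcases eq_or_ne z.1 z.2 with he | hne
      · rw [hn, he, sub_self, norm_zero]; positivity
      · have : n = |z.1 - z.2| * k := by
          rw [hk, mul_div_cancel₀ _ (abs_pos.2 (sub_ne_zero.2 hne)).ne']
        rw [this]; gcongr
    -- Truncation at level `lam`: above the threshold, k = k^(1-q)·k^q ≤ lam^(1-q)·k^q because 1 - q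
    -- is negative. This plays the role of Hölder's inequality.
    have hkl : k ≤ lam + lam ^ (1 - q) * k ^ q := by
      rcases le_total k lam with h | h
      · have : 0 ≤ lam ^ (1 - q) * k ^ q := by positivity
        linarith
      · have hk1 : 0 < k := hlam0.trans_le h
        have h2 : k ^ (1 - q) ≤ lam ^ (1 - q) :=
          Real.rpow_le_rpow_of_nonpos hlam0 h (by linarith)
        have h3 : k = k ^ (1 - q) * k ^ q := by
          rw [← Real.rpow_add hk1]; simp
        have h4 : k ^ (1 - q) * k ^ q ≤ lam ^ (1 - q) * k ^ q := by gcongr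
        linarith
    nlinarith
  have hm : Measurable fun z : ℝ × ℝ =>
      ENNReal.ofReal ((‖g z.1 - g z.2‖ / |z.1 - z.2|) ^ q) := by
    have := hg.measurable
    fun_prop
  calc ∫⁻ z in Icc a b ×ˢ Icc a' b', ‖g z.1 - g z.2‖ₑ
      ≤ ∫⁻ z in Icc a b ×ˢ Icc a' b', (ENNReal.ofReal (L * lam) +
        ENNReal.ofReal (L * lam ^ (1 - q)) *
          ENNReal.ofReal ((‖g z.1 - g z.2‖ / |z.1 - z.2|) ^ q)) :=
        setLIntegral_mono' (measurableSet_Icc.prod measurableSet_Icc) hpt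
    _ = ENNReal.ofReal (L * lam) * volume (Icc a b ×ˢ Icc a' b') +
        ENNReal.ofReal (L * lam ^ (1 - q)) * ∫⁻ z in Icc a b ×ˢ Icc a' b',
          ENNReal.ofReal ((‖g z.1 - g z.2‖ / |z.1 - z.2|) ^ q) := by
        rw [lintegral_add_left measurable_const, setLIntegral_const, lintegral_const_mul _ hm]
    _ ≤ ENNReal.ofReal (L * lam) * ENNReal.ofReal (L * (L / 2)) +
        ENNReal.ofReal (L * lam ^ (1 - q)) * ENNReal.ofReal M := by
        gcongr
        · rw [Measure.volume_eq_prod, Measure.prod_prod, Real.volume_Icc, Real.volume_Icc, hhalf,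
            ← ENNReal.ofReal_mul hL0.le]
        · exact (lintegral_mono_set (prod_mono_right hsub)).trans hE
    _ = ENNReal.ofReal (3 * (lam * L) * (L * (b' - a'))) := by
        rw [← ENNReal.ofReal_mul (by positivity), ← ENNReal.ofReal_mul (by positivity),
          ← ENNReal.ofReal_add (by positivity) (by positivity), hhalf, mul_assoc L (lam ^ (1 - q)), e2]
        congr 1; ring

/-- The averages over nested halved intervals shrinking to `c` are telescoped. Their increments form
a geometric series of ratio (1/2)^(1-2/q), which is less than 1 because q > 2. -/
theorem norm_average_sub_endpoint_le {g : ℝ → ℂ} (hg : Continuous g) {q M : ℝ} (hq : 2 < q)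
    (hM : 0 < M) {a b : ℝ} (hab : a < b)
    (hE : ∫⁻ z in Icc a b ×ˢ Icc a b,
      ENNReal.ofReal ((‖g z.1 - g z.2‖ / |z.1 - z.2|) ^ q) ≤ ENNReal.ofReal M)
    {l r : ℕ → ℝ} (hl : ∀ n, l n ≤ l (n + 1)) (hr : ∀ n, r (n + 1) ≤ r n)
    (hl0 : l 0 = a) (hr0 : r 0 = b) (hlr : ∀ n, r n - l n = (b - a) * (1 / 2) ^ n) {c : ℝ}
    (hc : ∀ n, c ∈ Icc (l n) (r n)) :
    ‖((b - a)⁻¹ • ∫ s in Icc a b, g s) - g c‖ ≤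
      3 * M ^ (1 / q) / (1 - (1 / 2) ^ (1 - 2 / q)) * (b - a) ^ (1 - 2 / q) := by
  have hL0 : 0 < b - a := sub_pos.2 hab
  set α := 1 - 2 / q with hα
  have hα0 : 0 < α := by
    rw [hα, sub_pos, div_lt_one (by linarith)]; exact hq
  set A : ℕ → ℂ := fun n => (r n - l n)⁻¹ • ∫ s in Icc (l n) (r n), g s with hA
  have hlr0 : ∀ n, 0 < r n - l n := fun n => by rw [hlr]; positivity
  have hsub : ∀ n, Icc (l n) (r n) ⊆ Icc a b := by
    intro n
    induction n with
    | zero => rw [hl0, hr0]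
    | succ n ih => exact (Icc_subset_Icc (hl n) (hr n)).trans ih
  have hstep : ∀ n, dist (A n) (A (n + 1)) ≤
      3 * M ^ (1 / q) * (b - a) ^ α * ((1 / 2) ^ α) ^ n := by
    intro n
    rw [dist_eq_norm]
    refine (norm_average_half_le hg hq hM (sub_pos.1 (hlr0 n))
      (Icc_subset_Icc (hl n) (hr n)) (by rw [hlr, hlr, pow_succ]; ring)
      ((lintegral_mono_set (prod_mono (hsub n) (hsub n))).trans hE)).trans (le_of_eq ?_)
    rw [hlr, Real.mul_rpow hL0.le (by positivity), ← Real.rpow_natCast, ← Real.rpow_natCast,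
      ← Real.rpow_mul (by norm_num), ← Real.rpow_mul (by norm_num), mul_comm (n : ℝ)]
    ring
  have htend : Tendsto A atTop (𝓝 (g c)) := by
    have hpow : Tendsto (fun n : ℕ => (b - a) * (1 / 2 : ℝ) ^ n) atTop (𝓝 0) := by
      have := (tendsto_pow_atTop_nhds_zero_of_lt_one (r := (1 / 2 : ℝ)) (by norm_num)
        (by norm_num)).const_mul (b - a)
      simpa using this
    rw [Metric.tendsto_atTop]
    intro ε hε
    obtain ⟨ρ, hρ, hgρ⟩ := Metric.continuous_iff.1 hg c (ε / 2) (by positivity)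
    obtain ⟨N, hN⟩ := Metric.tendsto_atTop.1 hpow ρ hρ
    refine ⟨N, fun n hn => ?_⟩
    have hnρ : r n - l n < ρ := by
      have := hN n hn
      rw [Real.dist_eq, sub_zero, abs_of_pos (by positivity)] at this
      rwa [hlr]
    have hint : IntegrableOn g (Icc (l n) (r n)) :=
      hg.continuousOn.integrableOn_compact isCompact_Icc
    have hvol : (volume : Measure ℝ).real (Icc (l n) (r n)) = r n - l n := by
      simp [measureReal_def, (sub_pos.1 (hlr0 n)).le]
    have e : A n - g c = (r n - l n)⁻¹ • ∫ s in Icc (l n) (r n), (g s - g c) := by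
      have hcint : IntegrableOn (fun _ => g c) (Icc (l n) (r n)) := by simp
      rw [integral_sub hint hcint, setIntegral_const, hvol, smul_sub,
        smul_smul, inv_mul_cancel₀ (hlr0 n).ne', one_smul]
    rw [dist_eq_norm, e, norm_smul, Real.norm_of_nonneg (inv_nonneg.2 (hlr0 n).le),
      inv_mul_lt_iff₀ (hlr0 n)]
    have h1 := norm_setIntegral_le_of_norm_le_const (μ := volume) (s := Icc (l n) (r n))
      (f := fun s => g s - g c) (C := ε / 2) (by simp) fun s hs => by
        have h2 : dist s c < ρ := by
          rw [Real.dist_eq]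
          refine lt_of_le_of_lt (abs_le.2 ⟨?_, ?_⟩) hnρ
          · linarith [hs.1, (hc n).2]
          · linarith [hs.2, (hc n).1]
        have := hgρ s h2
        rw [dist_eq_norm] at this
        exact this.le
    rw [hvol] at h1
    nlinarith [hlr0 n]
  have hr1 : (1 / 2 : ℝ) ^ α < 1 := Real.rpow_lt_one (by norm_num) (by norm_num) hα0
  have := dist_le_of_le_geometric_of_tendsto₀ _ _ hr1 hstep htend
  rw [dist_eq_norm] at this
  have eA : A 0 = (b - a)⁻¹ • ∫ s in Icc a b, g s := by simp only [hA, hl0, hr0]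
  rw [eA] at this
  refine this.trans (le_of_eq ?_)
  ring

/-- A Morrey type inequality. -/
theorem norm_sub_le_of_energy {g : ℝ → ℂ} (hg : Continuous g) {q M : ℝ} (hq : 2 < q)
    (hM : 0 < M) {a b : ℝ} (hab : a < b)
    (hE : ∫⁻ z in Icc a b ×ˢ Icc a b,
      ENNReal.ofReal ((‖g z.1 - g z.2‖ / |z.1 - z.2|) ^ q) ≤ ENNReal.ofReal M) :
    ‖g a - g b‖ ≤ 6 * M ^ (1 / q) / (1 - (1 / 2) ^ (1 - 2 / q)) * (b - a) ^ (1 - 2 / q) := by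
  have hL0 : 0 < b - a := sub_pos.2 hab
  have hpow : ∀ n : ℕ, (b - a) * (1 / 2) ^ (n + 1) ≤ (b - a) * (1 / 2) ^ n := fun n => by
    rw [pow_succ]
    have : 0 < (b - a) * (1 / 2) ^ n := by positivity
    linarith
  have hpos : ∀ n : ℕ, 0 < (b - a) * (1 / 2) ^ n := fun n => by positivity
  have h1 := norm_average_sub_endpoint_le hg hq hM hab hE (l := fun _ => a)
    (r := fun n => a + (b - a) * (1 / 2) ^ n) (fun _ => le_rfl)
    (fun n => by linarith [hpow n]) rfl (by simp) (fun n => by ring)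
    (c := a) (fun n => ⟨le_rfl, by linarith [hpos n]⟩)
  have h2 := norm_average_sub_endpoint_le hg hq hM hab hE (l := fun n => b - (b - a) * (1 / 2) ^ n)
    (r := fun _ => b) (fun n => by linarith [hpow n]) (fun _ => le_rfl)
    (by simp) rfl (fun n => by ring)
    (c := b) (fun n => ⟨by linarith [hpos n], le_rfl⟩)
  rw [norm_sub_rev] at h1
  have h3 := norm_sub_le_norm_sub_add_norm_sub (g a) ((b - a)⁻¹ • ∫ s in Icc a b, g s) (g b)
  refine h3.trans ((add_le_add h1 h2).trans (le_of_eq ?_))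
  ring

/-! ### Squares of unit tangents -/

/-- Squaring a unit vector forgets its sign. The difference of the squares is twice the sine of the
angle between the lines, which is all that the tangent-point kernel can see. -/
theorem norm_sq_sub_sq_of_unit {a c : ℂ} (ha : ‖a‖ = 1) (hc : ‖c‖ = 1) :
    ‖a ^ 2 - c ^ 2‖ = 2 * |det a c| := by
  have h1 := norm_sub_sq_real a c
  have h2 := norm_add_sq_real a c
  have h3 := inner_sq_add_det_sq a c
  rw [ha, hc] at h1 h2 h3
  have e : a ^ 2 - c ^ 2 = (a - c) * (a + c) := by ring
  rw [e, norm_mul]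
  have h4 : (‖a - c‖ * ‖a + c‖) ^ 2 = (2 * |det a c|) ^ 2 := by
    rw [mul_pow, mul_pow, sq_abs, h1, h2]
    linear_combination (-4 : ℝ) * h3
  exact (pow_left_inj₀ (by positivity) (by positivity) two_ne_zero).1 h4

/-- Triangle inequality through the square of the direction of the chord `c`. -/
theorem norm_sq_sub_sq_le {a b c : ℂ} (ha : ‖a‖ = 1) (hb : ‖b‖ = 1) :
    ‖c‖ * ‖a ^ 2 - b ^ 2‖ ≤ 2 * |det a c| + 2 * |det b c| := by
  rcases eq_or_ne c 0 with rfl | hc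
  · simp only [norm_zero, zero_mul]; positivity
  have hc0 : 0 < ‖c‖ := norm_pos_iff.2 hc
  set e : ℂ := ‖c‖⁻¹ • c with he
  have he1 : ‖e‖ = 1 := by
    rw [he, norm_smul, norm_inv, norm_norm, inv_mul_cancel₀ hc0.ne']
  have key : ∀ a : ℂ, ‖a‖ = 1 → ‖c‖ * ‖a ^ 2 - e ^ 2‖ = 2 * |det a c| := fun a ha => by
    rw [norm_sq_sub_sq_of_unit ha he1, he, det_smul_right, abs_mul, abs_of_pos (inv_pos.2 hc0)]
    field_simp
  have h1 := norm_sub_le_norm_sub_add_norm_sub (a ^ 2) (e ^ 2) (b ^ 2)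
  rw [norm_sub_rev (e ^ 2)] at h1
  rw [← key a ha, ← key b hb, ← mul_add]
  exact mul_le_mul_of_nonneg_left h1 hc0.le

/-- A continuous unit vector field is controlled by its square as long as the latter varies by at
most `1`. -/
theorem norm_sub_le_norm_sq_sub {g : ℝ → ℂ} (hg : Continuous g) (h1 : ∀ x, ‖g x‖ = 1) {x y : ℝ}
    (h : ∀ t ∈ uIcc x y, ‖g x ^ 2 - g t ^ 2‖ ≤ 1) : ‖g x - g y‖ ≤ ‖g x ^ 2 - g y ^ 2‖ := by
  have hpar : ∀ t, ‖g x - g t‖ ^ 2 + ‖g x + g t‖ ^ 2 = 4 := fun t => by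
    have e1 := norm_sub_sq_real (g x) (g t)
    have e2 := norm_add_sq_real (g x) (g t)
    rw [h1, h1] at e1 e2
    linarith
  have hmul : ∀ t, ‖g x ^ 2 - g t ^ 2‖ = ‖g x - g t‖ * ‖g x + g t‖ := fun t => by
    rw [← norm_mul]; congr 1; ring
  have hle : ‖g x - g y‖ ^ 2 ≤ 2 := by
    by_contra hcon
    push Not at hcon
    -- If the vectors were more than a right angle apart, they would be orthogonal at some
    -- intermediate parameter, where the squares differ by 2.
    have hivt := intermediate_value_uIcc (f := fun t => ‖g x - g t‖ ^ 2) (a := x) (b := y)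
      (Continuous.continuousOn (by fun_prop))
    obtain ⟨t, ht, ht2⟩ := hivt (show (2 : ℝ) ∈ _ by
      simp only [sub_self, norm_zero]
      rw [mem_uIcc]; left; constructor
      · norm_num
      · exact hcon.le)
    simp only at ht2
    have h3 := h t ht
    have h4 := hpar t
    have h5 : ‖g x + g t‖ ^ 2 = 2 := by linarith
    rw [hmul] at h3
    have h6 : (‖g x - g t‖ * ‖g x + g t‖) ^ 2 = 4 := by rw [mul_pow, ht2, h5]; norm_num
    have h7 : 0 ≤ ‖g x - g t‖ * ‖g x + g t‖ := by positivity
    nlinarith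
  have h2 : 1 ≤ ‖g x + g y‖ := by
    have := hpar y
    nlinarith [norm_nonneg (g x + g y)]
  rw [hmul]
  exact le_mul_of_one_le_right (norm_nonneg _) h2


/-! ### Curves with bounded energy and almost right angles -/

theorem norm_smul_sub_smul_ge {a b : ℂ} (ha : ‖a‖ = 1) (hb : ‖b‖ = 1)
    (hab : |inner ℝ a b| ≤ 1 / 2) (σ τ : ℝ) : (|σ| + |τ|) / 2 ≤ ‖σ • a - τ • b‖ := by
  have h1 := norm_sub_sq_real (σ • a) (τ • b)
  rw [norm_smul, norm_smul, ha, hb, mul_one, mul_one, Real.norm_eq_abs, Real.norm_eq_abs,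
    real_inner_smul_left, real_inner_smul_right] at h1
  have h2 : σ * (τ * inner ℝ a b) ≤ |σ| * |τ| * (1 / 2) := by
    refine (le_abs_self _).trans ?_
    rw [abs_mul, abs_mul, ← mul_assoc]
    gcongr
  refine abs_le_of_sq_le_sq' ?_ (norm_nonneg _) |>.2
  rw [h1]
  nlinarith [sq_nonneg (|σ| - |τ|), sq_nonneg (|σ| + |τ|)]

/-- Straight generic curves with almost right angles and energy at most `M`. -/
structure IsControlled (η q M : ℝ) (γ : ℝ → ℂ) : Prop extends IsStraightGeneric η γ where
  angle : ∀ u v, Cross γ u v → |inner ℝ (deriv γ u) (deriv γ v)| ≤ 1 / 2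
  energy : truncatedTP q η γ ≤ ENNReal.ofReal M

theorem norm_sub_le_abs_sub {γ : ℝ → ℂ} (hγ : IsC1Loop γ) (h : ∀ x, ‖deriv γ x‖ = 1) (x y : ℝ) :
    ‖γ x - γ y‖ ≤ |x - y| := by
  have := norm_sub_sub_le hγ.differentiable (x := y) (y := x) (v := 0) (c := 1)
    fun t _ => by rw [sub_zero, h]
  simpa using this

variable {η q M : ℝ} {γ : ℝ → ℂ}

theorem IsControlled.norm_sub_ge (h : IsControlled η q M γ) {u v s t : ℝ} (huv : Cross γ u v)
    (hs : |s - u| < η) (ht : |t - v| < η) : (|s - u| + |t - v|) / 2 ≤ ‖γ s - γ t‖ := by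
  rw [h.straight u v huv s hs, h.straight v u huv.symm t ht, huv.2, add_sub_add_left_eq_sub]
  exact norm_smul_sub_smul_ge (h.unit u) (h.unit v) (h.angle u v huv) _ _

/-- If `x` and `y` lay near the two parameters of a crossing, the strands would separate at least at
half speed, so |x - u| + |y - v| ≤ 2|x - y| ≤ η. That puts the parameters within 3η/2 of each other,
below the gap 2η. Hence TP_η controls the curve near the diagonal. -/
theorem IsControlled.notMem_cutout (h : IsControlled η q M γ) {x y : ℝ}
    (hxy : |x - y| ≤ η / 2) : (x, y) ∉ cutout η γ := by
  rw [mem_cutout_iff h.periodic h.unit]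
  rintro ⟨u, v, huv, hu, hv⟩
  simp only at hu hv
  have h1 := h.norm_sub_ge huv hu hv
  have h2 := norm_sub_le_abs_sub h.isC1Loop h.unit x y
  have h3 := h.gap u v v u huv huv.symm huv.1
  have h4 : |u - v| ≤ |x - u| + |x - y| + |y - v| := by
    rw [show u - v = -(x - u) + (x - y) + (y - v) by ring]
    refine (abs_add_le _ _).trans (add_le_add_left ((abs_add_le _ _).trans ?_) _)
    rw [abs_neg]
  linarith

theorem IsStraightGeneric.ne_of_abs_sub_le (h : IsStraightGeneric η γ) (hη : 0 < η) (hη1 : η ≤ 1)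
    {x y : ℝ} (hne : x ≠ y) (hxy : |x - y| ≤ η / 2) : γ x ≠ γ y := by
  intro he
  have hk : ∀ k : ℤ, x ≠ y + k := fun k hk => by
    rw [show x - y = k by linarith] at hxy
    have h2 : |(k : ℝ)| < 1 := by linarith
    have h3 : |k| < 1 := by exact_mod_cast h2
    rw [Int.abs_lt_one_iff] at h3
    subst h3
    exact hne (by simpa using hk)
  have hc : Cross γ x y := ⟨hk, he⟩
  have := h.gap x y y x hc hc.symm hk
  linarith

/-- Both tangents are compared with the chord, whose deviation from each tangent line is measured by
the kernel in one of its two orders. The chord is no longer than the arc. -/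
theorem IsControlled.norm_deriv_sq_sub_le (h : IsControlled η q M γ) (hη : 0 < η) (hη1 : η ≤ 1)
    {x y : ℝ} (hxy : |x - y| ≤ η / 2) :
    ‖deriv γ x ^ 2 - deriv γ y ^ 2‖ ≤ |x - y| * (tpKernel γ x y + tpKernel γ y x) := by
  rcases eq_or_ne x y with rfl | hne
  · simp
  have hc0 : 0 < ‖γ x - γ y‖ :=
    norm_pos_iff.2 (sub_ne_zero.2 (h.ne_of_abs_sub_le hη hη1 hne hxy))
  have h1 := norm_sq_sub_sq_le (c := γ x - γ y) (h.unit x) (h.unit y)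
  have h2 := norm_sub_le_abs_sub h.isC1Loop h.unit x y
  have e : ‖γ x - γ y‖ ^ 2 * (tpKernel γ x y + tpKernel γ y x) =
      2 * |det (deriv γ x) (γ x - γ y)| + 2 * |det (deriv γ y) (γ x - γ y)| := by
    have e3 : |det (deriv γ x) (γ y - γ x)| = |det (deriv γ x) (γ x - γ y)| := by
      rw [det_sub_right, det_sub_right, abs_sub_comm]
    unfold tpKernel
    rw [e3, norm_sub_rev (γ y) (γ x)]
    field_simp
    ring
  rw [← e, pow_two ‖γ x - γ y‖, mul_assoc] at h1
  have h3 := le_of_mul_le_mul_left h1 hc0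
  refine h3.trans ?_
  have := tpKernel_nonneg γ x y
  have := tpKernel_nonneg γ y x
  gcongr

theorem add_rpow_le_two_rpow_mul {a b q : ℝ} (ha : 0 ≤ a) (hb : 0 ≤ b) (hq : 0 ≤ q) :
    (a + b) ^ q ≤ 2 ^ q * (a ^ q + b ^ q) := by
  have h1 : 0 ≤ a ^ q := Real.rpow_nonneg ha q
  have h2 : 0 ≤ b ^ q := Real.rpow_nonneg hb q
  have h3 : (0 : ℝ) ≤ 2 ^ q := by positivity
  rcases le_total a b with h | h
  · have : (a + b) ^ q ≤ (2 * b) ^ q := Real.rpow_le_rpow (by positivity) (by linarith) hq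
    rw [Real.mul_rpow zero_le_two hb] at this
    nlinarith
  · have : (a + b) ^ q ≤ (2 * a) ^ q := Real.rpow_le_rpow (by positivity) (by linarith) hq
    rw [Real.mul_rpow zero_le_two ha] at this
    nlinarith

theorem IsControlled.ofReal_quotient_le (h : IsControlled η q M γ) (hη : 0 < η) (hη1 : η ≤ 1)
    (hq : 0 < q) {x y : ℝ} (hxy : |x - y| ≤ η / 2) :
    ENNReal.ofReal ((‖deriv γ x ^ 2 - deriv γ y ^ 2‖ / |x - y|) ^ q) ≤
      ENNReal.ofReal (2 ^ q) * (offDensity q η γ (x, y) + offDensity q η γ (y, x)) := by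
  have h1 : offDensity q η γ (x, y) = ENNReal.ofReal (tpKernel γ x y ^ q) :=
    indicator_of_mem (h.notMem_cutout hxy) _
  have h2 : offDensity q η γ (y, x) = ENNReal.ofReal (tpKernel γ y x ^ q) :=
    indicator_of_mem (h.notMem_cutout (by rwa [abs_sub_comm])) _
  have k1 := tpKernel_nonneg γ x y
  have k2 := tpKernel_nonneg γ y x
  rw [h1, h2, ← ENNReal.ofReal_add (by positivity) (by positivity),
    ← ENNReal.ofReal_mul (by positivity)]
  refine ENNReal.ofReal_le_ofReal (le_trans ?_ (add_rpow_le_two_rpow_mul k1 k2 hq.le))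
  refine Real.rpow_le_rpow (by positivity) ?_ hq.le
  refine div_le_of_le_mul₀ (abs_nonneg _) (by positivity) ?_
  rw [mul_comm]
  exact h.norm_deriv_sq_sub_le hη hη1 hxy

theorem lintegral_square_swap (F : ℝ × ℝ → ℝ≥0∞) (s : Set ℝ) :
    ∫⁻ z in s ×ˢ s, F z.swap = ∫⁻ z in s ×ˢ s, F z := by
  rw [Measure.volume_eq_prod, ← Measure.prod_restrict, lintegral_prod_swap]

theorem IsStraightGeneric.lintegral_square_le (h : IsStraightGeneric η γ) (q : ℝ) {a b c d : ℝ}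
    (hab : b < a + 1) (hcd : d < c + 1) :
    ∫⁻ z in Icc a b ×ˢ Icc c d, offDensity q η γ z ≤ truncatedTP q η γ := by
  rw [truncatedTP_eq h.isC1Loop h.unit, ← lintegral_biperiodic
    (measurable_offDensity h.isC1Loop h.unit q η) (offDensity_add_int h.periodic h.unit q η) a c]
  refine lintegral_mono_set (prod_mono ?_ ?_)
  · exact fun x hx => ⟨hx.1, hx.2.trans_lt hab⟩
  · exact fun x hx => ⟨hx.1, hx.2.trans_lt hcd⟩

theorem IsControlled.lintegral_quotient_le (h : IsControlled η q M γ) (hη : 0 < η) (hη1 : η ≤ 1)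
    (hq : 0 < q) (hM : 0 ≤ M) {a b : ℝ} (hab : b - a ≤ η / 2) :
    ∫⁻ z in Icc a b ×ˢ Icc a b,
      ENNReal.ofReal ((‖deriv γ z.1 ^ 2 - deriv γ z.2 ^ 2‖ / |z.1 - z.2|) ^ q) ≤
      ENNReal.ofReal (2 ^ q * (2 * M)) := by
  have hm := measurable_offDensity h.isC1Loop h.unit q η
  have hms : Measurable fun z : ℝ × ℝ => offDensity q η γ z.swap := hm.comp measurable_swap
  have hle := (h.lintegral_square_le q (a := a) (b := b) (c := a) (d := b)
    (by linarith) (by linarith)).trans h.energy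
  calc _ ≤ ∫⁻ z in Icc a b ×ˢ Icc a b,
        ENNReal.ofReal (2 ^ q) * (offDensity q η γ z + offDensity q η γ z.swap) := by
        refine setLIntegral_mono' (measurableSet_Icc.prod measurableSet_Icc) fun z hz => ?_
        exact h.ofReal_quotient_le hη hη1 hq (abs_le.2
          ⟨by linarith [hz.1.1, hz.2.2], by linarith [hz.1.2, hz.2.1]⟩)
    _ = ENNReal.ofReal (2 ^ q) * ((∫⁻ z in Icc a b ×ˢ Icc a b, offDensity q η γ z) +
          ∫⁻ z in Icc a b ×ˢ Icc a b, offDensity q η γ z) := by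
        have hms' : Measurable fun z : ℝ × ℝ =>
            offDensity q η γ z + offDensity q η γ z.swap := hm.add hms
        rw [lintegral_const_mul _ hms', lintegral_add_left hm, lintegral_square_swap (offDensity q η γ)]
    _ ≤ ENNReal.ofReal (2 ^ q) * (ENNReal.ofReal M + ENNReal.ofReal M) := by gcongr
    _ = _ := by
        rw [← ENNReal.ofReal_add hM hM, ← ENNReal.ofReal_mul (by positivity), two_mul M]

/-- The tangents of controlled curves are equicontinuous, and locally controlled by their
squares. -/
theorem exists_modulus (hη : 0 < η) (hη1 : η ≤ 1) (hq : 2 < q) (hM : 0 < M) {ε : ℝ} (hε : 0 < ε) :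
    ∃ r > 0, r ≤ η / 2 ∧ ∀ γ, IsControlled η q M γ → ∀ x y, |x - y| ≤ r →
      ‖deriv γ x - deriv γ y‖ ≤ ε ∧
        ‖deriv γ x - deriv γ y‖ ≤ ‖deriv γ x ^ 2 - deriv γ y ^ 2‖ := by
  set K := 6 * (2 ^ q * (2 * M)) ^ (1 / q) / (1 - (1 / 2) ^ (1 - 2 / q)) with hK
  have hα : 0 < 1 - 2 / q := by
    rw [sub_pos, div_lt_one (by linarith)]; exact hq
  have hden : (0 : ℝ) < 1 - (1 / 2) ^ (1 - 2 / q) :=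
    sub_pos.2 (Real.rpow_lt_one (by norm_num) (by norm_num) hα)
  have hK0 : 0 < K := by positivity
  have hsq : ∀ γ, IsControlled η q M γ → ∀ x y, |x - y| ≤ η / 2 →
      ‖deriv γ x ^ 2 - deriv γ y ^ 2‖ ≤ K * |x - y| ^ (1 - 2 / q) := by
    intro γ h
    have hlt : ∀ x y, x < y → |x - y| ≤ η / 2 →
        ‖deriv γ x ^ 2 - deriv γ y ^ 2‖ ≤ K * |x - y| ^ (1 - 2 / q) := by
      intro x y hlt hxy
      have e : |x - y| = y - x := by rw [abs_sub_comm, abs_of_pos (by linarith)]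
      rw [e] at hxy ⊢
      exact norm_sub_le_of_energy (g := fun t => deriv γ t ^ 2)
        (h.generic.immersed.continuous_deriv.pow 2) hq (by positivity) hlt
        (h.lintegral_quotient_le hη hη1 (by linarith) hM.le hxy)
    intro x y hxy
    rcases lt_trichotomy x y with h1 | rfl | h1
    · exact hlt x y h1 hxy
    · simp only [sub_self, norm_zero]; positivity
    · rw [norm_sub_rev, abs_sub_comm]
      exact hlt y x h1 (by rwa [abs_sub_comm])
  -- The squares must vary by at most 1, so that the tangent cannot flip while its square returns.
  set m := min ε 1 with hm
  have hm0 : 0 < m := by positivity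
  refine ⟨min (η / 2) ((m / K) ^ (1 / (1 - 2 / q))), by positivity, min_le_left _ _,
    fun γ h x y hxy => ?_⟩
  have hsmall : ∀ t, |x - t| ≤ |x - y| → ‖deriv γ x ^ 2 - deriv γ t ^ 2‖ ≤ m := by
    intro t ht
    have h1 := ht.trans hxy
    refine (hsq γ h x t (h1.trans (min_le_left _ _))).trans ?_
    have h2 : |x - t| ^ (1 - 2 / q) ≤ m / K := by
      have h3 := Real.rpow_le_rpow (abs_nonneg _) (h1.trans (min_le_right _ _)) hα.le
      rwa [← Real.rpow_mul (by positivity), one_div_mul_cancel hα.ne', Real.rpow_one] at h3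
    calc K * |x - t| ^ (1 - 2 / q) ≤ K * (m / K) := by gcongr
      _ = m := by field_simp
  have h2 := norm_sub_le_norm_sq_sub h.generic.immersed.continuous_deriv h.unit (x := x) (y := y)
    fun t ht => (hsmall t (by
      rw [abs_sub_comm, abs_sub_comm x y]; exact abs_sub_left_of_mem_uIcc ht)).trans (min_le_right _ _)
  exact ⟨h2.trans ((hsmall y le_rfl).trans (min_le_left _ _)), h2⟩

/-! ### Near-intersections of controlled curves -/

/-- Without a crossing nearby, the point of the second strand nearest to γ(x) lies at some distance
e > 0 and is seen perpendicularly to the strand. On a square of side e/5 in the parameters the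
kernel is then at least 1/(2e), and the resulting energy (1/(2e))^q·(e/5)² exceeds `M`. -/
theorem IsControlled.exists_cross_near (h : IsControlled η q M γ) {r : ℝ}
    (hr : ∀ x y, |x - y| ≤ r → ‖deriv γ x - deriv γ y‖ ≤ 1 / 20) (hq : 0 < q) {x y d : ℝ}
    (hd : 0 < d) (hxy : ‖γ x - γ y‖ ≤ d) (hdr : 5 * d ≤ r) (hd1 : d ≤ 1)
    (hfar : ∀ k : ℤ, 5 * d ≤ |x - y - k|)
    (hbig : ∀ e, 0 < e → e ≤ d → M < (1 / (2 * e)) ^ q * (e / 5) ^ 2) :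
    ∃ u v, Cross γ u v ∧ |x - u| ≤ 27 * d ∧ |y - v| ≤ 27 * d := by
  by_contra! hno
  have hlip := norm_sub_le_abs_sub h.isC1Loop h.unit
  have hdiff := h.isC1Loop.differentiable
  -- A point of this box in the cutout would have its crossing within 5d + 22d = 27d, because ‖γ(s)
  -- - γ(t)‖ ≤ 11d bounds the sum of the distances to its parameters by 22d.
  have hbox : ∀ s t, |x - s| ≤ 5 * d → |y - t| ≤ 5 * d → (s, t) ∉ cutout η γ := by
    intro s t hs ht hmem
    obtain ⟨u, v, huv, hu, hv⟩ := (mem_cutout_iff h.periodic h.unit).1 hmem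
    simp only at hu hv
    have h1 := h.norm_sub_ge huv hu hv
    have h2 : ‖γ s - γ t‖ ≤ 11 * d := by
      have h3 := hlip s x
      have h4 := hlip y t
      rw [abs_sub_comm] at h3
      have h5 : ‖γ s - γ t‖ ≤ ‖γ s - γ x‖ + ‖γ x - γ y‖ + ‖γ y - γ t‖ := by
        rw [show γ s - γ t = (γ s - γ x) + (γ x - γ y) + (γ y - γ t) by abel]
        exact norm_add₃_le
      linarith
    have h6 := abs_sub_le x s u
    have h7 := abs_sub_le y t v
    have := abs_nonneg (s - u)
    have := abs_nonneg (t - v)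
    have := hno u v huv (by linarith)
    linarith
  obtain ⟨t₁, ht₁, hmin⟩ := (isCompact_Icc (a := y - 4 * d) (b := y + 4 * d)).exists_isMinOn
    ⟨y, by constructor <;> linarith⟩
    (f := fun t => ‖γ x - γ t‖ ^ 2)
    (Continuous.continuousOn (by have := h.generic.immersed.continuous; fun_prop))
  set e := ‖γ x - γ t₁‖ with he
  have hed : e ≤ d := by
    have := hmin (show y ∈ Icc (y - 4 * d) (y + 4 * d) by constructor <;> linarith)
    simp only [mem_ofPred_eq] at this
    exact ((pow_le_pow_iff_left₀ (norm_nonneg _) (norm_nonneg _) two_ne_zero).1 this).trans hxy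
  have hty : |t₁ - y| ≤ 4 * d := abs_le.2 ⟨by linarith [ht₁.1], by linarith [ht₁.2]⟩
  -- Contact at `t₁` would be a genuine crossing, since `hfar` excludes coincidence modulo 1, and it
  -- would lie too close.
  have he0 : 0 < e := by
    refine norm_pos_iff.2 (sub_ne_zero.2 fun heq => ?_)
    have hc : Cross γ x t₁ := ⟨fun k hk => by
      have h1 := hfar k
      rw [show x - y - k = t₁ - y by linarith] at h1
      linarith, heq⟩
    have := hno x t₁ hc (by rw [sub_self, abs_zero]; linarith)
    rw [abs_sub_comm] at this
    linarith
  -- The minimum is interior: at an end of the window the strand has moved at least 3.8d away from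
  -- γ(y), but γ(t₁) is within e + d ≤ 2d of it.
  have hty' : |t₁ - y| < 4 * d := by
    refine lt_of_le_of_ne hty fun heq => ?_
    have h1 := norm_sub_sub_le hdiff (x := y) (y := t₁) (v := deriv γ y) (c := 1 / 20)
      fun t ht => hr t y (by
        have := abs_sub_left_of_mem_uIcc ht
        linarith)
    have h2 : ‖(t₁ - y) • deriv γ y‖ = 4 * d := by
      rw [norm_smul, h.unit, Real.norm_eq_abs, heq, mul_one]
    have h3 : ‖γ t₁ - γ y‖ ≤ e + d := by
      have := norm_sub_le_norm_sub_add_norm_sub (γ t₁) (γ x) (γ y)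
      rw [norm_sub_rev (γ t₁) (γ x)] at this
      linarith
    have h4 := norm_sub_norm_le ((t₁ - y) • deriv γ y) (γ t₁ - γ y)
    rw [norm_sub_rev ((t₁ - y) • deriv γ y) (γ t₁ - γ y)] at h4
    rw [heq] at h1
    linarith
  have horth : inner ℝ (γ x - γ t₁) (deriv γ t₁) = 0 := by
    have hloc : IsLocalMin (fun t => ‖γ x - γ t‖ ^ 2) t₁ := by
      refine hmin.isLocalMin ?_
      rw [abs_lt] at hty'
      exact Icc_mem_nhds (by linarith) (by linarith)
    have hder : HasDerivAt (fun t => ‖γ x - γ t‖ ^ 2)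
        (2 * inner ℝ (γ x - γ t₁) (-deriv γ t₁)) t₁ :=
      ((hdiff t₁).hasDerivAt.const_sub (γ x)).norm_sq
    have := hloc.hasDerivAt_eq_zero hder
    rw [inner_neg_right] at this
    linarith
  have hdet : |det (deriv γ t₁) (γ x - γ t₁)| = e := by
    have h1 := inner_sq_add_det_sq (deriv γ t₁) (γ x - γ t₁)
    rw [real_inner_comm, horth, h.unit] at h1
    rw [he, ← abs_of_nonneg (norm_nonneg (γ x - γ t₁)), ← sq_eq_sq_iff_abs_eq_abs]
    linarith
  have hker : ∀ z ∈ Icc (x - e / 10) (x + e / 10) ×ˢ Icc (t₁ - e / 10) (t₁ + e / 10),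
      ENNReal.ofReal ((1 / (2 * e)) ^ q) ≤ offDensity q η γ z := by
    rintro ⟨s, t⟩ ⟨hs, ht⟩
    simp only at hs ht
    have hs' : |s - x| ≤ e / 10 := abs_le.2 ⟨by linarith [hs.1], by linarith [hs.2]⟩
    have ht' : |t - t₁| ≤ e / 10 := abs_le.2 ⟨by linarith [ht.1], by linarith [ht.2]⟩
    have hnot : (s, t) ∉ cutout η γ := by
      refine hbox s t (by rw [abs_sub_comm]; linarith) ?_
      have := abs_sub_le t t₁ y
      rw [abs_sub_comm]; linarith
    have hval : offDensity q η γ (s, t) = ENNReal.ofReal (tpKernel γ s t ^ q) :=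
      indicator_of_mem hnot _
    rw [hval]
    refine ENNReal.ofReal_le_ofReal (Real.rpow_le_rpow (by positivity) ?_ hq.le)
    set w := γ s - γ t with hw
    set w₀ := γ x - γ t₁ with hw₀
    have hww : ‖w - w₀‖ ≤ e / 5 := by
      have h1 := hlip s x
      have h2 := hlip t t₁
      have h3 := norm_sub_le (γ s - γ x) (γ t - γ t₁)
      rw [show w - w₀ = (γ s - γ x) - (γ t - γ t₁) by rw [hw, hw₀]; abel]
      linarith
    have hw1 : ‖w‖ ≤ 6 / 5 * e := by
      have := norm_sub_norm_le w w₀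
      linarith
    have hw2 : 4 / 5 * e ≤ ‖w‖ := by
      have := norm_sub_norm_le w₀ w
      rw [norm_sub_rev w₀ w] at this
      linarith
    -- Displacing both points loses e/5, turning the tangent loses 6e/100. With ‖w‖ ≤ 6e/5, the
    -- remaining 6e/10 gives a kernel of at least 1/(2e).
    have hdw : e / 2 + e / 10 ≤ |det (deriv γ t) w| := by
      have e1 : det (deriv γ t₁) w₀ = det (deriv γ t) w - det (deriv γ t₁) (w - w₀) -
          det (deriv γ t - deriv γ t₁) w := by
        rw [det_sub_right _ w w₀, det_sub_left]; ring
      have h1 := abs_det_le (deriv γ t₁) (w - w₀)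
      have h2 := abs_det_le (deriv γ t - deriv γ t₁) w
      rw [h.unit, one_mul] at h1
      have h3 : ‖deriv γ t - deriv γ t₁‖ * ‖w‖ ≤ 1 / 20 * (6 / 5 * e) :=
        mul_le_mul (hr t t₁ (by linarith)) hw1 (norm_nonneg _) (by norm_num)
      have h4 := abs_sub (det (deriv γ t) w - det (deriv γ t₁) (w - w₀))
        (det (deriv γ t - deriv γ t₁) w)
      have h5 := abs_sub (det (deriv γ t) w) (det (deriv γ t₁) (w - w₀))
      rw [← e1, hdet] at h4
      linarith
    unfold tpKernel
    rw [norm_sub_rev, ← hw, div_le_div_iff₀ (by positivity) (by nlinarith)]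
    nlinarith
  have hlow : ENNReal.ofReal ((1 / (2 * e)) ^ q * (e / 5) ^ 2) ≤ ENNReal.ofReal M := by
    refine le_trans ?_ ((h.lintegral_square_le q (a := x - e / 10) (b := x + e / 10)
      (c := t₁ - e / 10) (d := t₁ + e / 10) (by linarith) (by linarith)).trans h.energy)
    refine le_trans ?_ (setLIntegral_mono' (measurableSet_Icc.prod measurableSet_Icc) hker)
    rw [setLIntegral_const, Measure.volume_eq_prod, Measure.prod_prod, Real.volume_Icc,
      Real.volume_Icc, ← ENNReal.ofReal_mul (by linarith), ← ENNReal.ofReal_mul (by positivity)]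
    refine ENNReal.ofReal_le_ofReal (le_of_eq ?_)
    ring
  have h1 := hbig e he0 hed
  have h2 : 0 < (1 / (2 * e)) ^ q * (e / 5) ^ 2 := by positivity
  rcases le_total 0 M with h0 | h0
  · rw [ENNReal.ofReal_le_ofReal_iff h0] at hlow
    linarith
  · rw [ENNReal.ofReal_of_nonpos h0] at hlow
    have := ENNReal.ofReal_pos.2 h2
    exact absurd hlow (not_le.2 this)


/-! ### Compactness in `C¹` -/

theorem exists_subseq_tendstoUniformly {f : ℕ → ℝ → ℂ} (hc : ∀ k, Continuous (f k))
    (hp : ∀ k, Function.Periodic (f k) 1) (hb : ∀ k x, ‖f k x‖ ≤ 1)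
    (he : ∀ ε > 0, ∃ r > 0, ∀ k x y, |x - y| ≤ r → ‖f k x - f k y‖ ≤ ε) :
    ∃ (φ : ℕ → ℕ) (g : ℝ → ℂ), StrictMono φ ∧ Continuous g ∧
      TendstoUniformly (fun k => f (φ k)) g atTop := by
  let F : ℕ → BoundedContinuousFunction (Icc (0 : ℝ) 1) ℂ := fun k =>
    BoundedContinuousFunction.mkOfCompact ⟨fun x => f k x, (hc k).comp continuous_subtype_val⟩
  have hF : ∀ k x, F k x = f k x := fun _ _ => rfl
  have hcomp : IsCompact (closure (range F)) := by
    refine BoundedContinuousFunction.arzela_ascoli (Metric.closedBall (0 : ℂ) 1)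
      (isCompact_closedBall 0 1) (range F) ?_ ?_
    · rintro _ x ⟨k, rfl⟩
      rw [mem_closedBall_zero_iff, hF]
      exact hb k x
    · intro x₀
      rw [Metric.equicontinuousAt_iff_right]
      intro ε hε
      obtain ⟨r, hr, H⟩ := he (ε / 2) (by positivity)
      filter_upwards [Metric.ball_mem_nhds x₀ hr] with x hx
      rintro ⟨_, k, rfl⟩
      change dist (F k x₀) (F k x) < ε
      rw [hF, hF, dist_eq_norm]
      have h1 : |(x₀ : ℝ) - x| ≤ r := by
        rw [Metric.mem_ball, dist_comm] at hx
        exact hx.le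
      linarith [H k x₀ x h1]
  obtain ⟨G, -, φ, hφ, hG⟩ := hcomp.tendsto_subseq fun k => subset_closure (mem_range_self k)
  rw [BoundedContinuousFunction.tendsto_iff_tendstoUniformly] at hG
  let π : ℝ → Icc (0 : ℝ) 1 := fun x => ⟨Int.fract x, (Int.fract_nonneg x), (Int.fract_lt_one x).le⟩
  have h1 := hG.comp π
  have e : (fun k => (fun x => F (φ k) x) ∘ π) = fun k => f (φ k) := by
    funext k x
    exact periodic_fract (hp (φ k)) x
  have h2 : TendstoUniformly (fun k => f (φ k)) (G ∘ π) atTop := by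
    rw [← e]; exact h1
  exact ⟨φ, G ∘ π, hφ, h2.continuous (Frequently.of_forall fun k => hc _), h2⟩

/-- Arzelà–Ascoli is applied to the derivatives only. The curves, translated to start at 0, are
recovered by integration, and periodicity passes to the limit. -/
theorem exists_tendstoC1 {ξ : ℕ → ℝ → ℂ} (hξ : ∀ k, IsC1Loop (ξ k))
    (hb : ∀ k x, ‖deriv (ξ k) x‖ ≤ 1)
    (he : ∀ ε > 0, ∃ r > 0, ∀ k x y, |x - y| ≤ r → ‖deriv (ξ k) x - deriv (ξ k) y‖ ≤ ε) :
    ∃ (φ : ℕ → ℕ) (c : ℕ → ℂ) (Γ : ℝ → ℂ), StrictMono φ ∧ IsC1Loop Γ ∧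
      TendstoC1 (fun k x => ξ (φ k) x + c k) Γ := by
  have hcd : ∀ k, Continuous (deriv (ξ k)) := fun k => (hξ k).contDiff.continuous_deriv le_rfl
  obtain ⟨φ, g, hφ, hg, hlim⟩ := exists_subseq_tendstoUniformly hcd
    (fun k => periodic_deriv (hξ k).periodic) hb he
  set ζ : ℕ → ℝ → ℂ := fun k x => ξ (φ k) x + -ξ (φ k) 0 with hζ
  set Γ : ℝ → ℂ := fun x => ∫ t in (0 : ℝ)..x, g t with hΓ
  have hint : ∀ k x, ζ k x = ∫ t in (0 : ℝ)..x, deriv (ξ (φ k)) t := fun k x => by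
    rw [intervalIntegral.integral_deriv_eq_sub (fun t _ => (hξ _).differentiable t)
      ((hcd _).intervalIntegrable _ _)]
    simp only [hζ, sub_eq_add_neg]
  have hloc : ∀ ε > 0, ∀ᶠ k in atTop, ∀ x, ‖ζ k x - Γ x‖ ≤ ε * |x| := by
    intro ε hε
    filter_upwards [Metric.tendstoUniformly_iff.1 hlim ε hε] with k hk x
    rw [hint, hΓ, ← intervalIntegral.integral_sub ((hcd _).intervalIntegrable _ _)
      (hg.intervalIntegrable _ _)]
    have := intervalIntegral.norm_integral_le_of_norm_le_const (a := 0) (b := x) (C := ε)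
      (f := fun t => deriv (ξ (φ k)) t - g t) fun t _ => by
        rw [← dist_eq_norm, dist_comm]; exact (hk t).le
    simpa using this
  have hptw : ∀ x, Tendsto (fun k => ζ k x) atTop (𝓝 (Γ x)) := by
    intro x
    rw [Metric.tendsto_atTop']
    intro ε hε
    obtain ⟨N, hN⟩ := eventually_atTop.1 (hloc (ε / (|x| + 1)) (by positivity))
    refine ⟨N, fun k hk => ?_⟩
    rw [dist_eq_norm]
    refine (hN k hk.le x).trans_lt ?_
    rw [div_mul_eq_mul_div, div_lt_iff₀ (by positivity)]
    nlinarith [abs_nonneg x]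
  have hζp : ∀ k, Function.Periodic (ζ k) 1 := fun k x => by
    simp only [hζ, (hξ (φ k)).periodic x]
  have hΓp : Function.Periodic Γ 1 := fun x => by
    refine tendsto_nhds_unique (hptw (x + 1)) ?_
    simp only [hζp _ x]
    exact hptw x
  have hder : ∀ x, HasDerivAt Γ (g x) x := fun x =>
    intervalIntegral.integral_hasDerivAt_right (hg.intervalIntegrable _ _)
      hg.stronglyMeasurable.stronglyMeasurableAtFilter hg.continuousAt
  have hderiv : deriv Γ = g := funext fun x => (hder x).deriv
  refine ⟨φ, fun k => -ξ (φ k) 0, Γ, hφ, ⟨hΓp, ?_⟩, ?_, ?_⟩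
  · rw [contDiff_one_iff_deriv]
    exact ⟨fun x => (hder x).differentiableAt, by rwa [hderiv]⟩
  · rw [Metric.tendstoUniformly_iff]
    intro ε hε
    filter_upwards [hloc (ε / 2) (by positivity)] with k hk x
    have h1 := hk (Int.fract x)
    rw [periodic_fract (hζp k), periodic_fract hΓp, abs_of_nonneg (Int.fract_nonneg x)] at h1
    rw [dist_comm, dist_eq_norm]
    have h2 := Int.fract_lt_one x
    have h3 := Int.fract_nonneg x
    refine lt_of_le_of_lt h1 ?_
    nlinarith
  · have e : (fun k => deriv fun x => ξ (φ k) x + -ξ (φ k) 0) = fun k => deriv (ξ (φ k)) := by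
      funext k x; simp
    rw [e, hderiv]
    exact hlim

/-! ### Translations -/

theorem cross_add_const {γ : ℝ → ℂ} {c : ℂ} {x y : ℝ} :
    Cross (fun x => γ x + c) x y ↔ Cross γ x y := by
  simp [Cross]

theorem deriv_add_const_fun (γ : ℝ → ℂ) (c : ℂ) : deriv (fun x => γ x + c) = deriv γ := by
  funext x; simp

theorem IsStraightGeneric.add_const {η : ℝ} {γ : ℝ → ℂ} (h : IsStraightGeneric η γ) (c : ℂ) :
    IsStraightGeneric η fun x => γ x + c := by
  refine ⟨h.generic.add_const c, ?_, ?_, ?_⟩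
  · rw [deriv_add_const_fun]; exact h.unit
  · simp only [cross_add_const]; exact h.gap
  · simp only [cross_add_const, deriv_add_const_fun]
    intro u v huv x hx
    rw [h.straight u v huv x hx]; abel

theorem truncatedTP_add_const {η : ℝ} {γ : ℝ → ℂ} (h : IsStraightGeneric η γ) (c : ℂ) (q δ : ℝ) :
    truncatedTP q δ (fun x => γ x + c) = truncatedTP q δ γ := by
  have h' := h.add_const c
  have e1 : cutout δ (fun x => γ x + c) = cutout δ γ := by
    ext z
    rw [mem_cutout_iff h.periodic h.unit, mem_cutout_iff h'.periodic h'.unit]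
    simp only [cross_add_const]
  have e2 : tpDensity q (fun x => γ x + c) = tpDensity q γ := by
    funext z
    simp only [tpDensity, tpKernel, deriv_add_const_fun, add_sub_add_right_eq_sub]
  rw [truncatedTP_eq h.isC1Loop h.unit, truncatedTP_eq h'.isC1Loop h'.unit, offDensity,
    offDensity, e1, e2]

theorem IsControlled.add_const {η q M : ℝ} {γ : ℝ → ℂ} (h : IsControlled η q M γ) (c : ℂ) :
    IsControlled η q M fun x => γ x + c := by
  refine ⟨h.toIsStraightGeneric.add_const c, ?_, ?_⟩
  · simp only [cross_add_const, deriv_add_const_fun]; exact h.angle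
  · rw [truncatedTP_add_const h.toIsStraightGeneric]; exact h.energy

/-! ### Limits of controlled curves -/

/-- The right-hand side is a constant multiple of e^(2-q), which tends to infinity as e → 0 since q
> 2. -/
theorem exists_lt_crossing_bound {q : ℝ} (hq : 2 < q) (M : ℝ) :
    ∃ d₀ > 0, ∀ e, 0 < e → e ≤ d₀ → M < (1 / (2 * e)) ^ q * (e / 5) ^ 2 := by
  set K := 25 * 2 ^ q * (|M| + 1) with hK
  have hK0 : 0 < K := by positivity
  have hq2 : 2 - q ≠ 0 := by linarith
  refine ⟨K ^ (1 / (2 - q)), by positivity, fun e he hle => ?_⟩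
  have h1 : K ≤ e ^ (2 - q) := by
    have := Real.rpow_le_rpow_of_nonpos he hle (show 2 - q ≤ 0 by linarith)
    rwa [← Real.rpow_mul hK0.le, one_div_mul_cancel hq2, Real.rpow_one] at this
  have h2 : (1 / (2 * e)) ^ q * (e / 5) ^ 2 = (25 * 2 ^ q)⁻¹ * e ^ (2 - q) := by
    rw [Real.div_rpow zero_le_one (by positivity), Real.one_rpow, Real.mul_rpow zero_le_two he.le,
      Real.rpow_sub he, Real.rpow_two]
    field_simp
    norm_num
  rw [h2, inv_mul_eq_div, lt_div_iff₀ (by positivity)]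
  have := le_abs_self M
  have h3 : (0 : ℝ) < 25 * 2 ^ q := by positivity
  nlinarith

theorem exists_dist_int_pos {t : ℝ} (h : ∀ k : ℤ, t ≠ k) : ∃ m > 0, ∀ k : ℤ, m ≤ |t - k| :=
  ⟨|t - round t|, abs_pos.2 (sub_ne_zero.2 (h _)), fun k => round_le t k⟩

variable {η q M : ℝ} {ζ : ℕ → ℝ → ℂ} {Γ : ℝ → ℂ}

/-- A self-contact of the limit is an ever closer near-contact of the approximating curves, and
bounded energy forces actual crossings next to it. Every property of crossings can then be passed to
the limit. -/
theorem exists_cross_seq (hη : 0 < η) (hη1 : η ≤ 1) (hq : 2 < q) (hM : 0 < M)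
    (hζ : ∀ k, IsControlled η q M (ζ k)) (hlim : TendstoC1 ζ Γ) {x y : ℝ} (hxy : Cross Γ x y) :
    ∃ u v : ℕ → ℝ, Tendsto u atTop (𝓝 x) ∧ Tendsto v atTop (𝓝 y) ∧
      ∀ᶠ k in atTop, Cross (ζ k) (u k) (v k) := by
  obtain ⟨r, hr0, -, hr⟩ := exists_modulus hη hη1 hq hM (ε := 1 / 20) (by norm_num)
  obtain ⟨d₀, hd₀, hbig⟩ := exists_lt_crossing_bound hq M
  obtain ⟨m, hm0, hm⟩ := exists_dist_int_pos (t := x - y) fun k hk => hxy.1 k (by linarith)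
  -- The added null sequence only serves to keep `d k` positive if the points already coincide.
  set d : ℕ → ℝ := fun k => ‖ζ k x - ζ k y‖ + 1 / ((k : ℝ) + 1) with hd
  have hd0 : ∀ k, 0 < d k := fun k => by
    have : (0 : ℝ) < 1 / ((k : ℝ) + 1) := by positivity
    simp only [hd]; positivity
  have hdlim : Tendsto d atTop (𝓝 0) := by
    have h1 := (hlim.1.tendsto_at x).sub (hlim.1.tendsto_at y)
    rw [hxy.2, sub_self] at h1
    have h2 := h1.norm.add tendsto_one_div_add_atTop_nhds_zero_nat
    rw [norm_zero, add_zero] at h2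
    exact h2
  have hev : ∀ᶠ k in atTop, ∃ p : ℝ × ℝ, Cross (ζ k) p.1 p.2 ∧
      |x - p.1| ≤ 27 * d k ∧ |y - p.2| ≤ 27 * d k := by
    have hs : 0 < min (min (r / 5) d₀) (min 1 (m / 5)) := by positivity
    filter_upwards [hdlim.eventually (gt_mem_nhds hs)] with k hk
    simp only [lt_min_iff] at hk
    obtain ⟨⟨h1, h2⟩, h3, h4⟩ := hk
    obtain ⟨u, v, h⟩ := (hζ k).exists_cross_near (fun x y h => (hr _ (hζ k) x y h).1)
      (by linarith) (hd0 k) (x := x) (y := y)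
      (by have : (0 : ℝ) < 1 / ((k : ℝ) + 1) := by positivity
          simp only [hd]; linarith)
      (by linarith) h3.le (fun j => by linarith [hm j])
      (fun e he hed => hbig e he (hed.trans h2.le))
    exact ⟨(u, v), h⟩
  obtain ⟨p, hp⟩ := hev.choice
  have h27 : Tendsto (fun k => 27 * d k) atTop (𝓝 0) := by simpa using hdlim.const_mul 27
  refine ⟨fun k => (p k).1, fun k => (p k).2, ?_, ?_, hp.mono fun k hk => hk.1⟩
  · rw [tendsto_iff_dist_tendsto_zero]
    refine squeeze_zero' (Eventually.of_forall fun _ => dist_nonneg) (hp.mono fun k hk => ?_) h27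
    rw [dist_comm]; exact hk.2.1
  · rw [tendsto_iff_dist_tendsto_zero]
    refine squeeze_zero' (Eventually.of_forall fun _ => dist_nonneg) (hp.mono fun k hk => ?_) h27
    rw [dist_comm]; exact hk.2.2

theorem inner_eq_zero_of_limit (hη : 0 < η) (hη1 : η ≤ 1) (hq : 2 < q) (hM : 0 < M)
    (hζ : ∀ k, IsControlled η q M (ζ k)) (hΓ : IsC1Loop Γ) (hlim : TendstoC1 ζ Γ)
    (hang : ∀ ε > 0, ∀ᶠ k in atTop, ∀ u v, Cross (ζ k) u v →
      |inner ℝ (deriv (ζ k) u) (deriv (ζ k) v)| ≤ ε) {x y : ℝ} (hxy : Cross Γ x y) :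
    inner ℝ (deriv Γ x) (deriv Γ y) = 0 := by
  have hcd : Continuous (deriv Γ) := hΓ.contDiff.continuous_deriv le_rfl
  obtain ⟨u, v, hu, hv, huv⟩ := exists_cross_seq hη hη1 hq hM hζ hlim hxy
  have h1 := (hlim.2.tendsto_comp hcd.continuousAt hu).inner (𝕜 := ℝ)
    (hlim.2.tendsto_comp hcd.continuousAt hv)
  refine abs_nonpos_iff.1 (le_of_forall_pos_le_add fun ε hε => ?_)
  rw [zero_add]
  refine le_of_tendsto h1.abs ?_
  filter_upwards [hang ε hε, huv] with k h2 h3 using h2 _ _ h3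

/-- The plane has no room for three mutually orthogonal unit vectors. This excludes triple points of
a limit whose crossings are all orthogonal. -/
theorem not_three_orthogonal {a b c : ℂ} (ha : ‖a‖ = 1) (hb : ‖b‖ = 1) (hc : ‖c‖ = 1)
    (hab : inner ℝ a b = 0) (hbc : inner ℝ b c = 0) (hac : inner ℝ a c = 0) : False := by
  have h1 := inner_sq_add_det_sq a b
  have h2 := inner_sq_add_det_sq a c
  rw [ha, hb, hab] at h1
  rw [ha, hc, hac] at h2
  have h3 : inner ℝ a b * inner ℝ a c + det a b * det a c = ‖a‖ ^ 2 * inner ℝ b c := by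
    rw [Complex.sq_norm, Complex.normSq_apply, Complex.inner, Complex.inner, Complex.inner]
    simp [det]; ring
  rw [hab, hac, hbc] at h3
  have h4 : (det a b * det a c) ^ 2 = 1 := by
    rw [mul_pow]
    have e1 : det a b ^ 2 = 1 := by linarith
    have e2 : det a c ^ 2 = 1 := by linarith
    rw [e1, e2, one_mul]
  have h5 : det a b * det a c = 0 := by linarith
  rw [h5] at h4
  norm_num at h4

/-- Orthogonality replaces the open conditions of genericity, and gap and straightness are closed
conditions once each crossing of Γ is approximated by crossings. -/
theorem isStraightGeneric_of_limit (hη : 0 < η) (hη1 : η ≤ 1) (hq : 2 < q) (hM : 0 < M)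
    (hζ : ∀ k, IsControlled η q M (ζ k)) (hΓ : IsC1Loop Γ) (hlim : TendstoC1 ζ Γ)
    (hang : ∀ ε > 0, ∀ᶠ k in atTop, ∀ u v, Cross (ζ k) u v →
      |inner ℝ (deriv (ζ k) u) (deriv (ζ k) v)| ≤ ε) : IsStraightGeneric η Γ := by
  have hcd : Continuous (deriv Γ) := hΓ.contDiff.continuous_deriv le_rfl
  have hc : Continuous Γ := hΓ.contDiff.continuous
  have hunit : ∀ x, ‖deriv Γ x‖ = 1 := fun x => by
    have h1 := (hlim.2.tendsto_at x).norm
    simp only [(hζ _).unit] at h1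
    exact tendsto_nhds_unique h1 tendsto_const_nhds
  have horth : ∀ x y, Cross Γ x y → inner ℝ (deriv Γ x) (deriv Γ y) = 0 := fun x y =>
    inner_eq_zero_of_limit hη hη1 hq hM hζ hΓ hlim hang
  have himm : IsImmersedLoop Γ := ⟨hΓ.periodic, hΓ.contDiff, fun x h0 => by
    have := hunit x
    rw [h0, norm_zero] at this
    exact zero_ne_one this⟩
  refine ⟨IsGeneric.of_cross himm (fun x y hxy => ?_) (fun x y z hxy hyz hxz =>
    not_three_orthogonal (hunit x) (hunit y) (hunit z) (horth x y hxy) (horth y z hyz)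
      (horth x z hxz)), hunit, fun a a' b b' ha hb hk => ?_, fun u v huv x hx => ?_⟩
  · rw [transverseAt_iff]
    intro h0
    have := inner_sq_add_det_sq (deriv Γ x) (deriv Γ y)
    rw [h0, horth x y hxy, hunit, hunit] at this
    norm_num at this
  · obtain ⟨u, u', hu, -, huu⟩ := exists_cross_seq hη hη1 hq hM hζ hlim ha
    obtain ⟨v, v', hv, -, hvv⟩ := exists_cross_seq hη hη1 hq hM hζ hlim hb
    -- Since `a - b` stays away from the integers, the approximating parameters are also distinct
    -- modulo 1, and their gap applies.
    obtain ⟨m, hm0, hm⟩ := exists_dist_int_pos (t := a - b) fun k h => hk k (by linarith)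
    have hsub := hu.sub hv
    refine ge_of_tendsto hsub.abs ?_
    have hnear := hsub.eventually (Metric.ball_mem_nhds (a - b) hm0)
    filter_upwards [huu, hvv, hnear] with k h1 h2 h3
    refine (hζ k).gap _ _ _ _ h1 h2 fun j hj => ?_
    have h4 := hm j
    rw [Real.dist_eq, show u k - v k = j by linarith, abs_sub_comm] at h3
    linarith
  · obtain ⟨u', v', hu, -, huu⟩ := exists_cross_seq hη hη1 hq hM hζ hlim huv
    have h1 : Tendsto (fun k => ζ k (u' k) + (x - u' k) • deriv (ζ k) (u' k)) atTop
        (𝓝 (Γ u + (x - u) • deriv Γ u)) :=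
      (hlim.1.tendsto_comp hc.continuousAt hu).add
        ((tendsto_const_nhds.sub hu).smul (hlim.2.tendsto_comp hcd.continuousAt hu))
    refine tendsto_nhds_unique (hlim.1.tendsto_at x) (h1.congr' ?_)
    have hnear := (tendsto_const_nhds.sub hu).abs.eventually (gt_mem_nhds hx)
    filter_upwards [huu, hnear] with k h2 h3
    exact ((hζ k).straight _ _ h2 x h3).symm

theorem TendstoC1.eventually_close (h : TendstoC1 ζ Γ) {ε : ℝ} (hε : 0 < ε) :
    ∀ᶠ k in atTop, C1Close ε Γ (ζ k) := by
  filter_upwards [Metric.tendstoUniformly_iff.1 h.1 ε hε, Metric.tendstoUniformly_iff.1 h.2 ε hε]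
    with k h1 h2 x
  rw [← dist_eq_norm, ← dist_eq_norm, dist_comm, dist_comm (deriv (ζ k) x)]
  exact ⟨(h1 x).le, (h2 x).le⟩


/-! ### Lower semicontinuity of the energy -/

variable {η q M : ℝ} {ζ : ℕ → ℝ → ℂ} {Γ : ℝ → ℂ}

theorem tendstoUniformly_subseq {f : ℕ → ℝ → ℂ} {g : ℝ → ℂ} (h : TendstoUniformly f g atTop)
    {φ : ℕ → ℕ} (hφ : StrictMono φ) : TendstoUniformly (fun k => f (φ k)) g atTop :=
  fun V hV => hφ.tendsto_atTop.eventually (h V hV)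

theorem countable_cross_params {γ : ℝ → ℂ} (h : IsGeneric γ) :
    {u : ℝ | ∃ v, Cross γ u v}.Countable := by
  have hsub : {u : ℝ | ∃ v, Cross γ u v} ⊆
      ⋃ p ∈ selfIntParams γ, range fun k : ℤ => p + k := by
    rintro u ⟨v, huv⟩
    simp only [mem_iUnion]
    exact ⟨_, huv.fract_mem_selfIntParams h.immersed.periodic, ⌊u⌋, Int.fract_add_floor u⟩
  exact (h.finite_selfIntParams.countable.biUnion fun p _ => countable_range _).mono hsub

theorem countable_cutout_sides {γ : ℝ → ℂ} (h : IsGeneric γ) (η : ℝ) :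
    {x : ℝ | ∃ u v, Cross γ u v ∧ |x - u| = η}.Countable := by
  have hsub : {x : ℝ | ∃ u v, Cross γ u v ∧ |x - u| = η} ⊆
      (fun u => u + η) '' {u : ℝ | ∃ v, Cross γ u v} ∪
      (fun u => u - η) '' {u : ℝ | ∃ v, Cross γ u v} := by
    rintro x ⟨u, v, huv, hx⟩
    rcases abs_cases (x - u) with ⟨e, -⟩ | ⟨e, -⟩
    · exact Or.inl ⟨u, ⟨v, huv⟩, by simp only; linarith⟩
    · exact Or.inr ⟨u, ⟨v, huv⟩, by simp only; linarith⟩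
  exact (((countable_cross_params h).image _).union ((countable_cross_params h).image _)).mono hsub

/-- Otherwise crossings of infinitely many `ζ k` near `z` would accumulate at a crossing of Γ in the
closed η-square around `z`. The gap prevents the two parameters from merging. -/
theorem eventually_notMem_cutout (hη : 0 < η)
    (hζ : ∀ k, IsControlled η q M (ζ k)) (hΓ : IsC1Loop Γ) (hlim : TendstoC1 ζ Γ) {z : ℝ × ℝ}
    (hz : ∀ u v, Cross Γ u v → |z.1 - u| ≤ η → |z.2 - v| ≤ η → False) :
    ∀ᶠ k in atTop, z ∉ cutout η (ζ k) := by
  have hc : Continuous Γ := hΓ.contDiff.continuous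
  by_contra hcon
  rw [not_eventually] at hcon
  simp only [not_not] at hcon
  obtain ⟨φ, hφ, hmem⟩ := extraction_of_frequently_atTop hcon
  have hex : ∀ n, ∃ p : ℝ × ℝ, Cross (ζ (φ n)) p.1 p.2 ∧ |z.1 - p.1| < η ∧ |z.2 - p.2| < η :=
    fun n => by
      obtain ⟨u, v, h⟩ := (mem_cutout_iff (hζ (φ n)).periodic (hζ (φ n)).unit).1 (hmem n)
      exact ⟨(u, v), h⟩
  choose p hp using hex
  obtain ⟨⟨u, v⟩, hK, ψ, hψ, hpt⟩ := (isCompact_Icc.prod isCompact_Icc).tendsto_subseq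
    (s := Icc (z.1 - η) (z.1 + η) ×ˢ Icc (z.2 - η) (z.2 + η)) (x := p) fun n => by
      obtain ⟨-, h1, h2⟩ := hp n
      rw [abs_lt] at h1 h2
      exact ⟨⟨by linarith, by linarith⟩, ⟨by linarith, by linarith⟩⟩
  have h1 : Tendsto (fun n => (p (ψ n)).1) atTop (𝓝 u) := (continuous_fst.tendsto _).comp hpt
  have h2 : Tendsto (fun n => (p (ψ n)).2) atTop (𝓝 v) := (continuous_snd.tendsto _).comp hpt
  have hsub := tendstoUniformly_subseq hlim.1 (hφ.comp hψ)
  have h3 := hsub.tendsto_comp hc.continuousAt h1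
  have h4 := hsub.tendsto_comp hc.continuousAt h2
  have heq : Γ u = Γ v := by
    refine tendsto_nhds_unique h3 (h4.congr fun n => ?_)
    exact (hp (ψ n)).1.2.symm
  refine hz u v ⟨fun m hm => ?_, heq⟩ ?_ ?_
  · have h5 : Tendsto (fun n => |(p (ψ n)).1 - ((p (ψ n)).2 + m)|) atTop (𝓝 |u - (v + m)|) :=
      (h1.sub (h2.add_const _)).abs
    have h6 : 2 * η ≤ |u - (v + m)| := by
      refine ge_of_tendsto h5 (Eventually.of_forall fun n => ?_)
      have hcr := (hp (ψ n)).1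
      have hcr' := hcr.symm.add_int (hζ _).periodic m 0
      exact (hζ _).gap _ _ _ _ hcr hcr' fun j hj => hcr.1 (m + j) (by push_cast; linarith)
    rw [hm, sub_self, abs_zero] at h6
    linarith
  · exact abs_le.2 ⟨by linarith [hK.1.2], by linarith [hK.1.1]⟩
  · exact abs_le.2 ⟨by linarith [hK.2.2], by linarith [hK.2.1]⟩

theorem tendsto_offDensity (hη : 0 < η) (hq : 0 < q)
    (hζ : ∀ k, IsControlled η q M (ζ k)) (hΓ : IsStraightGeneric η Γ) (hlim : TendstoC1 ζ Γ)
    {z : ℝ × ℝ} (hz : z ∉ cutout η Γ) (h1 : ∀ u v, Cross Γ u v → |z.1 - u| ≠ η)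
    (h2 : ∀ u v, Cross Γ u v → |z.2 - u| ≠ η) (h3 : ∀ k : ℤ, z.1 ≠ z.2 + k) :
    Tendsto (fun k => offDensity q η (ζ k) z) atTop (𝓝 (offDensity q η Γ z)) := by
  have hmem : ∀ u v, Cross Γ u v → |z.1 - u| ≤ η → |z.2 - v| ≤ η → False :=
    fun u v huv hu hv => hz ((mem_cutout_iff hΓ.periodic hΓ.unit).2
      ⟨u, v, huv, lt_of_le_of_ne hu (h1 u v huv), lt_of_le_of_ne hv (h2 v u huv.symm)⟩)
  have hne : Γ z.2 - Γ z.1 ≠ 0 := fun h0 =>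
    hmem z.1 z.2 ⟨h3, (sub_eq_zero.1 h0).symm⟩ (by rw [sub_self, abs_zero]; exact hη.le)
      (by rw [sub_self, abs_zero]; exact hη.le)
  have hker : Tendsto (fun k => tpKernel (ζ k) z.1 z.2) atTop (𝓝 (tpKernel Γ z.1 z.2)) := by
    have a1 := hlim.1.tendsto_at z.1
    have a2 := hlim.1.tendsto_at z.2
    have a3 := hlim.2.tendsto_at z.2
    have hd := (continuous_det.tendsto (deriv Γ z.2, Γ z.1 - Γ z.2)).comp
      (a3.prodMk_nhds (a1.sub a2))
    have hn : ‖Γ z.2 - Γ z.1‖ ^ 2 ≠ 0 := pow_ne_zero 2 (norm_ne_zero_iff.2 hne)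
    exact (hd.abs.const_mul 2).div ((a2.sub a1).norm.pow 2) hn
  have e : offDensity q η Γ z = ENNReal.ofReal (tpKernel Γ z.1 z.2 ^ q) := indicator_of_mem hz _
  rw [e]
  refine (ENNReal.tendsto_ofReal (hker.rpow_const (Or.inr hq.le))).congr' ?_
  filter_upwards [eventually_notMem_cutout hη hζ hΓ.isC1Loop hlim hmem] with k hk
  have e' : offDensity q η (ζ k) z = ENNReal.ofReal (tpKernel (ζ k) z.1 z.2 ^ q) :=
    indicator_of_mem hk _
  exact e'.symm

/-- Fatou's lemma. The densities converge off the diagonal translates and off finitely or countably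
many lines bounding the cutout squares, a null set. -/
theorem truncatedTP_le_of_limit (hη : 0 < η) (hq : 0 < q)
    (hζ : ∀ k, IsControlled η q M (ζ k)) (hΓ : IsStraightGeneric η Γ) (hlim : TendstoC1 ζ Γ)
    {B : ℝ≥0∞} (hB : ∀ k, truncatedTP q η (ζ k) ≤ B) : truncatedTP q η Γ ≤ B := by
  have hcount := countable_cutout_sides hΓ.generic η
  have hae0 : ∀ᵐ x : ℝ, x ∉ {x : ℝ | ∃ u v, Cross Γ u v ∧ |x - u| = η} :=
    (measure_eq_zero_iff_ae_notMem).1 (hcount.measure_zero volume)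
  have hae1 : ∀ᵐ z : ℝ × ℝ, z.1 ∉ {x : ℝ | ∃ u v, Cross Γ u v ∧ |x - u| = η} :=
    Measure.quasiMeasurePreserving_fst.ae hae0
  have hae2 : ∀ᵐ z : ℝ × ℝ, z.2 ∉ {x : ℝ | ∃ u v, Cross Γ u v ∧ |x - u| = η} :=
    Measure.quasiMeasurePreserving_snd.ae hae0
  have hae3 : ∀ᵐ z : ℝ × ℝ, ∀ k : ℤ, z.1 ≠ z.2 + k := by
    rw [ae_all_iff]
    intro k
    have hm : MeasurableSet {z : ℝ × ℝ | z.1 ≠ z.2 + k} :=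
      (isOpen_ne_fun (by fun_prop) (by fun_prop)).measurableSet
    rw [Measure.volume_eq_prod, Measure.ae_prod_iff_ae_ae hm]
    refine Eventually.of_forall fun x => ?_
    have : ∀ᵐ y : ℝ, y ≠ x - k := by rw [ae_iff]; simp
    filter_upwards [this] with y hy h
    exact hy (by linarith)
  rw [truncatedTP_eq hΓ.isC1Loop hΓ.unit]
  have hle : ∀ᵐ z ∂(volume.restrict (Ico (0 : ℝ) 1 ×ˢ Ico (0 : ℝ) 1)), offDensity q η Γ z ≤
      liminf (fun k => offDensity q η (ζ k) z) atTop := by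
    refine ae_restrict_of_ae ?_
    filter_upwards [hae1, hae2, hae3] with z h1 h2 h3
    by_cases hz : z ∈ cutout η Γ
    · have : offDensity q η Γ z = 0 := indicator_of_notMem (by simpa using hz) _
      rw [this]; exact zero_le
    · exact (tendsto_offDensity hη hq hζ hΓ hlim hz (fun u v huv h => h1 ⟨u, v, huv, h⟩)
        (fun u v huv h => h2 ⟨u, v, huv, h⟩) h3).liminf_eq.ge
  refine (lintegral_mono_ae hle).trans ((lintegral_liminf_le fun k =>
    measurable_offDensity (hζ k).isC1Loop (hζ k).unit q η).trans ?_)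
  refine liminf_le_of_frequently_le' (Frequently.of_forall fun k => ?_)
  rw [← truncatedTP_eq (hζ k).isC1Loop (hζ k).unit]
  exact hB k

/-! ### Sobolev regularity -/

theorem lintegral_Icc_add_periodic {f : ℝ → ℝ≥0∞} (hf : Function.Periodic f 1) (x : ℝ) :
    ∫⁻ w in Icc (-(1 / 2) : ℝ) (1 / 2), f (x + w) = ∫⁻ y in Ico (0 : ℝ) 1, f y := by
  rw [← lintegral_periodic hf (x + -(1 / 2)), ← setLIntegral_congr Ico_ae_eq_Icc,
    ← lintegral_indicator measurableSet_Ico, ← lintegral_indicator measurableSet_Ico,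
    ← lintegral_add_left_eq_self (μ := volume)
      ((Ico (x + -(1 / 2)) (x + -(1 / 2) + 1)).indicator f) x]
  refine lintegral_congr fun w => ?_
  have hiff : w ∈ Ico (-(1 / 2) : ℝ) (1 / 2) ↔ x + w ∈ Ico (x + -(1 / 2)) (x + -(1 / 2) + 1) := by
    simp only [mem_Ico]
    constructor <;> rintro ⟨h1, h2⟩ <;> constructor <;> linarith
  by_cases h : w ∈ Ico (-(1 / 2) : ℝ) (1 / 2)
  · rw [indicator_of_mem h, indicator_of_mem (hiff.1 h)]
  · rw [indicator_of_notMem h, indicator_of_notMem fun h' => h (hiff.2 h')]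

/-- With σ = 1 - 1/q the Gagliardo exponent 1 + σq is just q, so the seminorm of γ' integrates the
q-th power of the difference quotient that the kernel dominates near the diagonal. -/
theorem IsControlled.memSobolevOneAdd {γ : ℝ → ℂ} (h : IsControlled η q M γ) (hη : 0 < η)
    (hη1 : η ≤ 1) (hq : 2 < q) (hM : 0 < M) : MemSobolevOneAdd (1 - 1 / q) q γ := by
  have hcd : Continuous (deriv γ) := h.generic.immersed.continuous_deriv
  have hq0 : 0 < q := by linarith
  refine ⟨h.periodic, deriv γ, ⟨periodic_deriv h.periodic, ?_, ?_⟩, fun x => ?_⟩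
  · exact MemLp.of_bound hcd.aestronglyMeasurable 1 (Eventually.of_forall fun x => (h.unit x).le)
  · obtain ⟨r, hr0, hrη, hr⟩ := exists_modulus hη hη1 hq hM one_pos
    have hm := measurable_offDensity h.isC1Loop h.unit q η
    have hms : Measurable fun z : ℝ × ℝ => offDensity q η γ z.swap := hm.comp measurable_swap
    have hper := offDensity_add_int h.periodic h.unit q η
    have hexp : 1 + (1 - 1 / q) * q = q := by field_simp; ring
    rw [hexp]
    -- For short `w` the tangents are controlled by their squares and so by the two kernels; for
    -- longer `w` unit length gives the crude bound 2/r.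
    have hpt : ∀ x w, ENNReal.ofReal (‖deriv γ (x + w) - deriv γ x‖ ^ q / |w| ^ q) ≤
        ENNReal.ofReal (2 ^ q) * (offDensity q η γ (x, x + w) + offDensity q η γ (x + w, x)) +
          ENNReal.ofReal ((2 / r) ^ q) := by
      intro x w
      rw [← Real.div_rpow (norm_nonneg _) (abs_nonneg _)]
      rcases le_total |w| r with hw | hw
      · have hw' : |x + w - x| ≤ r := by rwa [add_sub_cancel_left]
        have h1 := (hr γ h (x + w) x hw').2
        have h2 := h.ofReal_quotient_le hη hη1 hq0 (hw'.trans hrη)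
        rw [add_sub_cancel_left] at h2
        rw [add_comm (offDensity q η γ (x, x + w))]
        refine le_trans (le_trans (ENNReal.ofReal_le_ofReal ?_) h2) le_self_add
        gcongr
      · refine le_trans (ENNReal.ofReal_le_ofReal ?_) le_add_self
        have h1 : ‖deriv γ (x + w) - deriv γ x‖ ≤ 2 := by
          have := norm_sub_le (deriv γ (x + w)) (deriv γ x)
          rw [h.unit, h.unit] at this
          linarith
        gcongr
    have hinner : ∀ x, ∫⁻ w in Icc (-(1 / 2) : ℝ) (1 / 2),
        ENNReal.ofReal (‖deriv γ (x + w) - deriv γ x‖ ^ q / |w| ^ q) ≤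
        ENNReal.ofReal (2 ^ q) * ((∫⁻ y in Ico (0 : ℝ) 1, offDensity q η γ (x, y)) +
          ∫⁻ y in Ico (0 : ℝ) 1, offDensity q η γ (y, x)) + ENNReal.ofReal ((2 / r) ^ q) := by
      intro x
      have p1 : Function.Periodic (fun y => offDensity q η γ (x, y)) 1 := fun y => by
        simpa using hper x y 0 1
      have p2 : Function.Periodic (fun y => offDensity q η γ (y, x)) 1 := fun y => by
        simpa using hper y x 1 0
      have m1 : Measurable fun w => offDensity q η γ (x, x + w) := hm.comp (by fun_prop)
      have m2 : Measurable fun w => offDensity q η γ (x + w, x) := hm.comp (by fun_prop)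
      refine (lintegral_mono fun w => hpt x w).trans ?_
      rw [lintegral_add_right _ measurable_const, lintegral_const_mul' _ _ ENNReal.ofReal_ne_top,
        lintegral_add_left m1, lintegral_Icc_add_periodic p1, lintegral_Icc_add_periodic p2,
        setLIntegral_const, Real.volume_Icc]
      norm_num
    have htp : ∫⁻ x in Ico (0 : ℝ) 1, ∫⁻ y in Ico (0 : ℝ) 1, offDensity q η γ (x, y) =
        truncatedTP q η γ := by
      rw [truncatedTP_eq h.isC1Loop h.unit, Measure.volume_eq_prod, ← Measure.prod_restrict,
        lintegral_prod _ hm.aemeasurable]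
    have htp' : ∫⁻ x in Ico (0 : ℝ) 1, ∫⁻ y in Ico (0 : ℝ) 1, offDensity q η γ (y, x) =
        truncatedTP q η γ := by
      rw [truncatedTP_eq h.isC1Loop h.unit, ← lintegral_square_swap (offDensity q η γ),
        Measure.volume_eq_prod, ← Measure.prod_restrict, lintegral_prod _ hms.aemeasurable]
      rfl
    have hfin : truncatedTP q η γ < ∞ := h.energy.trans_lt ENNReal.ofReal_lt_top
    refine lt_of_le_of_lt (lintegral_mono fun x => hinner x) ?_
    have m3 : Measurable fun x => ∫⁻ y in Ico (0 : ℝ) 1, offDensity q η γ (x, y) :=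
      hm.lintegral_prod_right'
    rw [lintegral_add_right _ measurable_const, lintegral_const_mul' _ _ ENNReal.ofReal_ne_top,
      lintegral_add_left m3, htp, htp', setLIntegral_const]
    refine ENNReal.add_lt_top.2 ⟨ENNReal.mul_lt_top ENNReal.ofReal_lt_top
      (ENNReal.add_lt_top.2 ⟨hfin, hfin⟩), ENNReal.mul_lt_top ENNReal.ofReal_lt_top (by simp)⟩
  · rw [intervalIntegral.integral_deriv_eq_sub (fun t _ => h.isC1Loop.differentiable t)
      (hcd.intervalIntegrable _ _)]
    ring

/-! ### The compactness theorem -/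

/-- Joins equicontinuity, survival of the structure of crossings, stability and lower
semicontinuity. Translations do not change the energy, so its bounds need no adjustment. -/
theorem IsCompartment.exists_limit {jp jm s ω : ℤ} {C : Set (ℝ → ℂ)}
    (hC : IsCompartment jp jm s ω C) (hη : 0 < η) (hη1 : η ≤ 1) (hq : 2 < q) (hM : 0 < M)
    {ξ : ℕ → ℝ → ℂ} (hξ : ∀ k, ξ k ∈ admissible η jp jm s ω ∩ C)
    (hE : ∀ k, truncatedTP q η (ξ k) ≤ ENNReal.ofReal M)
    (hang : ∀ ε > 0, ∀ᶠ k in atTop, ∀ u v, Cross (ξ k) u v →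
      |inner ℝ (deriv (ξ k) u) (deriv (ξ k) v)| ≤ ε) :
    ∃ Γ ∈ admissible η jp jm s ω ∩ C, RightAngled Γ ∧ MemSobolevOneAdd (1 - 1 / q) q Γ ∧
      (∃ (φ : ℕ → ℕ) (c : ℕ → ℂ), StrictMono φ ∧ TendstoC1 (fun k x => ξ (φ k) x + c k) Γ) ∧
      ∀ B, (∀ k, truncatedTP q η (ξ k) ≤ B) → truncatedTP q η Γ ≤ B := by
  have hsg : ∀ k, IsStraightGeneric η (ξ k) := fun k => ((mem_admissible_iff hη).1 (hξ k).1).2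
  -- The first curves may still have bad angles; they are dropped so that one angle bound holds
  -- uniformly.
  obtain ⟨N, hN⟩ := eventually_atTop.1 (hang (1 / 2) (by norm_num))
  have hctl : ∀ k, IsControlled η q M (ξ (k + N)) := fun k =>
    ⟨hsg _, hN _ (Nat.le_add_left N k), hE _⟩
  obtain ⟨φ, c, Γ, hφ, hΓ, hlim⟩ := exists_tendstoC1 (ξ := fun k => ξ (k + N))
    (fun k => (hsg _).isC1Loop) (fun k x => ((hsg _).unit x).le) fun ε hε => by
      obtain ⟨r, hr0, -, hr⟩ := exists_modulus hη hη1 hq hM hε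
      exact ⟨r, hr0, fun k x y hxy => (hr _ (hctl k) x y hxy).1⟩
  set ζ : ℕ → ℝ → ℂ := fun k x => ξ (φ k + N) x + c k with hζdef
  have hζ : ∀ k, IsControlled η q M (ζ k) := fun k => (hctl (φ k)).add_const (c k)
  have hstrict : StrictMono fun k => φ k + N := fun a b hab => Nat.add_lt_add_right (hφ hab) N
  have hangζ : ∀ ε > 0, ∀ᶠ k in atTop, ∀ u v, Cross (ζ k) u v →
      |inner ℝ (deriv (ζ k) u) (deriv (ζ k) v)| ≤ ε := fun ε hε => by
    filter_upwards [hstrict.tendsto_atTop.eventually (hang ε hε)] with k hk u v huv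
    simp only [hζdef, deriv_add_const_fun]
    exact hk u v (cross_add_const.1 huv)
  have hΓsg := isStraightGeneric_of_limit hη hη1 hq hM hζ hΓ hlim hangζ
  have horth : ∀ x y, Cross Γ x y → inner ℝ (deriv Γ x) (deriv Γ y) = 0 := fun x y =>
    inner_eq_zero_of_limit hη hη1 hq hM hζ hΓ hlim hangζ
  have hlsc : ∀ B, (∀ k, truncatedTP q η (ξ k) ≤ B) → truncatedTP q η Γ ≤ B := fun B hB =>
    truncatedTP_le_of_limit hη (by linarith) hζ hΓsg hlim fun k => by
      simp only [hζdef]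
      rw [truncatedTP_add_const (hsg _)]
      exact hB _
  have hΓC : Γ ∈ C := by
    obtain ⟨ε, hε, H⟩ := hC.exists_mem_of_close hΓsg.generic
    obtain ⟨k, hk⟩ := (hlim.eventually_close hε).exists
    exact H (ζ k) Γ (hC.add_const (hξ _).2 _) hk hΓ (C1Close.refl hε.le Γ)
  refine ⟨Γ, ⟨(mem_admissible_iff hη).2 ⟨hC.subset hΓC, hΓsg⟩, hΓC⟩,
    (rightAngled_iff hΓ.periodic).2 horth, ?_, ⟨_, c, hstrict, hlim⟩, hlsc⟩
  have hΓctl : IsControlled η q M Γ :=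
    ⟨hΓsg, fun u v huv => by rw [horth u v huv, abs_zero]; norm_num, hlsc _ hE⟩
  exact hΓctl.memSobolevOneAdd hη hη1 hq hM


/-! ### Finite energy of `C^{1,1}` curves -/

variable {η q : ℝ}

/-- Taylor: the distance to the tangent line is at most L|x - y|² and the chord is at least |x -
y|/2, which gives 2L/(1/2)² = 8L. -/
theorem tpKernel_le_near {β : ℝ → ℂ} (hβ : IsC1Loop β) (hu : ∀ x, ‖deriv β x‖ = 1) {L : ℝ}
    (hL : 0 < L) (hlip : ∀ x y, ‖deriv β x - deriv β y‖ ≤ L * |x - y|) {x y : ℝ}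
    (hxy : |x - y| ≤ 1 / (2 * L)) : tpKernel β x y ≤ 8 * L := by
  rcases eq_or_ne x y with rfl | hne
  · simp only [tpKernel, sub_self, norm_zero]
    norm_num
    exact hL.le
  have h0 : 0 < |x - y| := abs_pos.2 (sub_ne_zero.2 hne)
  have h1 := norm_sub_sub_le hβ.differentiable (x := y) (y := x) (v := deriv β y)
    (c := L * |x - y|) fun t ht => (hlip t y).trans (by
      have := abs_sub_left_of_mem_uIcc ht
      gcongr)
  set e := β x - β y - (x - y) • deriv β y with he
  have h2 : det (deriv β y) (β x - β y) = det (deriv β y) e := by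
    rw [he, det_sub_right _ (β x - β y), det_smul_right, det_self, mul_zero, sub_zero]
  have h3 := abs_det_le (deriv β y) e
  rw [hu, one_mul] at h3
  have h4 : L * |x - y| ≤ 1 / 2 := by
    have := mul_le_mul_of_nonneg_left hxy hL.le
    rwa [show L * (1 / (2 * L)) = 1 / 2 by field_simp] at this
  have h5 : |x - y| / 2 ≤ ‖β x - β y‖ := by
    have h6 := norm_sub_norm_le ((x - y) • deriv β y) (β x - β y)
    rw [norm_smul, hu, mul_one, Real.norm_eq_abs, norm_sub_rev ((x - y) • deriv β y), ← he] at h6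
    nlinarith
  unfold tpKernel
  rw [h2, norm_sub_rev, div_le_iff₀ (by nlinarith)]
  have h7 : (|x - y| / 2) ^ 2 ≤ ‖β x - β y‖ ^ 2 := by gcongr
  nlinarith

theorem tpKernel_le_far {β : ℝ → ℂ} (hu : ∀ x, ‖deriv β x‖ = 1) {m : ℝ} (hm : 0 < m) {x y : ℝ}
    (hxy : m ≤ ‖β x - β y‖) : tpKernel β x y ≤ 2 / m := by
  have h1 := abs_det_le (deriv β y) (β x - β y)
  rw [hu, one_mul] at h1
  have h0 : 0 < ‖β x - β y‖ := hm.trans_le hxy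
  unfold tpKernel
  rw [norm_sub_rev, div_le_div_iff₀ (by positivity) hm]
  nlinarith [mul_le_mul_of_nonneg_left hxy h0.le]

/-- The kernel is bounded off the cutout: near the diagonal by the Lipschitz bound on the tangent,
elsewhere because compactness keeps the points of the curve apart. -/
theorem IsStraightGeneric.truncatedTP_lt_top {β : ℝ → ℂ} (h : IsStraightGeneric η β)
    (hη : 0 < η) (hq : 0 ≤ q) (hlip : ∃ K, LipschitzWith K (deriv β)) :
    truncatedTP q η β < ∞ := by
  obtain ⟨K, hK⟩ := hlip
  set L : ℝ := K + 1 with hLdef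
  have hL : 0 < L := by positivity
  have hlip : ∀ x y, ‖deriv β x - deriv β y‖ ≤ L * |x - y| := fun x y => by
    have := hK.dist_le_mul x y
    rw [dist_eq_norm, Real.dist_eq] at this
    exact this.trans (by gcongr; rw [hLdef]; linarith)
  have hcont : Continuous β := h.isC1Loop.contDiff.continuous
  set S : Set (ℝ × ℝ) := (Icc 0 1 ×ˢ Icc 0 1) ∩
    ((cutout η β)ᶜ ∩ ⋂ k : ℤ, {z : ℝ × ℝ | 1 / (2 * L) ≤ |z.1 - z.2 - k|}) with hS
  have hScomp : IsCompact S := by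
    refine (isCompact_Icc.prod isCompact_Icc).inter_right
      ((isOpen_cutout h.periodic h.unit η).isClosed_compl.inter (isClosed_iInter fun k => ?_))
    exact isClosed_le continuous_const (by fun_prop)
  obtain ⟨m, hm0, hm⟩ := hScomp.exists_forall_le' (f := fun z : ℝ × ℝ => ‖β z.1 - β z.2‖) (a := 0)
    (Continuous.continuousOn (by fun_prop)) fun z hz => by
      refine norm_pos_iff.2 (sub_ne_zero.2 fun heq => hz.2.1 ?_)
      refine (mem_cutout_iff h.periodic h.unit).2 ⟨z.1, z.2, ⟨fun k hk => ?_, heq⟩, ?_, ?_⟩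
      · have := mem_iInter.1 hz.2.2 k
        simp only [mem_ofPred_eq] at this
        rw [hk, add_sub_cancel_left, sub_self, abs_zero] at this
        have h2 : 0 < 1 / (2 * L) := by positivity
        linarith
      · rwa [sub_self, abs_zero]
      · rwa [sub_self, abs_zero]
  rw [truncatedTP_eq h.isC1Loop h.unit]
  have hbd : ∀ z ∈ Ico (0 : ℝ) 1 ×ˢ Ico (0 : ℝ) 1,
      offDensity q η β z ≤ ENNReal.ofReal (max (8 * L) (2 / m) ^ q) := by
    intro z hz
    by_cases hcut : z ∈ cutout η β
    · have : offDensity q η β z = 0 := indicator_of_notMem (by simpa using hcut) _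
      rw [this]; exact zero_le
    · have e : offDensity q η β z = ENNReal.ofReal (tpKernel β z.1 z.2 ^ q) :=
        indicator_of_mem hcut _
      rw [e]
      refine ENNReal.ofReal_le_ofReal (Real.rpow_le_rpow (tpKernel_nonneg _ _ _) ?_ hq)
      by_cases hnear : ∃ k : ℤ, |z.1 - z.2 - k| < 1 / (2 * L)
      · obtain ⟨k, hk⟩ := hnear
        refine le_max_of_le_left ?_
        have := tpKernel_le_near h.isC1Loop h.unit hL hlip (x := z.1) (y := z.2 + k)
          (by rw [← sub_sub]; exact hk.le)
        have e2 := tpKernel_add_int h.periodic z.1 z.2 0 k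
        rw [Int.cast_zero, add_zero] at e2
        rwa [e2] at this
      · push Not at hnear
        refine le_max_of_le_right (tpKernel_le_far h.unit hm0 (hm z ⟨?_, hcut, mem_iInter.2 hnear⟩))
        exact ⟨Ico_subset_Icc_self hz.1, Ico_subset_Icc_self hz.2⟩
  refine lt_of_le_of_lt (setLIntegral_mono' (measurableSet_Ico.prod measurableSet_Ico) hbd) ?_
  rw [setLIntegral_const, Measure.volume_eq_prod, Measure.prod_prod, Real.volume_Ico]
  exact ENNReal.mul_lt_top ENNReal.ofReal_lt_top (by simp)

/-! ### Comparison with right-angled curves -/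

variable {δ : ℝ}

theorem IsStraightGeneric.inner_sq_lt_one {γ : ℝ → ℂ} (h : IsStraightGeneric η γ) {u v : ℝ}
    (huv : Cross γ u v) : inner ℝ (deriv γ u) (deriv γ v) ^ 2 < 1 := by
  have h1 := inner_sq_add_det_sq (deriv γ u) (deriv γ v)
  rw [h.unit, h.unit] at h1
  have h2 := transverseAt_iff.1 (h.generic.transverse_of_cross huv)
  have h3 : 0 < det (deriv γ u) (deriv γ v) ^ 2 := by positivity
  linarith

theorem IsStraightGeneric.truncatedTP_of_rightAngled {γ : ℝ → ℂ} (h : IsStraightGeneric η γ)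
    (hr : RightAngled γ) (hδ : δ ≤ η) :
    truncatedTP q δ γ = truncatedTP q η γ + (crossPairs γ).ncard • crossEnergy q δ η 0 := by
  rw [truncatedTP_split h hδ, ncard_eq_toFinset_card _ h.generic.finite_crossPairs,
    ← Finset.sum_const]
  congr 1
  refine Finset.sum_congr rfl fun p hp => ?_
  rw [(rightAngled_iff h.periodic).1 hr _ _
    (cross_of_mem_crossPairs (h.generic.finite_crossPairs.mem_toFinset.1 hp))]

theorem crossEnergy_zero_le {c : ℝ} (hq : 2 < q) (hc : c ^ 2 < 1) :
    crossEnergy q δ η 0 ≤ crossEnergy q δ η c :=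
  le_self_add.trans (crossEnergy_ge hq hc)

theorem IsStraightGeneric.le_truncatedTP {γ : ℝ → ℂ} (h : IsStraightGeneric η γ) (hq : 2 < q)
    (hδ : δ ≤ η) :
    truncatedTP q η γ + (crossPairs γ).ncard • crossEnergy q δ η 0 ≤ truncatedTP q δ γ := by
  rw [truncatedTP_split h hδ, ncard_eq_toFinset_card _ h.generic.finite_crossPairs,
    ← Finset.sum_const]
  gcongr with p hp
  exact crossEnergy_zero_le hq (h.inner_sq_lt_one
    (cross_of_mem_crossPairs (h.generic.finite_crossPairs.mem_toFinset.1 hp)))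

/-- One chosen crossing keeps its excess over the right angle; all others are estimated by the
right-angled energy. -/
theorem IsStraightGeneric.shell_le_truncatedTP {γ : ℝ → ℂ} (h : IsStraightGeneric η γ)
    (hq : 2 < q) (hδ : δ ≤ η) {u v : ℝ} (huv : Cross γ u v) :
    (∫⁻ s, shellDensity q δ η s) *
        ENNReal.ofReal (√(1 - inner ℝ (deriv γ u) (deriv γ v) ^ 2) ^ (1 - q) - 1) +
      (crossPairs γ).ncard • crossEnergy q δ η 0 ≤ truncatedTP q δ γ := by
  have hpd := periodic_deriv h.periodic
  have hp := huv.fract_mem h.periodic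
  rw [← periodic_fract hpd u, ← periodic_fract hpd v]
  set p : ℝ × ℝ := (Int.fract u, Int.fract v) with hpdef
  have hpc := h.generic.finite_crossPairs.mem_toFinset.2 hp
  have h2 : ∀ p' ∈ h.generic.finite_crossPairs.toFinset,
      inner ℝ (deriv γ p'.1) (deriv γ p'.2) ^ 2 < 1 := fun p' hp' => h.inner_sq_lt_one
    (cross_of_mem_crossPairs (h.generic.finite_crossPairs.mem_toFinset.1 hp'))
  rw [truncatedTP_split h hδ, ncard_eq_toFinset_card _ h.generic.finite_crossPairs,
    ← Finset.sum_const, ← Finset.add_sum_erase _ _ hpc, ← Finset.add_sum_erase _ _ hpc,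
    ← add_assoc, add_comm ((∫⁻ s, shellDensity q δ η s) * _)]
  refine (add_le_add (crossEnergy_ge hq (h2 p hpc)) (Finset.sum_le_sum fun p' hp' =>
    crossEnergy_zero_le hq (h2 p' (Finset.mem_of_mem_erase hp')))).trans le_add_self

/-- Both curves have equally many crossings, and the right-angled crossing energies are finite for δ
> 0, so they may be cancelled. What remains is an inequality at the fixed scale η. The slack `E` is
0 for minimizers and positive in the argument for almost minimality. -/
theorem IsStraightGeneric.compare {γ ζ : ℝ → ℂ} (h : IsStraightGeneric η γ)
    (hζ : IsStraightGeneric η ζ) (hζr : RightAngled ζ)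
    (hcard : (crossPairs γ).ncard = (crossPairs ζ).ncard) (hq : 2 < q) (hδ0 : 0 < δ) (hδ : δ ≤ η)
    {E : ℝ≥0∞} (hle : truncatedTP q δ γ + E ≤ truncatedTP q δ ζ) :
    truncatedTP q η γ + E ≤ truncatedTP q η ζ ∧ ∀ u v, Cross γ u v →
      (∫⁻ s, shellDensity q δ η s) *
        ENNReal.ofReal (√(1 - inner ℝ (deriv γ u) (deriv γ v) ^ 2) ^ (1 - q) - 1) ≤
          truncatedTP q η ζ := by
  have hfin : (crossPairs ζ).ncard • crossEnergy q δ η 0 ≠ ∞ := by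
    rw [nsmul_eq_mul]
    exact ENNReal.mul_ne_top (ENNReal.natCast_ne_top _) (crossEnergy_zero_lt_top hq hδ0).ne
  rw [hζ.truncatedTP_of_rightAngled hζr hδ] at hle
  constructor
  · refine ENNReal.le_of_add_le_add_right hfin (le_trans ?_ hle)
    rw [add_right_comm, ← hcard]
    gcongr
    exact h.le_truncatedTP hq hδ
  · intro u v huv
    refine ENNReal.le_of_add_le_add_right hfin (le_trans ?_ (le_self_add.trans hle))
    rw [← hcard]
    exact h.shell_le_truncatedTP hq hδ huv

/-- The radial factor is at least a multiple of δ^(2-q), so a bounded product forces the angular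
excess to 0 and hence the sine to 1. -/
theorem exists_angle_bound (hq : 2 < q) (η B : ℝ) {ε : ℝ} (hε : 0 < ε) :
    ∃ δ₀ > 0, ∀ δ, 0 < δ → δ ≤ δ₀ → δ ≤ η / 2 → ∀ c : ℝ, c ^ 2 < 1 →
      (∫⁻ s, shellDensity q δ η s) * ENNReal.ofReal (√(1 - c ^ 2) ^ (1 - q) - 1) ≤
        ENNReal.ofReal B → |c| ≤ ε := by
  set e := min ε (1 / 2) with he
  have he0 : 0 < e := by positivity
  have he1 : e ^ 2 < 1 := by
    have : e ≤ 1 / 2 := min_le_right _ _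
    nlinarith
  set τ := √(1 - e ^ 2) with hτ
  have hτ0 : 0 < τ := Real.sqrt_pos.2 (by linarith)
  have hτ1 : τ < 1 := by
    rw [hτ, Real.sqrt_lt' one_pos]
    nlinarith
  set κ := τ ^ (1 - q) - 1 with hκ
  have hκ0 : 0 < κ := sub_pos.2 (Real.one_lt_rpow_of_pos_of_lt_one_of_neg hτ0 hτ1 (by linarith))
  set K := (|B| + 1) / (2 ^ (1 - q) * κ) with hK
  have hK0 : 0 < K := by positivity
  have hq2 : 2 - q ≠ 0 := by linarith
  refine ⟨K ^ (1 / (2 - q)), by positivity, fun δ hδ0 hδ hδη c hc hle => ?_⟩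
  by_contra! hcon
  have h1 : K ≤ δ ^ (2 - q) := by
    have := Real.rpow_le_rpow_of_nonpos hδ0 hδ (show 2 - q ≤ 0 by linarith)
    rwa [← Real.rpow_mul hK0.le, one_div_mul_cancel hq2, Real.rpow_one] at this
  have h2 : κ ≤ √(1 - c ^ 2) ^ (1 - q) - 1 := by
    rw [hκ]
    gcongr 1
    refine Real.rpow_le_rpow_of_nonpos (Real.sqrt_pos.2 (by linarith)) ?_ (by linarith)
    refine Real.sqrt_le_sqrt ?_
    have h3 : e ≤ |c| := (min_le_left _ _).trans hcon.le
    have h4 : e ^ 2 ≤ |c| ^ 2 := by gcongr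
    rw [sq_abs] at h4
    linarith
  have h5 : ENNReal.ofReal (2 ^ (1 - q) * δ ^ (2 - q) * κ) ≤ ENNReal.ofReal B := by
    refine le_trans ?_ hle
    rw [ENNReal.ofReal_mul (by positivity)]
    gcongr
    exact lintegral_shellDensity_ge hq hδ0 hδη
  have h6 : |B| + 1 ≤ 2 ^ (1 - q) * δ ^ (2 - q) * κ := by
    rw [hK, div_le_iff₀ (by positivity)] at h1
    linarith
  have h7 := h5.trans (ENNReal.ofReal_le_ofReal (le_abs_self B))
  rw [ENNReal.ofReal_le_ofReal_iff (abs_nonneg B)] at h7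
  linarith

/-- A sequence of curves with almost as little energy as a right-angled curve converges to a
right-angled curve. -/
theorem IsCompartment.exists_limit_of_compare {jp jm s ω : ℤ} {C : Set (ℝ → ℂ)}
    (hC : IsCompartment jp jm s ω C) (hη : 0 < η) (hη1 : η ≤ 1) (hq : 2 < q)
    {ζ : ℝ → ℂ} (hζ : ζ ∈ admissible η jp jm s ω ∩ C) (hζr : RightAngled ζ)
    (hζE : truncatedTP q η ζ < ∞) {δ : ℕ → ℝ} (hδ : ∀ k, δ k ∈ Ioc (0 : ℝ) (η / 2))
    (hδ0 : Tendsto δ atTop (𝓝 0)) {ξ : ℕ → ℝ → ℂ} (hξ : ∀ k, ξ k ∈ admissible η jp jm s ω ∩ C)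
    (hle : ∀ k, truncatedTP q (δ k) (ξ k) ≤ truncatedTP q (δ k) ζ) :
    ∃ Γ ∈ admissible η jp jm s ω ∩ C, RightAngled Γ ∧ MemSobolevOneAdd (1 - 1 / q) q Γ ∧
      (∃ (φ : ℕ → ℕ) (c : ℕ → ℂ), StrictMono φ ∧ TendstoC1 (fun k x => ξ (φ k) x + c k) Γ) ∧
      ∀ B, (∀ k, truncatedTP q η (ξ k) ≤ B) → truncatedTP q η Γ ≤ B := by
  have hsg : ∀ {γ}, γ ∈ admissible η jp jm s ω ∩ C → IsStraightGeneric η γ :=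
    fun h => ((mem_admissible_iff hη).1 h.1).2
  set M := (truncatedTP q η ζ).toReal + 1 with hM
  have hM0 : 0 < M := by positivity
  have hζM : truncatedTP q η ζ ≤ ENNReal.ofReal M := by
    rw [← ENNReal.ofReal_toReal hζE.ne]
    exact ENNReal.ofReal_le_ofReal (by linarith)
  have hcmp := fun k => (hsg (hξ k)).compare (hsg hζ) hζr (hC.ncard_eq (hξ k).2 hζ.2) hq
    (hδ k).1 (by linarith [(hδ k).2]) (E := 0) (by rw [add_zero]; exact hle k)
  refine hC.exists_limit hη hη1 hq hM0 hξ (fun k => ?_) fun ε hε => ?_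
  · have := (hcmp k).1
    rw [add_zero] at this
    exact this.trans hζM
  · obtain ⟨δ₀, hδ₀, H⟩ := exists_angle_bound hq η M hε
    filter_upwards [hδ0.eventually (gt_mem_nhds hδ₀)] with k hk u v huv
    exact H (δ k) (hδ k).1 hk.le (hδ k).2 _ ((hsg (hξ k)).inner_sq_lt_one huv)
      (((hcmp k).2 u v huv).trans hζM)

end ArnoldLoop

/-! ### The main theorem -/

theorem theorem1p5 (jp jm s ω : ℤ) (C : Set (ℝ → ℂ)) (hC : IsCompartment jp jm s ω C) :
    (∃ η₁ : ℝ, IsRightAngleThreshold jp jm s ω C η₁) ∧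
    ∀ η₁ : ℝ, IsRightAngleThreshold jp jm s ω C η₁ →
    ∀ q : ℝ, 2 < q → ∀ η ∈ Ioc (0 : ℝ) η₁,
    ∀ (δ : ℕ → ℝ) (γ : ℕ → ℝ → ℂ), (∀ k, δ k ∈ Ioc (0 : ℝ) (η / 2)) → Tendsto δ atTop (𝓝 0) →
      (∀ k, IsTPMinimizer q (δ k) (admissible η jp jm s ω ∩ C) (γ k)) →
      ∃ Γ ∈ admissible η jp jm s ω ∩ C,
        MemSobolevOneAdd (1 - 1 / q) q Γ ∧
        (∃ (φ : ℕ → ℕ) (c : ℕ → ℂ), StrictMono φ ∧ TendstoC1 (fun k x => γ (φ k) x + c k) Γ) ∧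
        RightAngled Γ ∧
        ∀ ε : ℝ, 0 < ε → ∃ δ₀ : ℝ, 0 < δ₀ ∧ ∀ δ' ∈ Ioo (0 : ℝ) δ₀,
          (⨅ ξ ∈ admissible η jp jm s ω ∩ C, truncatedTP q δ' ξ) ≤ truncatedTP q δ' Γ ∧
          truncatedTP q δ' Γ <
            (⨅ ξ ∈ admissible η jp jm s ω ∩ C, truncatedTP q δ' ξ) + ENNReal.ofReal ε := by
  refine ⟨hC.exists_rightAngleThreshold, fun η₁ hη₁ q hq η hη δ γ hδ hδ0 hmin => ?_⟩
  have hη0 : 0 < η := hη.1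
  have hη1 : η ≤ 1 := hη.2.trans hη₁.1.2.le
  set A := admissible η jp jm s ω ∩ C with hA
  have hsg : ∀ {ξ}, ξ ∈ A → IsStraightGeneric η ξ := fun h => ((mem_admissible_iff hη0).1 h.1).2
  -- Class C^{1,1} makes the energy of this right-angled competitor at scale η finite, which bounds
  -- that of all minimizers.
  obtain ⟨β, hβ, hβlip, hβr⟩ := hη₁.2 η hη
  have hβE := (hsg hβ).truncatedTP_lt_top hη0 (show 0 ≤ q by linarith) hβlip
  obtain ⟨Γ, hΓ, hΓr, hΓs, hconv, hlsc⟩ := hC.exists_limit_of_compare hη0 hη1 hq hβ hβr hβE hδ hδ0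
    (fun k => (hmin k).1) fun k => (hmin k).2 β hβ
  -- The limit minimizes TP_η among right-angled curves: each minimizer is no worse at scale η than
  -- any such curve, and the limit inherits this by semicontinuity.
  have hbest : ∀ ζ ∈ A, RightAngled ζ → truncatedTP q η Γ ≤ truncatedTP q η ζ := by
    intro ζ hζ hζr
    refine hlsc _ fun k => ?_
    have := ((hsg (hmin k).1).compare (hsg hζ) hζr (hC.ncard_eq (hmin k).1.2 hζ.2) hq
      (hδ k).1 (by linarith [(hδ k).2]) (E := 0) (by rw [add_zero]; exact (hmin k).2 ζ hζ)).1
    rwa [add_zero] at this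
  have hΓE : truncatedTP q η Γ < ∞ := (hbest β hβ hβr).trans_lt hβE
  refine ⟨Γ, hΓ, hΓs, hconv, hΓr, fun ε hε => ?_⟩
  by_contra! hcon
  have hinf : ∀ δ', (⨅ ξ ∈ A, truncatedTP q δ' ξ) ≤ truncatedTP q δ' Γ := fun δ' =>
    iInf₂_le Γ hΓ
  -- Half of `ε` is spent on choosing a near-minimizer, the other half remains as the fixed energy
  -- gap.
  set E := ENNReal.ofReal (ε / 2) with hE
  have hE0 : 0 < E := ENNReal.ofReal_pos.2 (by positivity)
  have hEE : ENNReal.ofReal ε = E + E := by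
    rw [hE, ← ENNReal.ofReal_add (by positivity) (by positivity), add_halves]
  have hseq : ∀ j : ℕ, ∃ p : ℝ × (ℝ → ℂ), p.1 ∈ Ioc (0 : ℝ) (η / 2) ∧ p.1 ≤ 1 / ((j : ℝ) + 1) ∧
      p.2 ∈ A ∧ truncatedTP q p.1 p.2 + E ≤ truncatedTP q p.1 Γ := by
    intro j
    obtain ⟨d, hd, h⟩ := hcon (min (η / 2) (1 / ((j : ℝ) + 1))) (by positivity)
    have hdη : d ≤ η / 2 := hd.2.le.trans (min_le_left _ _)
    have h1 := h (hinf d)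
    -- Finiteness of the infimum is needed for adding `E` to be strict in [0,∞].
    have hfin : (⨅ ξ ∈ A, truncatedTP q d ξ) ≠ ∞ := by
      refine ((hinf d).trans_lt ?_).ne
      rw [(hsg hΓ).truncatedTP_of_rightAngled hΓr (by linarith), nsmul_eq_mul]
      exact ENNReal.add_lt_top.2 ⟨hΓE, ENNReal.mul_lt_top (ENNReal.natCast_lt_top _)
        (crossEnergy_zero_lt_top hq hd.1)⟩
    have h2 := ENNReal.lt_add_right hfin hE0.ne'
    simp only [iInf_lt_iff] at h2
    obtain ⟨ξ, hξ, h3⟩ := h2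
    refine ⟨(d, ξ), ⟨hd.1, hdη⟩, hd.2.le.trans (min_le_right _ _), hξ, ?_⟩
    refine le_trans ?_ h1
    rw [hEE, ← add_assoc]
    gcongr
  choose p hp hpj hpA hpE using hseq
  have hcmp := fun j => ((hsg (hpA j)).compare (hsg hΓ) hΓr (hC.ncard_eq (hpA j).2 hΓ.2) hq
    (hp j).1 (by linarith [(hp j).2]) (hpE j)).1
  obtain ⟨ξ, hξ, hξr, -, -, hξlsc⟩ := hC.exists_limit_of_compare hη0 hη1 hq hΓ hΓr hΓE hp
    (squeeze_zero (fun j => (hp j).1.le) hpj tendsto_one_div_add_atTop_nhds_zero_nat) hpA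
    fun j => le_self_add.trans (hpE j)
  -- The gap survives the limit because it is already a gap at the fixed scale η. So `ξ` is
  -- right-angled and beats Γ by `E`, against `hbest`.
  have h1 := hξlsc (truncatedTP q η Γ - E) fun j => ENNReal.le_sub_of_add_le_right
    ENNReal.ofReal_ne_top (hcmp j)
  have h2 : E ≤ truncatedTP q η Γ := le_add_self.trans (hcmp 0)
  have h3 : truncatedTP q η Γ + E ≤ truncatedTP q η Γ := by
    calc truncatedTP q η Γ + E ≤ truncatedTP q η Γ - E + E := by
          gcongr
          exact (hbest ξ hξ hξr).trans h1
      _ = truncatedTP q η Γ := tsub_add_cancel_of_le h2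
  exact absurd h3 (not_le.2 (ENNReal.lt_add_right hΓE.ne hE0.ne'))
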